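/- Let $M$ be a smooth $n$-manifold (Hausdorff, $\sigma$-compact, without boundary) and $\mathcal V=M\times\mathbb R$ with smooth Lorentzian metrics $g$ and $\tilde g$ of signature $(+,-,\dots,-)$ (Jordan and Einstein frame) that are conformal, $\tilde g=\Omega^2 g$ with $\Omega>0$, and such that the slices $\mathcal M_t=M\times\{t\}$ are spacelike. Let $R$ be the scalar curvature of $g$ and let $f$ be a real function, smooth at the values of $R$, with $f'(R)>0$ there. Put $\phi=\ln f'(R)$, $V=\tfrac12 f'(R)^{-2}\,(R f'(R)-f(R))$ and $$T_{\alpha\beta}(\phi)=\partial_\alpha\phi\,\partial_\beta\phi-\tfrac12\,\tilde g_{\alpha\beta}\,(\tilde g^{\lambda\mu}\partial_\lambda\phi\,\partial_\mu\phi-2V).$$ Let $\tilde T_{\alpha\beta}(\tilde\psi)$ be a smooth symmetric tensor field (the matter stress tensor) such that the Einstein-frame field equations $\tilde G_{\alpha\beta}=T_{\alpha\beta}(\phi)+\tilde T_{\alpha\beta}(\tilde\psi)$ hold, where $\tilde G$ is the Einstein tensor of $\tilde g$. No conservation law is assumed for $T(\phi)$ or $\tilde T(\tilde\psi)$. Let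 $X$ be a smooth vector field and $\tilde X_\alpha=\tilde g_{\alpha\beta}X^\beta$; let $\tilde N$ be the future-directed unit normal of the slices and $d\tilde\mu_t$ their volume element, both with respect to $\tilde g$. For a stress tensor $T$ put $E_t=\int_{\mathcal M_t}\tilde X_\alpha T^{\alpha\beta}\tilde N_\beta\,d\tilde\mu_t$ (indices raised with $\tilde g$), denote by $E_t(\phi)$, $E_t(\tilde\psi)$ the energies of $T(\phi)$, $\tilde T(\tilde\psi)$, and put $E_t(\phi+\tilde\psi)=E_t(\phi)+E_t(\tilde\psi)$. Let $t_0,t_1\in\mathbb R$, and suppose that either $M$ is compact, or the fields fall off at infinity in the following sense: the energies $E_t(\phi)$, $E_t(\tilde\psi)$ exist (as convergent integrals) at $t=t_0,t_1$, and there are smooth compactly supported $\chi_k:M\to[0,1]$, on each compact set equal to $1$ for all large $k$, with $\int_{t_0}^{t_1}\int_{\mathcal M_t}P^\alpha\partial_\alpha\chi_k\,d\tilde\mu\to0$, where $P^\beta=\tilde X_\alpha(T(\phi)+\tilde T(\tilde\psi))^{\alpha\beta}$ and $d\tilde\mu$ is the spacetime volume element of $\tilde g$. Then: 1. the total stress tensor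 is conserved, $\tilde\nabla_\alpha\big(T^{\alpha\beta}(\phi)+\tilde T^{\alpha\beta}(\tilde\psi)\big)=0$; 2. $\displaystyle E_{t_1}(\phi+\tilde\psi)-E_{t_0}(\phi+\tilde\psi)=\int_{\mathcal M_{t_1}}\tilde G^{\alpha\beta}\tilde X_\alpha\tilde N_\beta\,d\tilde\mu_{t_1}-\int_{\mathcal M_{t_0}}\tilde G^{\alpha\beta}\tilde X_\alpha\tilde N_\beta\,d\tilde\mu_{t_0}$; 3. if $X$ is a Killing field of $\tilde g$, then the total slice energy is conserved: $E_{t_1}(\phi+\tilde\psi)=E_{t_0}(\phi+\tilde\psi)$. -/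

import Mathlib

open scoped Manifold ContDiff Topology Matrix
open MeasureTheory Filter

noncomputable section

/-! Spacetime `𝒱 = M × ℝ`, tangent spaces, coordinates.  Greek indices are `Fin (n + 1)`; the index
`0` is time and `i.succ` is the `i`-th spatial direction. -/

/-- The model of the spacetime `M × ℝ`. -/
abbrev STModel (n : ℕ) :=
  (𝓡 n).prod 𝓘(ℝ, ℝ)

/-- The space `ℝⁿ × ℝ` in which coordinates (and tangent vectors) of the spacetime live. -/
abbrev Coord (n : ℕ) := EuclideanSpace ℝ (Fin n) × ℝ

/-- The standard basis of `ℝⁿ × ℝ`. -/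
def coordVec (n : ℕ) (α : Fin (n + 1)) : Coord n :=
  Fin.cases (0, 1) (fun i => (EuclideanSpace.single i 1, 0)) α

/-- The components of an element of `ℝⁿ × ℝ` in the standard basis. -/
def coordOf {n : ℕ} (v : Coord n) (α : Fin (n + 1)) : ℝ :=
  Fin.cases v.2 (fun i => v.1 i) α

/-- The partial derivative `∂_α F` at `y`. -/
def pd {n : ℕ} (α : Fin (n + 1)) (F : Coord n → ℝ) (y : Coord n) : ℝ :=
  fderiv ℝ F y (coordVec n α)

section Coordinates

/-! ### Classical tensor calculus in one coordinate system -/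

variable {n : ℕ}

/-- A matrix-valued function of the coordinates (the components of a tensor with two indices). -/
abbrev MatField (n : ℕ) := Coord n → Matrix (Fin (n + 1)) (Fin (n + 1)) ℝ

/-- `Γ^γ_{αβ} = ½ g^{γδ} (∂_α g_{δβ} + ∂_β g_{δα} - ∂_δ g_{αβ})`. -/
def christoffel (g : MatField n) (γ α β : Fin (n + 1)) (y : Coord n) : ℝ :=
  (1 / 2) * ∑ δ, (g y)⁻¹ γ δ *
    (pd α (fun z => g z δ β) y + pd β (fun z => g z δ α) y - pd δ (fun z => g z α β) y)

/-- `R_{αβ} = ∂_γ Γ^γ_{αβ} - ∂_β Γ^γ_{αγ} + Γ^γ_{γδ} Γ^δ_{αβ} - Γ^γ_{βδ} Γ^δ_{αγ}`. -/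
def ricciComp (g : MatField n) : MatField n := fun y => Matrix.of fun α β =>
  ∑ γ, (pd γ (christoffel g γ α β) y - pd β (christoffel g γ α γ) y
    + ∑ δ, (christoffel g γ γ δ y * christoffel g δ α β y
      - christoffel g γ β δ y * christoffel g δ α γ y))

/-- `R = g^{αβ} R_{αβ}`. -/
def scalarComp (g : MatField n) (y : Coord n) : ℝ :=
  ∑ α, ∑ β, (g y)⁻¹ α β * ricciComp g y α β

/-- `G_{αβ} = R_{αβ} - ½ R g_{αβ}`. -/
def einsteinComp (g : MatField n) : MatField n := fun y => Matrix.of fun α β =>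
  ricciComp g y α β - (1 / 2) * scalarComp g y * g y α β

/-- `S^{αβ} = g^{αγ} g^{βδ} S_{γδ}`, the indices being raised with `g`. -/
def raiseComp (g S : MatField n) : MatField n := fun y => Matrix.of fun α β =>
  ∑ γ, ∑ δ, (g y)⁻¹ α γ * (g y)⁻¹ β δ * S y γ δ

/-- `∇_α S^{αβ} = ∂_α S^{αβ} + Γ^α_{αγ} S^{γβ} + Γ^β_{αγ} S^{αγ}`. -/
def divComp (g S : MatField n) (β : Fin (n + 1)) (y : Coord n) : ℝ :=
  ∑ α, (pd α (fun z => raiseComp g S z α β) y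
    + ∑ γ, (christoffel g α α γ y * raiseComp g S y γ β
      + christoffel g β α γ y * raiseComp g S y α γ))

/-- `∇_α X_β = ∂_α X_β - Γ^γ_{αβ} X_γ` for a covector field with components `X_β`. -/
def covDerivComp (g : MatField n) (X : Coord n → Fin (n + 1) → ℝ) (α β : Fin (n + 1))
    (y : Coord n) : ℝ :=
  pd α (fun z => X z β) y - ∑ γ, christoffel g γ α β y * X y γ

end Coordinates

section Spacetime

variable (n : ℕ) (M : Type*) [TopologicalSpace M] [ChartedSpace (EuclideanSpace ℝ (Fin n)) M]

/-- Covariant tensor fields with two indices on `M × ℝ` (evaluated on pairs of tangent vectors). -/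
abbrev TwoTensor := ∀ p : M × ℝ,
  TangentSpace (STModel n) p → TangentSpace (STModel n) p → ℝ

/-- Vector fields on `M × ℝ`. -/
abbrev VField := ∀ p : M × ℝ, TangentSpace (STModel n) p

/-- Smooth symmetric covariant tensor fields with two indices on `M × ℝ`. -/
structure SymTensorField [IsManifold (𝓡 n) ∞ M] where
  val : ∀ p : M × ℝ,
    TangentSpace (STModel n) p →L[ℝ] TangentSpace (STModel n) p →L[ℝ] ℝ
  symm : ∀ p v w, val p v w = val p w v
  smooth : ContMDiff (STModel n)
    ((STModel n).prod 𝓘(ℝ, Coord n →L[ℝ] Coord n →L[ℝ] ℝ)) ∞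
    (fun p => Bundle.TotalSpace.mk' (Coord n →L[ℝ] Coord n →L[ℝ] ℝ)
      (E := fun p : M × ℝ =>
        TangentSpace (STModel n) p →L[ℝ] TangentSpace (STModel n) p →L[ℝ] ℝ) p (val p))

/-- Smooth Lorentzian metrics on `M × ℝ`, of signature `(+,-,…,-)`. -/
structure LorentzMetric [IsManifold (𝓡 n) ∞ M] extends SymTensorField n M where
  lorentzian : ∀ p, ∃ v, 0 < val p v v ∧ ∀ w, val p v w = 0 → w ≠ 0 → val p w w < 0

end Spacetime

section Charts

variable {n : ℕ} {M : Type*} [TopologicalSpace M] [ChartedSpace (EuclideanSpace ℝ (Fin n)) M]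

/-- The tensor field underlying a smooth symmetric tensor field. -/
def SymTensorField.tensor [IsManifold (𝓡 n) ∞ M] (S : SymTensorField n M) : TwoTensor n M :=
  fun p v w => S.val p v w

/-- The point of `M × ℝ` with coordinates `y = (x, t)`, where `x` are coordinates on `M` in the
chart `e`, and `t` is the time. -/
def chartPoint (e : OpenPartialHomeomorph M (EuclideanSpace ℝ (Fin n))) (y : Coord n) : M × ℝ :=
  (e.symm y.1, y.2)

/-- The coordinate vector `∂_α` of the chart `e` at the point with coordinates `y`. -/
def chartFrame (e : OpenPartialHomeomorph M (EuclideanSpace ℝ (Fin n))) (y : Coord n)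
    (α : Fin (n + 1)) : TangentSpace (STModel n) (chartPoint e y) :=
  mfderiv 𝓘(ℝ, Coord n) (STModel n) (chartPoint e) y (coordVec n α)

/-- The components `B_{αβ} = B(∂_α, ∂_β)` in the chart `e`. -/
def comp (e : OpenPartialHomeomorph M (EuclideanSpace ℝ (Fin n))) (B : TwoTensor n M) :
    MatField n := fun y => Matrix.of fun α β =>
  B (chartPoint e y) (chartFrame e y α) (chartFrame e y β)

/-- The vectors `∂_α` at `p` of the preferred chart at `p`: with the identification of tangent
spaces with `ℝⁿ × ℝ` that is used for `TangentSpace`, this is the standard basis. -/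
def frame (p : M × ℝ) (α : Fin (n + 1)) : TangentSpace (STModel n) p :=
  coordVec n α

/-- The preferred coordinates of the point `p`. -/
def coordsAt (p : M × ℝ) : Coord n :=
  (chartAt (EuclideanSpace ℝ (Fin n)) p.1 p.1, p.2)

/-- The differential `du(v)` at `p`; the partial derivatives `∂_α u` are its values on `frame p α`. -/
def dScalar (u : M × ℝ → ℝ) (p : M × ℝ) (v : TangentSpace (STModel n) p) : ℝ :=
  mfderiv (STModel n) 𝓘(ℝ, ℝ) u p v

variable [IsManifold (𝓡 n) ∞ M]

/-- The slices `M × {t}` are spacelike. -/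
def SpacelikeSlices (g : LorentzMetric n M) : Prop :=
  ∀ (p : M × ℝ) (u : EuclideanSpace ℝ (Fin n)), u ≠ 0 →
    g.tensor p ((u, 0) : Coord n) ((u, 0) : Coord n) < 0

/-- The scalar curvature, as a function on spacetime. -/
def scalarCurvature (g : LorentzMetric n M) (p : M × ℝ) : ℝ :=
  scalarComp (comp (chartAt (EuclideanSpace ℝ (Fin n)) p.1) g.tensor) (coordsAt p)

/-- The Einstein tensor, as a tensor field on spacetime. -/
def einsteinTensor (g : LorentzMetric n M) : TwoTensor n M := fun p v w =>
  ∑ α, ∑ β,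
    einsteinComp (comp (chartAt (EuclideanSpace ℝ (Fin n)) p.1) g.tensor) (coordsAt p) α β
      * coordOf (n := n) v α * coordOf (n := n) w β

/-- The inverse metric `g^{αβ}` at `p`. -/
def invMetric (g : LorentzMetric n M) (p : M × ℝ) : Matrix (Fin (n + 1)) (Fin (n + 1)) ℝ :=
  (Matrix.of fun α β => g.tensor p (frame p α) (frame p β))⁻¹

/-- `v_α = g_{αβ} v^β` at `p`. -/
def lowerAt (g : LorentzMetric n M) (p : M × ℝ) (v : TangentSpace (STModel n) p)
    (α : Fin (n + 1)) : ℝ :=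
  g.tensor p (frame p α) v

/-- `T^{αβ} = g^{αγ} g^{βδ} T_{γδ}` at `p`. -/
def raiseAt (g : LorentzMetric n M) (T : TwoTensor n M) (p : M × ℝ) (α β : Fin (n + 1)) : ℝ :=
  ∑ γ, ∑ δ, invMetric g p α γ * invMetric g p β δ * T p (frame p γ) (frame p δ)

/-- The future-directed unit normal of the slice through `p`, with components
`g^{α0} / √(g^{00})`: the normalized gradient of the time `t`. -/
def unitNormal (g : LorentzMetric n M) : VField n M := fun p =>
  (1 / √(invMetric g p 0 0)) • ∑ α, invMetric g p α 0 • frame p α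

/-- The lapse `1 / √(g^{00})`: the spacetime volume element is the lapse times `dt` times the
volume element of the slices. -/
def lapse (g : LorentzMetric n M) (p : M × ℝ) : ℝ :=
  1 / √(invMetric g p 0 0)

/-- The energy-momentum vector `P^β = X_α T^{αβ}` of `T` relative to `X`. -/
def energyMomentum (g : LorentzMetric n M) (T : TwoTensor n M) (X : VField n M) (p : M × ℝ)
    (β : Fin (n + 1)) : ℝ :=
  ∑ α, lowerAt g p (X p) α * raiseAt g T p α β

/-- The energy density `P^α n_α`. -/
def energyDensity (g : LorentzMetric n M) (T : TwoTensor n M) (X : VField n M) (p : M × ℝ) : ℝ :=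
  ∑ α, energyMomentum g T X p α * lowerAt g p (unitNormal g p) α

/-- The vector field `X` is a Killing field of `g`: `∇_α X_β + ∇_β X_α = 0` in every chart. -/
def IsKilling (g : LorentzMetric n M) (X : VField n M) : Prop :=
  ∀ e ∈ atlas (EuclideanSpace ℝ (Fin n)) M, ∀ y : Coord n, y.1 ∈ e.target → ∀ α β,
    covDerivComp (comp e g.tensor)
        (fun z γ => g.tensor (chartPoint e z) (chartFrame e z γ) (X (chartPoint e z))) α β y
      + covDerivComp (comp e g.tensor)
        (fun z γ => g.tensor (chartPoint e z) (chartFrame e z γ) (X (chartPoint e z))) β α y = 0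

/-- `∇_α T^{αβ} = 0` in every chart. -/
def IsConserved (g : LorentzMetric n M) (T : TwoTensor n M) : Prop :=
  ∀ e ∈ atlas (EuclideanSpace ℝ (Fin n)) M, ∀ y : Coord n, y.1 ∈ e.target → ∀ β,
    divComp (comp e g.tensor) (comp e T) β y = 0

/-- The field equations `G_{αβ} = T_{αβ}`, in every chart. -/
def EinsteinEquations (g : LorentzMetric n M) (T : TwoTensor n M) : Prop :=
  ∀ e ∈ atlas (EuclideanSpace ℝ (Fin n)) M, ∀ y : Coord n, y.1 ∈ e.target → ∀ α β,
    einsteinComp (comp e g.tensor) y α β = comp e T y α β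

/-- The stress tensor of a scalar field `φ` with potential `V`,
`T_{αβ}(φ) = ∂_α φ ∂_β φ - ½ g_{αβ} (∂^λ φ ∂_λ φ - 2 V)`. -/
def scalarStress (g : LorentzMetric n M) (φ V : M × ℝ → ℝ) : TwoTensor n M := fun p v w =>
  dScalar φ p v * dScalar φ p w - (1 / 2) * g.tensor p v w *
    (∑ α, ∑ β, invMetric g p α β * dScalar φ p (frame p α) * dScalar φ p (frame p β) - 2 * V p)

/-- The scalar field `φ = ln f'(R)`, where `R` is the scalar curvature of the metric `g`. -/
def inflaton (f : ℝ → ℝ) (g : LorentzMetric n M) (p : M × ℝ) : ℝ :=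
  Real.log (deriv f (scalarCurvature g p))

/-- The potential `V = ½ (f')⁻² (R f' - f)`, with `f`, `f'` evaluated at `R`. -/
def inflatonPotential (f : ℝ → ℝ) (g : LorentzMetric n M) (p : M × ℝ) : ℝ :=
  (1 / 2) * (deriv f (scalarCurvature g p) ^ 2)⁻¹ *
    (scalarCurvature g p * deriv f (scalarCurvature g p) - f (scalarCurvature g p))

section Integration

variable [MeasurableSpace M]

/-- The volume measure of the spatial metric `-g_{ij}` of the slice at time `t` on the domain of
the chart `e`: the measure `√(det (-g_{ij})) dx¹ ⋯ dxⁿ`. -/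
def chartVolume (g : LorentzMetric n M) (t : ℝ)
    (e : OpenPartialHomeomorph M (EuclideanSpace ℝ (Fin n))) : Measure M :=
  (((volume : Measure (EuclideanSpace ℝ (Fin n))).restrict e.target).withDensity
    (fun x => ENNReal.ofReal √(Matrix.det
      (Matrix.of fun i j : Fin n => -comp e g.tensor (x, t) i.succ j.succ)))).map e.symm

/-- The volume measure `dμ_t` of the slice at time `t`. The measures in the charts agree on the
overlaps; the measure glued from them is their supremum. -/
def sliceVolume (g : LorentzMetric n M) (t : ℝ) : Measure M :=
  ⨆ e ∈ atlas (EuclideanSpace ℝ (Fin n)) M, chartVolume g t e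

/-- The slice energy `E_t = ∫ P^α n_α dμ_t`. -/
def sliceEnergy (g : LorentzMetric n M) (T : TwoTensor n M) (X : VField n M) (t : ℝ) : ℝ :=
  ∫ x, energyDensity g T X (x, t) ∂(sliceVolume g t)

/-- The slice energy exists. -/
def SliceEnergyExists (g : LorentzMetric n M) (T : TwoTensor n M) (X : VField n M) (t : ℝ) :
    Prop :=
  Integrable (fun x => energyDensity g T X (x, t)) (sliceVolume g t)

/-- The gravitational flux `∫ G^{αβ} X_α N_β dμ_t` through the slice. -/
def gravFlux (g : LorentzMetric n M) (X : VField n M) (t : ℝ) : ℝ :=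
  ∫ x, ∑ α, ∑ β, raiseAt g (einsteinTensor g) (x, t) α β * lowerAt g (x, t) (X (x, t)) α
    * lowerAt g (x, t) (unitNormal g (x, t)) β ∂(sliceVolume g t)

/-- Between the times `t₀` and `t₁` no energy-momentum flows off to spatial infinity: for some
sequence of smooth cutoff functions `χ_k` on `M` with compact support, equal to `1` on larger and
larger compact sets, `∫_{t₀}^{t₁} ∫_M P^α ∂_α χ_k dμ → 0`. -/
def NoFluxAtInfinity (g : LorentzMetric n M) (T : TwoTensor n M) (X : VField n M) (t₀ t₁ : ℝ) :
    Prop :=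
  ∃ χ : ℕ → M → ℝ,
    (∀ k, ContMDiff (𝓡 n) 𝓘(ℝ, ℝ) ∞ (χ k) ∧ HasCompactSupport (χ k) ∧
      ∀ x, 0 ≤ χ k x ∧ χ k x ≤ 1) ∧
    (∀ K : Set M, IsCompact K → ∀ᶠ k in atTop, ∀ x ∈ K, χ k x = 1) ∧
    Tendsto (fun k => ∫ t in t₀..t₁, ∫ x,
      (∑ α, energyMomentum g T X (x, t) α
        * dScalar (fun q : M × ℝ => χ k q.1) (x, t) (frame (x, t) α))
        * lapse g (x, t) ∂(sliceVolume g t)) atTop (𝓝 0)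

end Integration

end Charts

end

noncomputable section

set_option linter.unusedSectionVars false

namespace AlgTensor

/-! ### Tensor calculus over a commutative ring with commuting derivations -/

variable {ι A : Type*} [Fintype ι] [DecidableEq ι] [CommRing A] [Algebra ℝ A]

/-! The field equations identify the total stress tensor with the Einstein tensor of the
Einstein-frame metric. The contracted Bianchi identity therefore makes the total divergence free,
with no conservation law for either summand. Integrating the same field equations against `X` and
the unit normal over two slices gives the second assertion.

The Bianchi identity is purely algebraic: it needs only commuting derivations of a commutative real
algebra and a symmetric invertible matrix `g`. With connection matrices `Γ_α` and curvature `F = dΓ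
+ Γ ∧ Γ`, the second Bianchi identity is a noncommutative polynomial identity, and two contractions
turn it into `AlgTensor.div_ein`. Applied to the algebra of functions smooth on a coordinate domain,
this is `divComp_einsteinComp`.

For the third assertion, a symmetric divergence-free tensor contracted with a Killing covector gives
a current whose density `√|g| P^α` has zero coordinate divergence (`sum_pd_density_eq_zero`). For a
smooth compactly supported cutoff on `M`, integration by parts in space and the fundamental theorem
of calculus in time express the change of the cut-off energy as the integral of `P^α ∂_α χ`
(`balance_cutoff` in one chart, `balance_of_hasCompactSupport` by a partition of unity). Dominated
convergence at the two end times and the absence of flux at infinity remove the cutoff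
(`integral_energyDensity_eq`).

Passing between charts and the invariant energies requires two facts: the splitting `√|g| = lapse ·
√det(-g_{ij})` (`lapse_mul_chartDensity`), and that the supremum of the chart measures restricts on
each chart domain to the measure of that chart (`sliceVolume_restrict`). -/

/-- The entrywise derivative of a matrix. -/
def dM (d : Derivation ℝ A A) (m : Matrix ι ι A) : Matrix ι ι A := m.map d

lemma dM_add (d : Derivation ℝ A A) (m k : Matrix ι ι A) : dM d (m + k) = dM d m + dM d k := by
  ext i j; simp [dM]

lemma dM_sub (d : Derivation ℝ A A) (m k : Matrix ι ι A) : dM d (m - k) = dM d m - dM d k := by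
  ext i j; simp [dM]

lemma dM_transpose (d : Derivation ℝ A A) (m : Matrix ι ι A) : dM d mᵀ = (dM d m)ᵀ := rfl

lemma dM_mul (d : Derivation ℝ A A) (m k : Matrix ι ι A) :
    dM d (m * k) = dM d m * k + m * dM d k := by
  ext i j
  simp only [dM, Matrix.map_apply, Matrix.mul_apply, map_sum, Derivation.leibniz, smul_eq_mul,
    Matrix.add_apply, ← Finset.sum_add_distrib]
  exact Finset.sum_congr rfl fun x _ => by ring

lemma dM_one (d : Derivation ℝ A A) : dM d (1 : Matrix ι ι A) = 0 := by
  ext i j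
  by_cases h : i = j <;> simp [dM, h]

variable (D : ι → Derivation ℝ A A) (g h : Matrix ι ι A)

/-- The Christoffel symbols of the first kind, doubled. -/
def chrLow (α : ι) : Matrix ι ι A := Matrix.of fun δ β =>
  D α (g δ β) + D β (g δ α) - D δ (g α β)

/-- The Christoffel symbols; `h` is the inverse of `g`. -/
def chr (γ α β : ι) : A := (1 / 2 : ℝ) • ∑ δ, h γ δ * (D α (g δ β) + D β (g δ α) - D δ (g α β))

/-- The connection matrices `(Γ_α)^γ_β`. -/
def conn (α : ι) : Matrix ι ι A := Matrix.of fun γ β => chr D g h γ α β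

/-- The curvature `F_{αβ} = ∂_α Γ_β - ∂_β Γ_α + [Γ_α, Γ_β]`. -/
def curv (α β : ι) : Matrix ι ι A :=
  dM (D α) (conn D g h β) - dM (D β) (conn D g h α)
    + (conn D g h α * conn D g h β - conn D g h β * conn D g h α)

/-- The Ricci tensor. -/
def ric (α β : ι) : A :=
  ∑ γ, (D γ (chr D g h γ α β) - D β (chr D g h γ α γ)
    + ∑ δ, (chr D g h γ γ δ * chr D g h δ α β - chr D g h γ β δ * chr D g h δ α γ))

/-- The scalar curvature. -/
def scal : A := ∑ α, ∑ β, h α β * ric D g h α β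

/-- The Einstein tensor. -/
def ein (α β : ι) : A := ric D g h α β - (1 / 2 : ℝ) • (scal D g h * g α β)

/-- Raising of both indices. -/
def raise (S : ι → ι → A) (α β : ι) : A := ∑ γ, ∑ δ, h α γ * h β δ * S γ δ

/-- The divergence of a tensor. -/
def div (S : ι → ι → A) (β : ι) : A :=
  ∑ α, (D α (raise h S α β)
    + ∑ γ, (chr D g h α α γ * raise h S γ β + chr D g h β α γ * raise h S α γ))

variable {D g h}

lemma chr_symm (hg : gᵀ = g) (γ α β : ι) : chr D g h γ α β = chr D g h γ β α := by
  have e : ∀ i j, g i j = g j i := fun i j => congrFun (congrFun hg j) i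
  unfold chr
  congr 1
  refine Finset.sum_congr rfl fun δ _ => ?_
  rw [e α β]; ring

lemma conn_eq (α : ι) : conn D g h α = (1 / 2 : ℝ) • (h * chrLow D g α) := by
  ext γ β
  simp [conn, chr, chrLow, Matrix.mul_apply]

/-- Metric compatibility of the Levi-Civita connection. The matrix `g Γ_α` is half of `chrLow`, in
which the two derivatives other than `∂_α g` form a skew matrix; adding the transpose cancels them.
-/
lemma dM_metric (hg : gᵀ = g) (hgh : g * h = 1) (α : ι) :
    dM (D α) g = g * conn D g h α + (conn D g h α)ᵀ * g := by
  have e : ∀ i j, g i j = g j i := fun i j => congrFun (congrFun hg j) i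
  have hh : hᵀ * g = 1 := by
    have := congrArg Matrix.transpose hgh
    rwa [Matrix.transpose_mul, hg, Matrix.transpose_one] at this
  have h1 : g * conn D g h α = (1 / 2 : ℝ) • chrLow D g α := by
    rw [conn_eq, Matrix.mul_smul, ← Matrix.mul_assoc, hgh, Matrix.one_mul]
  have h2 : (conn D g h α)ᵀ * g = (1 / 2 : ℝ) • (chrLow D g α)ᵀ := by
    rw [conn_eq, Matrix.transpose_smul, Matrix.transpose_mul, Matrix.smul_mul, Matrix.mul_assoc,
      hh, Matrix.mul_one]
  rw [h1, h2, ← smul_add]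
  ext ρ β
  simp only [dM, Matrix.map_apply, Matrix.smul_apply, Matrix.add_apply, chrLow, Matrix.of_apply,
    Matrix.transpose_apply]
  rw [e α β, e ρ α, e β ρ, e α ρ, e β α]
  have : ∀ a b c : A, (1 / 2 : ℝ) • (a + b - c + (a + c - b)) = a := fun a b c => by
    rw [show a + b - c + (a + c - b) = (2 : ℝ) • a by rw [two_smul]; ring, smul_smul]; norm_num
  rw [this]

lemma inv_symm (hg : gᵀ = g) (hgh : g * h = 1) : hᵀ = h := by
  have hh : hᵀ * g = 1 := by
    have := congrArg Matrix.transpose hgh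
    rwa [Matrix.transpose_mul, hg, Matrix.transpose_one] at this
  calc hᵀ = hᵀ * (g * h) := by rw [hgh, Matrix.mul_one]
    _ = h := by rw [← Matrix.mul_assoc, hh, Matrix.one_mul]

/-- The inverse metric is parallel: differentiate `g h = 1`, insert metric compatibility, and
multiply by `h` on the left. -/
lemma dM_inv (hg : gᵀ = g) (hgh : g * h = 1) (α : ι) :
    dM (D α) h = -(conn D g h α * h) - h * (conn D g h α)ᵀ := by
  have hhg : h * g = 1 := mul_eq_one_comm.mp hgh
  have e := congrArg (dM (D α)) hgh
  rw [dM_mul, dM_one, dM_metric hg hgh] at e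
  have e2 := congrArg (h * ·) e
  simp only [Matrix.mul_add, Matrix.add_mul, ← Matrix.mul_assoc, hhg, Matrix.one_mul,
    Matrix.mul_zero] at e2
  simp only [Matrix.mul_assoc, hgh, Matrix.mul_one] at e2
  rw [eq_comm, sub_eq_iff_eq_add, neg_eq_iff_add_eq_zero, ← e2]
  abel

lemma dM_comm (hD : ∀ α β a, D α (D β a) = D β (D α a)) (α β : ι) (m : Matrix ι ι A) :
    dM (D α) (dM (D β) m) = dM (D β) (dM (D α) m) := by
  ext i j; simp [dM, hD α β]

lemma curv_skew_left (α β : ι) : curv D g h α β = -curv D g h β α := by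
  unfold curv; abel

/-- The commutator of two derivatives of `g` vanishes; expanding it by metric compatibility leaves
exactly the action of the curvature on `g`. -/
lemma metric_curv (hD : ∀ α β a, D α (D β a) = D β (D α a))
    (hg : gᵀ = g) (hgh : g * h = 1) (α β : ι) :
    g * curv D g h α β + (curv D g h α β)ᵀ * g = 0 := by
  have e := dM_comm hD α β g
  rw [dM_metric hg hgh β, dM_metric hg hgh α, dM_add, dM_add, dM_mul, dM_mul, dM_mul, dM_mul,
    dM_metric hg hgh β, dM_metric hg hgh α, dM_transpose, dM_transpose, ← sub_eq_zero] at e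
  rw [← e]
  simp only [curv, Matrix.transpose_add, Matrix.transpose_sub, Matrix.transpose_mul]
  noncomm_ring

lemma curv_skew_right (hD : ∀ α β a, D α (D β a) = D β (D α a))
    (hg : gᵀ = g) (hgh : g * h = 1) (α β γ δ : ι) :
    (curv D g h α β * h) γ δ = -(curv D g h α β * h) δ γ := by
  have hhg : h * g = 1 := mul_eq_one_comm.mp hgh
  have e := metric_curv hD hg hgh α β
  have e2 := congrArg (fun m => h * m * h) e
  simp only [Matrix.mul_add, Matrix.add_mul, ← Matrix.mul_assoc, hhg, Matrix.one_mul,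
    Matrix.mul_zero, Matrix.zero_mul] at e2
  rw [Matrix.mul_assoc (h * _), hgh, Matrix.mul_one] at e2
  have e3 := congrFun (congrFun e2 γ) δ
  have e4 : h * (curv D g h α β)ᵀ = (curv D g h α β * h)ᵀ := by
    rw [Matrix.transpose_mul, inv_symm hg hgh]
  rw [e4, Matrix.add_apply, Matrix.transpose_apply, Matrix.zero_apply] at e3
  exact eq_neg_of_add_eq_zero_left e3

/-- Covariant derivatives of the curvature act by commutators. In the cyclic sum the second
derivatives of `Γ` cancel because the derivations commute, and the remaining products cancel by
associativity. Connection terms for the lower indices `l`, `α`, `β` are omitted; neither symmetry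
nor invertibility of `g` enters. -/
lemma bianchi_second (hD : ∀ α β a, D α (D β a) = D β (D α a))
    (l α β : ι) :
    (dM (D l) (curv D g h α β) + (conn D g h l * curv D g h α β - curv D g h α β * conn D g h l))
    + (dM (D α) (curv D g h β l) + (conn D g h α * curv D g h β l - curv D g h β l * conn D g h α))
    + (dM (D β) (curv D g h l α) + (conn D g h β * curv D g h l α - curv D g h l α * conn D g h β))
      = 0 := by
  simp only [curv, dM_add, dM_sub, dM_mul]
  rw [dM_comm hD l α, dM_comm hD l β, dM_comm hD α β]
  noncomm_ring

variable (D g h) in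
/-- The Ricci tensor with the first index raised. -/
def ricMixed : Matrix ι ι A := Matrix.of fun δ β => ∑ γ, (curv D g h γ β * h) γ δ

lemma ric_eq (hg : gᵀ = g) (α β : ι) : ric D g h α β = ∑ γ, curv D g h γ β γ α := by
  refine Finset.sum_congr rfl fun γ _ => ?_
  simp [curv, dM, conn, Matrix.mul_apply, Finset.sum_sub_distrib, chr_symm hg _ α]

lemma ricMixed_eq (hg : gᵀ = g) (δ β : ι) : ricMixed D g h δ β = ∑ μ, ric D g h μ β * h μ δ := by
  simp only [ricMixed, Matrix.of_apply, Matrix.mul_apply, ric_eq hg, Finset.sum_mul]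
  rw [Finset.sum_comm]

lemma scal_eq (hg : gᵀ = g) : scal D g h = ∑ β, ricMixed D g h β β := by
  simp only [scal, ricMixed_eq hg]
  rw [Finset.sum_comm]
  exact Finset.sum_congr rfl fun _ _ => Finset.sum_congr rfl fun _ _ => mul_comm _ _

/-- Since `h` is parallel, multiplying by it on the right converts the right half of each commutator
into a connection term `(Γ)ᵀ` for the raised index. -/
lemma bianchi_raised (hD : ∀ α β a, D α (D β a) = D β (D α a))
    (hg : gᵀ = g) (hgh : g * h = 1) (l α β : ι) :
    (dM (D l) (curv D g h α β * h) + conn D g h l * (curv D g h α β * h)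
        + (curv D g h α β * h) * (conn D g h l)ᵀ)
      + (dM (D α) (curv D g h β l * h) + conn D g h α * (curv D g h β l * h)
        + (curv D g h β l * h) * (conn D g h α)ᵀ)
      + (dM (D β) (curv D g h l α * h) + conn D g h β * (curv D g h l α * h)
        + (curv D g h l α * h) * (conn D g h β)ᵀ) = 0 := by
  have e := congrArg (· * h) (bianchi_second (g := g) (h := h) hD l α β)
  simp only [Matrix.zero_mul] at e
  rw [← e]
  simp only [dM_mul, dM_inv hg hgh]
  noncomm_ring

lemma sum_skew_mul_symm (k s : ι → ι → A) (hk : ∀ a b, k a b = -k b a)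
    (hs : ∀ a b, s a b = s b a) : ∑ a, ∑ b, k a b * s a b = 0 := by
  have e : ∑ a, ∑ b, k a b * s a b = -∑ a, ∑ b, k a b * s a b := by
    conv_lhs => rw [Finset.sum_comm]
    rw [← Finset.sum_neg_distrib]
    refine Finset.sum_congr rfl fun a _ => ?_
    rw [← Finset.sum_neg_distrib]
    refine Finset.sum_congr rfl fun b _ => ?_
    rw [hk b a, hs b a]; ring
  have e2 : (2 : ℝ) • ∑ a, ∑ b, k a b * s a b = 0 := by
    rw [two_smul]; nth_rewrite 2 [e]; exact add_neg_cancel _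
  have := congrArg ((1 / 2 : ℝ) • ·) e2
  simpa [smul_smul] using this

/-- The contracted Bianchi identity `∇_α R^α_λ = ½ ∂_λ R`. -/
lemma bianchi_contracted (hD : ∀ α β a, D α (D β a) = D β (D α a))
    (hg : gᵀ = g) (hgh : g * h = 1) (l : ι) :
    ∑ α, (dM (D α) (ricMixed D g h) + conn D g h α * ricMixed D g h
      - ricMixed D g h * conn D g h α) α l = (1 / 2 : ℝ) • D l (scal D g h) := by
  set K : ι → ι → Matrix ι ι A := fun α β => curv D g h α β * h with hK
  set Γ := conn D g h with hΓ
  set Q := ricMixed D g h with hQ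
  have hΓs : ∀ a b c, Γ a b c = Γ c b a := fun a b c => chr_symm hg b a c
  have kl : ∀ a b c d, K a b c d = -K b a c d := fun a b c d => by
    simp only [hK]; rw [curv_skew_left]; simp
  have kr : ∀ a b c d, K a b c d = -K a b d c := fun a b c d => curv_skew_right hD hg hgh a b c d
  have q1 : ∀ d b, ∑ c, K c b c d = Q d b := fun d b => rfl
  have q2 : ∀ d b, ∑ c, K b c c d = -Q d b := fun d b => by
    rw [← q1, ← Finset.sum_neg_distrib]; exact Finset.sum_congr rfl fun c _ => kl _ _ _ _
  have q3 : ∀ d b, ∑ c, K c b d c = -Q d b := fun d b => by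
    rw [← q1, ← Finset.sum_neg_distrib]; exact Finset.sum_congr rfl fun c _ => kr _ _ _ _
  have q4 : ∀ d b, ∑ c, K b c d c = Q d b := fun d b => by
    rw [← neg_neg (Q d b), ← q2, ← Finset.sum_neg_distrib]
    exact Finset.sum_congr rfl fun c _ => kr _ _ _ _
  -- Contract the cyclic identity twice by taking entry `(α, β)` and summing. The first group gives
  -- `∂_l R + 2 Γ^α_{lμ} R^μ_α`; each of the other two gives `-(∂_α R^α_l + Γ^α_{αμ} R^μ_l)`, since
  -- their remaining connection terms pair the skew curvature with the symmetric Christoffel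
  -- symbols.
  have e : ∑ α, ∑ β, ((dM (D l) (K α β) + Γ l * K α β + K α β * (Γ l)ᵀ)
      + (dM (D α) (K β l) + Γ α * K β l + K β l * (Γ α)ᵀ)
      + (dM (D β) (K l α) + Γ β * K l α + K l α * (Γ β)ᵀ)) α β = 0 := by
    refine Finset.sum_eq_zero fun α _ => Finset.sum_eq_zero fun β _ => ?_
    rw [bianchi_raised hD hg hgh l α β]; rfl
  simp only [Matrix.add_apply, Finset.sum_add_distrib] at e
  have t1 : ∑ α, ∑ β, dM (D l) (K α β) α β = D l (scal D g h) := by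
    simp only [scal_eq hg, dM, Matrix.map_apply, map_sum]
    rw [Finset.sum_comm]
    refine Finset.sum_congr rfl fun b _ => ?_
    rw [← map_sum, q1]
  have t2 : ∑ α, ∑ β, (Γ l * K α β) α β = ∑ α, ∑ μ, Γ l α μ * Q μ α := by
    refine Finset.sum_congr rfl fun a _ => ?_
    simp only [Matrix.mul_apply]
    rw [Finset.sum_comm]
    refine Finset.sum_congr rfl fun b _ => ?_
    rw [← Finset.mul_sum, q4]
  have t3 : ∑ α, ∑ β, (K α β * (Γ l)ᵀ) α β = ∑ α, ∑ μ, Γ l α μ * Q μ α := by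
    rw [Finset.sum_comm]
    refine Finset.sum_congr rfl fun a _ => ?_
    simp only [Matrix.mul_apply, Matrix.transpose_apply]
    rw [Finset.sum_comm]
    refine Finset.sum_congr rfl fun b _ => ?_
    rw [← Finset.sum_mul, q1, mul_comm]
  have t4 : ∑ α, ∑ β, dM (D α) (K β l) α β = -∑ α, dM (D α) Q α l := by
    rw [← Finset.sum_neg_distrib]
    refine Finset.sum_congr rfl fun a _ => ?_
    simp only [dM, Matrix.map_apply]
    rw [← map_sum, q3, map_neg]
  have t5 : ∑ α, ∑ β, (Γ α * K β l) α β = -∑ α, ∑ μ, Γ α α μ * Q μ l := by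
    rw [← Finset.sum_neg_distrib]
    refine Finset.sum_congr rfl fun a _ => ?_
    simp only [Matrix.mul_apply]
    rw [Finset.sum_comm, ← Finset.sum_neg_distrib]
    refine Finset.sum_congr rfl fun b _ => ?_
    rw [← Finset.mul_sum, q3, mul_neg]
  have t6 : ∑ α, ∑ β, (K β l * (Γ α)ᵀ) α β = 0 := by
    rw [Finset.sum_comm]
    refine Finset.sum_eq_zero fun b _ => ?_
    simp only [Matrix.mul_apply, Matrix.transpose_apply]
    exact sum_skew_mul_symm _ _ (kr b l) fun a m => hΓs a b m
  have t7 : ∑ α, ∑ β, dM (D β) (K l α) α β = -∑ α, dM (D α) Q α l := by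
    rw [Finset.sum_comm, ← Finset.sum_neg_distrib]
    refine Finset.sum_congr rfl fun a _ => ?_
    simp only [dM, Matrix.map_apply]
    rw [← map_sum, q2, map_neg]
  have t8 : ∑ α, ∑ β, (Γ β * K l α) α β = 0 := by
    refine Finset.sum_eq_zero fun a _ => ?_
    simp only [Matrix.mul_apply]
    rw [← sum_skew_mul_symm (K l a) (fun m b => Γ b a m) (kr l a) fun m b => hΓs b a m,
      Finset.sum_comm]
    exact Finset.sum_congr rfl fun _ _ => Finset.sum_congr rfl fun _ _ => mul_comm _ _
  have t9 : ∑ α, ∑ β, (K l α * (Γ β)ᵀ) α β = -∑ α, ∑ μ, Γ α α μ * Q μ l := by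
    rw [Finset.sum_comm, ← Finset.sum_neg_distrib]
    refine Finset.sum_congr rfl fun a _ => ?_
    simp only [Matrix.mul_apply, Matrix.transpose_apply]
    rw [Finset.sum_comm, ← Finset.sum_neg_distrib]
    refine Finset.sum_congr rfl fun b _ => ?_
    rw [← Finset.sum_mul, q2, neg_mul, mul_comm]
  rw [t1, t2, t3, t4, t5, t6, t7, t8, t9] at e
  -- Vanishing torsion identifies the connection terms of the first group with the lower-index term
  -- that completes `∇_α R^α_l`.
  have f : ∑ α, (Q * Γ α) α l = ∑ α, ∑ μ, Γ l α μ * Q μ α := by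
    simp only [Matrix.mul_apply]
    rw [Finset.sum_comm]
    exact Finset.sum_congr rfl fun a _ => Finset.sum_congr rfl fun b _ => by
      rw [hΓs b a l, mul_comm]
  simp only [Matrix.sub_apply, Matrix.add_apply, Finset.sum_sub_distrib, Finset.sum_add_distrib]
  rw [f]
  simp only [Matrix.mul_apply]
  have e2 : D l (scal D g h) = (2 : ℝ) • (∑ α, dM (D α) Q α l + ∑ α, ∑ μ, Γ α α μ * Q μ l
      - ∑ α, ∑ μ, Γ l α μ * Q μ α) := by
    rw [two_smul]; linear_combination e
  rw [e2, smul_smul]; norm_num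

/-- Factoring out the second raising leaves the mixed tensor `R^α_l - ½ R δ^α_l`, the form to which
the contracted Bianchi identity applies. -/
lemma raise_ein (hg : gᵀ = g) (hgh : g * h = 1) (α β : ι) :
    raise h (ein D g h) α β
      = ((ricMixed D g h - Matrix.scalar ι ((1 / 2 : ℝ) • scal D g h)) * h) α β := by
  have hs : ∀ i j, h i j = h j i := fun i j => congrFun (congrFun (inv_symm hg hgh) j) i
  have hhg : h * g = 1 := mul_eq_one_comm.mp hgh
  have e1 : raise h (ein D g h) α β = (h * Matrix.of (ein D g h) * h) α β := by
    simp only [raise, Matrix.mul_apply, Matrix.of_apply, Finset.sum_mul]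
    rw [Finset.sum_comm]
    exact Finset.sum_congr rfl fun c _ => Finset.sum_congr rfl fun d _ => by rw [hs β c]; ring
  have e2 : h * Matrix.of (ein D g h)
      = ricMixed D g h - Matrix.scalar ι ((1 / 2 : ℝ) • scal D g h) := by
    have : Matrix.of (ein D g h)
        = Matrix.of (ric D g h) - ((1 / 2 : ℝ) • scal D g h) • g := by
      ext i j; simp [ein]
    rw [this, Matrix.mul_sub, Matrix.mul_smul, hhg, Matrix.scalar_apply,
      Matrix.smul_one_eq_diagonal]
    congr 1
    ext i j
    rw [ricMixed_eq hg, Matrix.mul_apply]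
    exact Finset.sum_congr rfl fun c _ => by rw [hs i c, mul_comm]; rfl
  rw [e1, e2]

/-- The Einstein tensor is divergence free. -/
theorem div_ein (hD : ∀ α β a, D α (D β a) = D β (D α a))
    (hg : gᵀ = g) (hgh : g * h = 1) (β : ι) : div D g h (ein D g h) β = 0 := by
  set r := (1 / 2 : ℝ) • scal D g h with hr
  set E := ricMixed D g h - Matrix.scalar ι r with hE
  have e1 : div D g h (ein D g h) β
      = ∑ α, ((dM (D α) E + conn D g h α * E - E * conn D g h α) * h) α β := by
    refine Finset.sum_congr rfl fun α _ => ?_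
    simp only [raise_ein hg hgh]
    -- Because `h` is parallel, the divergence of `E h` is the divergence of the mixed tensor `E`
    -- multiplied by `h`.
    have : (dM (D α) E + conn D g h α * E - E * conn D g h α) * h
        = dM (D α) (E * h) + (conn D g h α * (E * h) + E * h * (conn D g h α)ᵀ) := by
      rw [dM_mul, dM_inv hg hgh]; noncomm_ring
    rw [this, Finset.sum_add_distrib]
    simp only [Matrix.add_apply, Matrix.mul_apply (M := conn D g h α),
      Matrix.mul_apply (N := (conn D g h α)ᵀ)]
    congr 2
    exact Finset.sum_congr rfl fun c _ => mul_comm _ _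
  have e2 : ∀ α, dM (D α) E + conn D g h α * E - E * conn D g h α
      = dM (D α) (ricMixed D g h) + conn D g h α * ricMixed D g h
        - ricMixed D g h * conn D g h α - Matrix.scalar ι (D α r) := by
    intro α
    have c : conn D g h α * Matrix.scalar ι r = Matrix.scalar ι r * conn D g h α :=
      ((Matrix.scalar_commute r (fun x => mul_comm _ _) _).eq).symm
    have d : dM (D α) (Matrix.scalar ι r) = Matrix.scalar ι (D α r) := by
      ext i j
      by_cases hij : i = j <;> simp [dM, hij]
    rw [hE, dM_sub, d, Matrix.mul_sub, Matrix.sub_mul, c]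
    abel
  rw [e1]
  simp only [e2, Matrix.mul_apply]
  rw [Finset.sum_comm]
  refine Finset.sum_eq_zero fun l _ => ?_
  rw [← Finset.sum_mul]
  have : ∑ α, (dM (D α) (ricMixed D g h) + conn D g h α * ricMixed D g h
      - ricMixed D g h * conn D g h α - Matrix.scalar ι (D α r)) α l = 0 := by
    have e : ∀ (α : ι) (X Y : Matrix ι ι A), (X - Y) α l = X α l - Y α l := fun _ _ _ => rfl
    rw [Finset.sum_congr rfl fun α _ => e α _ (Matrix.scalar ι (D α r)), Finset.sum_sub_distrib,
      bianchi_contracted hD hg hgh l]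
    simp [Matrix.diagonal_apply, hr]
  rw [this, zero_mul]

end AlgTensor

/-! ### The Einstein tensor of a metric in coordinates -/

section CoordinateCalculus

variable {n : ℕ} {U : Set (Coord n)}

lemma pd_congr (hU : IsOpen U) {F H : Coord n → ℝ} (h : ∀ y ∈ U, F y = H y) (α : Fin (n + 1))
    {y : Coord n} (hy : y ∈ U) : pd α F y = pd α H y := by
  have : F =ᶠ[𝓝 y] H := Filter.eventually_of_mem (hU.mem_nhds hy) h
  rw [pd, pd, this.fderiv_eq]

lemma contDiffOn_pd (hU : IsOpen U) {F : Coord n → ℝ} (hF : ContDiffOn ℝ ∞ F U) (α : Fin (n + 1)) :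
    ContDiffOn ℝ ∞ (pd α F) U :=
  (hF.fderiv_of_isOpen hU (m := ∞) (by simp)).clm_apply contDiffOn_const

lemma differentiableAt_of_contDiffOn (hU : IsOpen U) {F : Coord n → ℝ} (hF : ContDiffOn ℝ ∞ F U)
    {y : Coord n} (hy : y ∈ U) : DifferentiableAt ℝ F y :=
  (hF.differentiableOn (by simp)).differentiableAt (hU.mem_nhds hy)

lemma pd_mul {F H : Coord n → ℝ} {y : Coord n} (hF : DifferentiableAt ℝ F y)
    (hH : DifferentiableAt ℝ H y) (α : Fin (n + 1)) :
    pd α (fun z => F z * H z) y = F y * pd α H y + H y * pd α F y := by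
  simp only [pd]
  rw [fderiv_fun_mul hF hH]
  simp

lemma pd_sum {ι : Type*} (s : Finset ι) {F : ι → Coord n → ℝ} {y : Coord n}
    (hF : ∀ i ∈ s, DifferentiableAt ℝ (F i) y) (α : Fin (n + 1)) :
    pd α (fun z => ∑ i ∈ s, F i z) y = ∑ i ∈ s, pd α (F i) y := by
  simp only [pd]
  rw [fderiv_fun_sum hF]
  simp

lemma pd_comm (hU : IsOpen U) {F : Coord n → ℝ} (hF : ContDiffOn ℝ ∞ F U) (α β : Fin (n + 1))
    {y : Coord n} (hy : y ∈ U) : pd α (pd β F) y = pd β (pd α F) y := by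
  have hd : DifferentiableAt ℝ (fderiv ℝ F) y :=
    ((hF.fderiv_of_isOpen hU (m := ∞) (by simp)).differentiableOn
      (by simp)).differentiableAt (hU.mem_nhds hy)
  have key : ∀ a b : Fin (n + 1), pd a (pd b F) y
      = fderiv ℝ (fderiv ℝ F) y (coordVec n a) (coordVec n b) := by
    intro a b
    change fderiv ℝ (fun z => fderiv ℝ F z (coordVec n b)) y (coordVec n a) = _
    rw [fderiv_clm_apply hd (differentiableAt_const _)]
    simp
  rw [key, key]
  exact ((hF.contDiffAt (hU.mem_nhds hy)).isSymmSndFDerivAt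
    (by simpa using WithTop.coe_le_coe.mpr (le_top : (2 : ℕ∞) ≤ ⊤))).eq _ _

variable (U) in
/-- The algebra of functions that are smooth on `U`. -/
def smoothOn : Subalgebra ℝ (Coord n → ℝ) where
  carrier := {F | ContDiffOn ℝ ∞ F U}
  mul_mem' ha hb := ContDiffOn.mul ha hb
  add_mem' ha hb := ContDiffOn.add ha hb
  algebraMap_mem' _ := contDiffOn_const

/-- The partial derivative as a derivation of the algebra of smooth functions on `U`. -/
def pdDer (hU : IsOpen U) (α : Fin (n + 1)) : Derivation ℝ (smoothOn U) (smoothOn U) where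
  -- Elements of `smoothOn U` are arbitrary off `U`, where `fderiv` need not obey the product rule
  -- or commute. Setting the derivative to zero there makes the derivation laws and commutation hold
  -- identically.
  toFun F := ⟨U.indicator (pd α F.1),
    (contDiffOn_pd hU F.2 α).congr fun y hy => Set.indicator_of_mem hy _⟩
  map_add' F H := by
    ext y
    by_cases hy : y ∈ U
    · have := fderiv_add (differentiableAt_of_contDiffOn hU F.2 hy)
        (differentiableAt_of_contDiffOn hU H.2 hy)
      simp [hy, pd, this]
    · simp [hy]
  map_smul' c F := by
    ext y
    by_cases hy : y ∈ U
    · have := fderiv_const_smul (differentiableAt_of_contDiffOn hU F.2 hy) c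
      simp [hy, pd, this]
    · simp [hy]
  map_one_eq_zero' := by
    ext y
    have : fderiv ℝ (1 : Coord n → ℝ) y = 0 := fderiv_const_apply 1
    by_cases hy : y ∈ U <;> simp [hy, pd, this]
  leibniz' F H := by
    ext y
    by_cases hy : y ∈ U
    · have := pd_mul (differentiableAt_of_contDiffOn hU F.2 hy)
        (differentiableAt_of_contDiffOn hU H.2 hy) α
      change U.indicator (pd α (fun z => F.1 z * H.1 z)) y
        = F.1 y * U.indicator (pd α H.1) y + H.1 y * U.indicator (pd α F.1) y
      simp only [Set.indicator_of_mem hy, this]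
    · simp [hy]

lemma pdDer_apply (hU : IsOpen U) (α : Fin (n + 1)) (F : smoothOn U) {y : Coord n} (hy : y ∈ U) :
    (pdDer hU α F).1 y = pd α F.1 y := Set.indicator_of_mem hy _

lemma pdDer_comm (hU : IsOpen U) (α β : Fin (n + 1)) (F : smoothOn U) :
    pdDer hU α (pdDer hU β F) = pdDer hU β (pdDer hU α F) := by
  ext y
  by_cases hy : y ∈ U
  · rw [pdDer_apply hU _ _ hy, pdDer_apply hU _ _ hy,
      pd_congr hU (fun z hz => pdDer_apply hU β F hz) α hy,
      pd_congr hU (fun z hz => pdDer_apply hU α F hz) β hy, pd_comm hU F.2 α β hy]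
  · simp [pdDer, hy]

lemma pdDer_eq_pd (hU : IsOpen U) (α : Fin (n + 1)) (F : smoothOn U) {H : Coord n → ℝ}
    (h : ∀ y ∈ U, F.1 y = H y) {y : Coord n} (hy : y ∈ U) : (pdDer hU α F).1 y = pd α H y := by
  rw [pdDer_apply hU _ _ hy, pd_congr hU h α hy]

/-- A symmetric nondegenerate matrix of smooth functions: the components of a metric. -/
structure IsMetricOn (g : MatField n) (U : Set (Coord n)) : Prop where
  isOpen : IsOpen U
  smooth : ∀ α β, ContDiffOn ℝ ∞ (fun y => g y α β) U
  symm : ∀ y ∈ U, (g y)ᵀ = g y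
  det_ne_zero : ∀ y ∈ U, (g y).det ≠ 0

variable {g : MatField n}

lemma contDiffOn_det {m : Type*} [Fintype m] [DecidableEq m] {F : Coord n → Matrix m m ℝ}
    (hF : ∀ i j, ContDiffOn ℝ ∞ (fun y => F y i j) U) :
    ContDiffOn ℝ ∞ (fun y => (F y).det) U := by
  simp only [Matrix.det_apply']
  exact ContDiffOn.sum fun σ _ => contDiffOn_const.mul (contDiffOn_prod fun i _ => hF _ _)

/-- Cramer's rule writes each entry of the inverse as a quotient of two determinants in the smooth
entries of `g`. -/
lemma IsMetricOn.contDiffOn_inv (hg : IsMetricOn g U) (α β : Fin (n + 1)) :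
    ContDiffOn ℝ ∞ (fun y => (g y)⁻¹ α β) U := by
  have : (fun y => (g y)⁻¹ α β)
      = fun y => ((g y).det)⁻¹ * ((g y).updateRow β (Pi.single α 1)).det := by
    ext y
    rw [Matrix.inv_def, Matrix.smul_apply, Matrix.adjugate_apply, Ring.inverse_eq_inv', smul_eq_mul]
  rw [this]
  refine ((contDiffOn_det hg.smooth).inv hg.det_ne_zero).mul (contDiffOn_det fun i j => ?_)
  by_cases h : i = β
  · subst h; simpa using contDiffOn_const
  · simpa [Matrix.updateRow_ne h] using hg.smooth i j

open Classical in
/-- The metric as a matrix over the algebra of smooth functions. -/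
def IsMetricOn.mat (hg : IsMetricOn g U) : Matrix (Fin (n + 1)) (Fin (n + 1)) (smoothOn U) :=
  -- The identity matrix off `U`, here and in `inv`, keeps `mat * inv = 1` valid in the whole
  -- algebra, not only at points of `U`.
  Matrix.of fun α β => ⟨fun y => if y ∈ U then g y α β else (1 : Matrix _ _ ℝ) α β,
    (hg.smooth α β).congr fun _ hy => if_pos hy⟩

open Classical in
/-- The inverse metric as a matrix over the algebra of smooth functions. -/
def IsMetricOn.inv (hg : IsMetricOn g U) : Matrix (Fin (n + 1)) (Fin (n + 1)) (smoothOn U) :=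
  Matrix.of fun α β => ⟨fun y => if y ∈ U then (g y)⁻¹ α β else (1 : Matrix _ _ ℝ) α β,
    (hg.contDiffOn_inv α β).congr fun _ hy => if_pos hy⟩

lemma IsMetricOn.mat_apply (hg : IsMetricOn g U) (α β : Fin (n + 1)) {y : Coord n} (hy : y ∈ U) :
    (hg.mat α β).1 y = g y α β := if_pos hy

lemma IsMetricOn.inv_apply (hg : IsMetricOn g U) (α β : Fin (n + 1)) {y : Coord n} (hy : y ∈ U) :
    (hg.inv α β).1 y = (g y)⁻¹ α β := if_pos hy

lemma IsMetricOn.mat_transpose (hg : IsMetricOn g U) : hg.matᵀ = hg.mat := by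
  ext α β y
  by_cases hy : y ∈ U
  · rw [Matrix.transpose_apply, hg.mat_apply _ _ hy, hg.mat_apply _ _ hy]
    exact congrFun (congrFun (hg.symm y hy) α) β
  · simp [IsMetricOn.mat, hy, Matrix.one_apply, eq_comm]

lemma smoothOn_sum_apply {ι : Type*} (s : Finset ι) (F : ι → smoothOn U) (y : Coord n) :
    (∑ i ∈ s, F i).1 y = ∑ i ∈ s, (F i).1 y := by
  have : (∑ i ∈ s, F i).1 = ∑ i ∈ s, (F i).1 := map_sum (smoothOn U).val F s
  rw [this, Finset.sum_apply]

lemma smoothOn_one_apply (α β : Fin (n + 1)) (y : Coord n) :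
    (1 : Matrix (Fin (n + 1)) (Fin (n + 1)) ℝ) α β
    = ((1 : Matrix (Fin (n + 1)) (Fin (n + 1)) (smoothOn U)) α β).1 y := by
  rcases eq_or_ne α β with rfl | h
  · rw [Matrix.one_apply_eq, Matrix.one_apply_eq]; rfl
  · rw [Matrix.one_apply_ne h, Matrix.one_apply_ne h]; rfl

lemma IsMetricOn.mat_mul_inv (hg : IsMetricOn g U) : hg.mat * hg.inv = 1 := by
  ext α β y
  rw [Matrix.mul_apply, smoothOn_sum_apply]
  by_cases hy : y ∈ U
  · have e := Matrix.mul_nonsing_inv (g y) (hg.det_ne_zero y hy).isUnit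
    have e2 := congrFun (congrFun e α) β
    rw [Matrix.mul_apply] at e2
    rw [Finset.sum_congr rfl fun k _ => show (hg.mat α k * hg.inv k β).1 y
      = g y α k * (g y)⁻¹ k β by
        rw [← hg.mat_apply _ _ hy, ← hg.inv_apply _ _ hy]; rfl, e2]
    exact smoothOn_one_apply α β y
  · rw [Finset.sum_congr rfl fun k _ => show (hg.mat α k * hg.inv k β).1 y
      = (1 : Matrix _ _ ℝ) α k * (1 : Matrix _ _ ℝ) k β by
        simp [IsMetricOn.mat, IsMetricOn.inv, hy], ← Matrix.mul_apply, Matrix.one_mul]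
    exact smoothOn_one_apply α β y

/-! ### Evaluating the algebraic tensors at points of a coordinate domain. -/

section Representation

variable (hg : IsMetricOn g U) {y : Coord n} (hy : y ∈ U)
include hg hy

lemma chr_apply (γ α β : Fin (n + 1)) :
    (AlgTensor.chr (pdDer hg.isOpen) hg.mat hg.inv γ α β).1 y = christoffel g γ α β y := by
  have e : ∀ a b c, (pdDer hg.isOpen a (hg.mat b c)).1 y = pd a (fun z => g z b c) y :=
    fun a b c => pdDer_eq_pd _ _ _ (fun z hz => hg.mat_apply b c hz) hy
  unfold AlgTensor.chr christoffel
  change (1 / 2 : ℝ) * (∑ δ, _ : smoothOn U).1 y = _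
  rw [smoothOn_sum_apply]
  congr 1
  refine Finset.sum_congr rfl fun δ _ => ?_
  rw [← e, ← e, ← e, ← hg.inv_apply _ _ hy]
  rfl

lemma ric_apply (α β : Fin (n + 1)) :
    (AlgTensor.ric (pdDer hg.isOpen) hg.mat hg.inv α β).1 y = ricciComp g y α β := by
  have e : ∀ d a b c, (pdDer hg.isOpen d (AlgTensor.chr (pdDer hg.isOpen) hg.mat hg.inv a b c)).1 y
      = pd d (christoffel g a b c) y :=
    fun d a b c => pdDer_eq_pd _ _ _ (fun z hz => chr_apply hg hz a b c) hy
  unfold AlgTensor.ric ricciComp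
  rw [smoothOn_sum_apply, Matrix.of_apply]
  refine Finset.sum_congr rfl fun γ _ => ?_
  rw [← e, ← e]
  simp only [← chr_apply hg hy]
  change _ + (∑ δ, _ : smoothOn U).1 y = _
  rw [smoothOn_sum_apply]
  rfl

lemma scal_apply :
    (AlgTensor.scal (pdDer hg.isOpen) hg.mat hg.inv).1 y = scalarComp g y := by
  unfold AlgTensor.scal scalarComp
  rw [smoothOn_sum_apply]
  refine Finset.sum_congr rfl fun α _ => ?_
  rw [smoothOn_sum_apply]
  refine Finset.sum_congr rfl fun β _ => ?_
  rw [← ric_apply hg hy, ← hg.inv_apply _ _ hy]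
  rfl

lemma ein_apply (α β : Fin (n + 1)) :
    (AlgTensor.ein (pdDer hg.isOpen) hg.mat hg.inv α β).1 y = einsteinComp g y α β := by
  unfold AlgTensor.ein einsteinComp
  rw [Matrix.of_apply, ← scal_apply hg hy, ← ric_apply hg hy, ← hg.mat_apply _ _ hy, mul_assoc]
  rfl

lemma raise_apply {S : MatField n} {S' : Fin (n + 1) → Fin (n + 1) → smoothOn U}
    (hS : ∀ α β, (S' α β).1 y = S y α β) (α β : Fin (n + 1)) :
    (AlgTensor.raise hg.inv S' α β).1 y = raiseComp g S y α β := by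
  unfold AlgTensor.raise raiseComp
  rw [smoothOn_sum_apply, Matrix.of_apply]
  refine Finset.sum_congr rfl fun γ _ => ?_
  rw [smoothOn_sum_apply]
  refine Finset.sum_congr rfl fun δ _ => ?_
  rw [← hS, ← hg.inv_apply _ _ hy, ← hg.inv_apply _ _ hy]
  rfl

lemma algDiv_apply {S : MatField n} {S' : Fin (n + 1) → Fin (n + 1) → smoothOn U}
    (hS : ∀ z ∈ U, ∀ α β, (S' α β).1 z = S z α β) (β : Fin (n + 1)) :
    (AlgTensor.div (pdDer hg.isOpen) hg.mat hg.inv S' β).1 y = divComp g S β y := by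
  have e : ∀ a, (pdDer hg.isOpen a (AlgTensor.raise hg.inv S' a β)).1 y
      = pd a (fun z => raiseComp g S z a β) y :=
    fun a => pdDer_eq_pd _ _ _ (fun z hz => raise_apply hg hz (hS z hz) a β) hy
  unfold AlgTensor.div divComp
  rw [smoothOn_sum_apply]
  refine Finset.sum_congr rfl fun α _ => ?_
  rw [← e]
  simp only [← chr_apply hg hy, ← raise_apply hg hy (hS y hy)]
  change _ + (∑ δ, _ : smoothOn U).1 y = _
  rw [smoothOn_sum_apply]
  rfl

/-- The contracted Bianchi identity in coordinates. -/
theorem divComp_einsteinComp (β : Fin (n + 1)) : divComp g (einsteinComp g) β y = 0 := by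
  rw [← algDiv_apply hg hy (fun z hz α β => ein_apply hg hz α β) β,
    AlgTensor.div_ein (pdDer_comm hg.isOpen) hg.mat_transpose hg.mat_mul_inv]
  rfl

end Representation

lemma contDiffOn_einsteinComp (hg : IsMetricOn g U) (α β : Fin (n + 1)) :
    ContDiffOn ℝ ∞ (fun y => einsteinComp g y α β) U :=
  ContDiffOn.congr (AlgTensor.ein (pdDer hg.isOpen) hg.mat hg.inv α β).2
    fun _ hy => (ein_apply hg hy α β).symm

lemma divComp_congr (hU : IsOpen U) {S T : MatField n} (h : ∀ y ∈ U, ∀ α β, S y α β = T y α β)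
    (β : Fin (n + 1)) {y : Coord n} (hy : y ∈ U) : divComp g S β y = divComp g T β y := by
  have r : ∀ z ∈ U, ∀ a b, raiseComp g S z a b = raiseComp g T z a b := fun z hz a b => by
    simp [raiseComp, h z hz]
  unfold divComp
  refine Finset.sum_congr rfl fun α _ => ?_
  rw [pd_congr hU (fun z hz => r z hz α β) α hy]
  simp [r y hy]

end CoordinateCalculus

/-! ### Conservation of the energy-momentum of a Killing field in coordinates -/

section DerivationDet
variable {ι A : Type*} [Fintype ι] [DecidableEq ι] [CommRing A] [Algebra ℝ A]

lemma derivation_prod {κ : Type*} [DecidableEq κ] (d : Derivation ℝ A A) (s : Finset κ)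
    (f : κ → A) : d (∏ i ∈ s, f i) = ∑ i ∈ s, (∏ j ∈ s.erase i, f j) * d (f i) := by
  induction s using Finset.induction_on with
  | empty => simp
  | insert a s ha ih =>
    rw [Finset.prod_insert ha, Derivation.leibniz, ih, Finset.sum_insert ha,
      Finset.erase_insert ha, smul_eq_mul, smul_eq_mul, Finset.mul_sum, add_comm]
    congr 1
    refine Finset.sum_congr rfl fun i hi => ?_
    have hai : a ≠ i := fun h => ha (h ▸ hi)
    rw [Finset.erase_insert_of_ne hai, Finset.prod_insert (by simp [ha]), mul_assoc]

/-- Jacobi's formula for derivations. -/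
lemma derivation_det (d : Derivation ℝ A A) (m : Matrix ι ι A) :
    d m.det = ∑ i, ∑ j, m.adjugate j i * d (m i j) := by
  -- Leibniz's expansion of the determinant lets the derivation act on one row at a time; Cramer's
  -- rule then identifies each summand with a row of the adjugate.
  have e : d m.det = ∑ i, (m.updateRow i fun j => d (m i j)).det := by
    have hdet : ∀ k : Matrix ι ι A, k.det = ∑ σ : Equiv.Perm ι, σ.sign • ∏ i, k i (σ i) := by
      intro k; rw [← Matrix.det_transpose, Matrix.det_apply]; rfl
    simp only [hdet, map_sum]
    rw [Finset.sum_comm]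
    refine Finset.sum_congr rfl fun σ _ => ?_
    rw [Units.smul_def, map_zsmul, derivation_prod, Finset.smul_sum]
    refine Finset.sum_congr rfl fun i _ => ?_
    have h1 : m.updateRow i (fun j => d (m i j)) i (σ i) = d (m i (σ i)) :=
      congrFun (Matrix.updateRow_self (M := m)) _
    have h2 : ∏ j ∈ Finset.univ.erase i, m.updateRow i (fun j => d (m i j)) j (σ j)
        = ∏ j ∈ Finset.univ.erase i, m j (σ j) :=
      Finset.prod_congr rfl fun j hj =>
        congrFun (Matrix.updateRow_ne (Finset.ne_of_mem_erase hj)) _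
    rw [← Finset.mul_prod_erase Finset.univ _ (Finset.mem_univ i), h1, h2, mul_comm, Units.smul_def]
  rw [e]
  refine Finset.sum_congr rfl fun i _ => ?_
  rw [← Matrix.cramer_transpose_apply, Matrix.cramer_eq_adjugate_mulVec, Matrix.mulVec,
    ← Matrix.adjugate_transpose]
  rfl

namespace AlgTensor
variable {D : ι → Derivation ℝ A A} {g h : Matrix ι ι A}

/-- In the trace, two of the three metric derivatives cancel by the symmetry of `h`. -/
lemma sum_chr_trace (hg : gᵀ = g) (hgh : g * h = 1) (γ : ι) :
    ∑ α, chr D g h α α γ = (1 / 2 : ℝ) • ∑ α, ∑ δ, h α δ * D γ (g δ α) := by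
  have hs : ∀ i j, h i j = h j i := fun i j => congrFun (congrFun (inv_symm hg hgh) j) i
  have e : ∀ i j, g i j = g j i := fun i j => congrFun (congrFun hg j) i
  unfold chr
  rw [← Finset.smul_sum]
  congr 1
  have : ∑ α, ∑ δ, h α δ * D α (g δ γ) = ∑ α, ∑ δ, h α δ * D δ (g α γ) := by
    rw [Finset.sum_comm]
    exact Finset.sum_congr rfl fun _ _ => Finset.sum_congr rfl fun _ _ => by rw [hs]
  simp only [mul_sub, mul_add, Finset.sum_sub_distrib, Finset.sum_add_distrib]
  rw [this]; ring

lemma derivation_det_metric (hg : gᵀ = g) (hgh : g * h = 1) (γ : ι) :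
    D γ g.det = (2 : ℝ) • (g.det * ∑ α, chr D g h α α γ) := by
  have ha : g.adjugate = g.det • h := by
    calc g.adjugate = g.adjugate * (g * h) := by rw [hgh, Matrix.mul_one]
      _ = g.det • h := by
        rw [← Matrix.mul_assoc, Matrix.adjugate_mul, Matrix.smul_mul, Matrix.one_mul]
  rw [sum_chr_trace hg hgh, mul_smul_comm, smul_smul, derivation_det, ha, Finset.sum_comm,
    Finset.mul_sum]
  norm_num
  refine Finset.sum_congr rfl fun i _ => ?_
  rw [Finset.mul_sum]
  exact Finset.sum_congr rfl fun j _ => mul_assoc _ _ _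

end AlgTensor
end DerivationDet

/-! ### The density `√|g|` and the divergence of `X_α S^{αβ}` in coordinates. -/

section Conservation

variable {n : ℕ} {U : Set (Coord n)} {g : MatField n}

lemma IsMetricOn.det_mat_apply (hg : IsMetricOn g U) {y : Coord n} (hy : y ∈ U) :
    (hg.mat.det).1 y = (g y).det := by
  let ev : smoothOn U →+* ℝ := (Pi.evalRingHom (fun _ : Coord n => ℝ) y).comp
    (smoothOn U).val.toRingHom
  change ev hg.mat.det = _
  rw [RingHom.map_det]
  congr 1
  ext α β
  exact hg.mat_apply α β hy

lemma pd_det (hg : IsMetricOn g U) {y : Coord n} (hy : y ∈ U) (γ : Fin (n + 1)) :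
    pd γ (fun z => (g z).det) y = 2 * ((g y).det * ∑ α, christoffel g α α γ y) := by
  rw [← pdDer_eq_pd hg.isOpen γ hg.mat.det (fun z hz => hg.det_mat_apply hz) hy,
    AlgTensor.derivation_det_metric hg.mat_transpose hg.mat_mul_inv]
  change 2 * ((hg.mat.det).1 y * (∑ α, _ : smoothOn U).1 y) = _
  rw [smoothOn_sum_apply, hg.det_mat_apply hy]
  simp only [chr_apply hg hy]

/-- Jacobi's formula under the square root: the logarithmic derivative of `√|g|` is the trace of the
connection. The constant `σ` fixes the sign of the determinant; for the Lorentz metrics below it is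
`(-1) ^ n`. -/
lemma pd_sqrt_det (hg : IsMetricOn g U) {σ : ℝ} (hσ : ∀ y ∈ U, 0 < σ * (g y).det) {y : Coord n}
    (hy : y ∈ U) (γ : Fin (n + 1)) :
    pd γ (fun z => √(σ * (g z).det)) y = √(σ * (g y).det) * ∑ α, christoffel g α α γ y := by
  have hd : DifferentiableAt ℝ (fun z => (g z).det) y :=
    differentiableAt_of_contDiffOn hg.isOpen (contDiffOn_det hg.smooth) hy
  have hpos := hσ y hy
  have hs : 0 < √(σ * (g y).det) := Real.sqrt_pos.mpr hpos
  have e : pd γ (fun z => √(σ * (g z).det)) y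
      = 1 / (2 * √(σ * (g y).det)) * (σ * pd γ (fun z => (g z).det) y) := by
    simp only [pd]
    rw [fderiv_sqrt (hd.const_mul σ) hpos.ne', fderiv_const_mul hd]
    simp
  rw [e, pd_det hg hy]
  have := Real.mul_self_sqrt hpos.le
  field_simp
  linear_combination (-(∑ α, christoffel g α α γ y)) * this

lemma contDiffOn_raiseComp (hg : IsMetricOn g U) {S : MatField n}
    (hS : ∀ α β, ContDiffOn ℝ ∞ (fun z => S z α β) U) (α β : Fin (n + 1)) :
    ContDiffOn ℝ ∞ (fun z => raiseComp g S z α β) U :=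
  show ContDiffOn ℝ ∞ (fun z => ∑ γ, ∑ δ, (g z)⁻¹ α γ * (g z)⁻¹ β δ * S z γ δ) U from
  ContDiffOn.sum fun γ _ => ContDiffOn.sum fun δ _ =>
    ((hg.contDiffOn_inv α γ).mul (hg.contDiffOn_inv β δ)).mul (hS γ δ)

/-- The derivative of `√|g|` supplies the trace term of the covariant divergence, so the sum is
`√|g| (X_α ∇_β R^{αβ} + R^{αβ} ∇_β X_α)`. The first term vanishes by `hdiv`; in the second, the
symmetric `R` sees only the symmetrized derivative of `X`, which is zero by the Killing equation. -/
lemma sum_pd_density_eq_zero_aux (hg : IsMetricOn g U) {σ : ℝ}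
    (hσ : ∀ y ∈ U, 0 < σ * (g y).det) {R : Fin (n + 1) → Fin (n + 1) → Coord n → ℝ}
    (hR : ∀ α β, ContDiffOn ℝ ∞ (R α β) U) (hsymm : ∀ y ∈ U, ∀ α β, R α β y = R β α y)
    (hdiv : ∀ y ∈ U, ∀ β, ∑ α, (pd α (R α β) y + ∑ γ, (christoffel g α α γ y * R γ β y
      + christoffel g β α γ y * R α γ y)) = 0)
    {X : Coord n → Fin (n + 1) → ℝ} (hX : ∀ α, ContDiffOn ℝ ∞ (fun z => X z α) U)
    (hK : ∀ y ∈ U, ∀ α β, covDerivComp g X α β y + covDerivComp g X β α y = 0)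
    {y : Coord n} (hy : y ∈ U) :
    ∑ β, pd β (fun z => √(σ * (g z).det) * ∑ α, X z α * R α β z) y = 0 := by
  have dS := fun α β => differentiableAt_of_contDiffOn hg.isOpen (hR α β) hy
  have dX := fun α => differentiableAt_of_contDiffOn hg.isOpen (hX α) hy
  have ds : DifferentiableAt ℝ (fun z => √(σ * (g z).det)) y :=
    ((differentiableAt_of_contDiffOn hg.isOpen (contDiffOn_det hg.smooth) hy).const_mul σ).sqrt
      (hσ y hy).ne'
  set s := √(σ * (g y).det)
  have e1 : ∀ β, pd β (fun z => √(σ * (g z).det) * ∑ α, X z α * R α β z) y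
      = s * (∑ α, (X y α * pd β (R α β) y + R α β y * pd β (fun z => X z α) y)
        + (∑ γ, christoffel g γ γ β y) * ∑ α, X y α * R α β y) := by
    intro β
    rw [pd_mul ds (DifferentiableAt.fun_sum fun α _ => (dX α).fun_mul (dS α β)),
      pd_sum _ (fun α _ => (dX α).fun_mul (dS α β)), pd_sqrt_det hg hσ hy,
      Finset.sum_congr rfl fun α _ => pd_mul (dX α) (dS α β) β]
    ring
  simp only [e1]
  rw [← Finset.mul_sum]
  refine mul_eq_zero_of_right _ ?_
  have e3 : ∑ α, ∑ β, R α β y * covDerivComp g X β α y = 0 := by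
    have h1 : ∑ α, ∑ β, R α β y * covDerivComp g X β α y
        = ∑ α, ∑ β, R α β y * covDerivComp g X α β y := by
      rw [Finset.sum_comm]
      exact Finset.sum_congr rfl fun a _ => Finset.sum_congr rfl fun b _ => by rw [hsymm y hy]
    have h2 : ∑ α, ∑ β, R α β y * covDerivComp g X β α y
        + ∑ α, ∑ β, R α β y * covDerivComp g X α β y = 0 := by
      simp only [← Finset.sum_add_distrib, ← mul_add]
      exact Finset.sum_eq_zero fun a _ => Finset.sum_eq_zero fun b _ => by
        rw [hK y hy, mul_zero]
    linarith
  have e4 := Finset.sum_eq_zero fun α (_ : α ∈ Finset.univ) =>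
    mul_eq_zero_of_right (X y α) (hdiv y hy α)
  simp only [covDerivComp, mul_add, mul_sub, Finset.mul_sum, Finset.sum_add_distrib,
    Finset.sum_sub_distrib] at e3 e4 ⊢
  have f1 : ∑ β, ∑ α, X y α * pd β (R α β) y = ∑ α, ∑ β, X y α * pd β (R β α) y := by
    rw [Finset.sum_comm]
    refine Finset.sum_congr rfl fun α _ => Finset.sum_congr rfl fun β _ => ?_
    rw [pd_congr hg.isOpen (fun z hz => hsymm z hz α β) β hy]
  have f2 : ∑ β, ∑ α, R α β y * pd β (fun z => X z α) y
      = ∑ α, ∑ β, R α β y * pd β (fun z => X z α) y := Finset.sum_comm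
  have f3 : ∑ β, ∑ α, (∑ γ, christoffel g γ γ β y) * (X y α * R α β y)
      = ∑ α, ∑ β, ∑ γ, X y α * (christoffel g β β γ y * R γ α y) := by
    rw [Finset.sum_comm]
    refine Finset.sum_congr rfl fun α _ => ?_
    rw [Finset.sum_comm (f := fun β γ => X y α * (christoffel g β β γ y * R γ α y))]
    refine Finset.sum_congr rfl fun β _ => ?_
    rw [Finset.sum_mul]
    refine Finset.sum_congr rfl fun γ _ => ?_
    rw [hsymm y hy β α]; ring
  -- The Christoffel term for the free index of the divergence is, after relabelling, the one
  -- subtracted in `∇_β X_α`.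
  have f4 : ∑ α, ∑ β, ∑ γ, X y α * (christoffel g α β γ y * R β γ y)
      = ∑ α, ∑ β, ∑ γ, R α β y * (christoffel g γ β α y * X y γ) := by
    rw [Finset.sum_comm_cycle]
    refine Finset.sum_congr rfl fun a _ => ?_
    rw [Finset.sum_comm]
    refine Finset.sum_congr rfl fun b _ => Finset.sum_congr rfl fun c _ => ?_
    rw [hsymm y hy b a]; ring
  rw [f1, f2, f3]
  linarith

/-- If `S` is symmetric and divergence free and `X` is a Killing covector field, then the
energy-momentum density `√|g| X_α S^{αβ}` is divergence free. -/
theorem sum_pd_density_eq_zero (hg : IsMetricOn g U) {σ : ℝ} (hσ : ∀ y ∈ U, 0 < σ * (g y).det)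
    {S : MatField n} (hS : ∀ α β, ContDiffOn ℝ ∞ (fun z => S z α β) U)
    (hsymm : ∀ y ∈ U, ∀ α β, S y α β = S y β α)
    (hdiv : ∀ y ∈ U, ∀ β, divComp g S β y = 0)
    {X : Coord n → Fin (n + 1) → ℝ} (hX : ∀ α, ContDiffOn ℝ ∞ (fun z => X z α) U)
    (hK : ∀ y ∈ U, ∀ α β, covDerivComp g X α β y + covDerivComp g X β α y = 0)
    {y : Coord n} (hy : y ∈ U) :
    ∑ β, pd β (fun z => √(σ * (g z).det) * ∑ α, X z α * raiseComp g S z α β) y = 0 := by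
  refine sum_pd_density_eq_zero_aux hg hσ (R := fun α β z => raiseComp g S z α β)
    (fun α β => contDiffOn_raiseComp hg hS α β) (fun y hy α β => ?_) hdiv hX hK hy
  simp only [raiseComp, Matrix.of_apply]
  rw [Finset.sum_comm]
  refine Finset.sum_congr rfl fun γ _ => Finset.sum_congr rfl fun δ _ => ?_
  rw [hsymm y hy]; ring

end Conservation

/-! ### The balance law for a divergence-free current in one chart -/

section Balance

variable {n : ℕ} {O : Set (EuclideanSpace ℝ (Fin n))} {u : EuclideanSpace ℝ (Fin n) → ℝ}

/-- At a point outside `O` the product vanishes on a whole neighbourhood, because the closed support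
of `u` lies in `O`. -/
lemma contDiff_cutoff_mul (hO : IsOpen O) (hu : ContDiff ℝ ∞ u) (hs : tsupport u ⊆ O)
    {F : Coord n → ℝ} (hF : ContDiffOn ℝ ∞ F (O ×ˢ Set.univ)) :
    ContDiff ℝ ∞ (fun z : Coord n => u z.1 * F z) := by
  rw [contDiff_iff_contDiffAt]
  intro z
  by_cases hz : z.1 ∈ O
  · exact (hu.comp contDiff_fst).contDiffAt.mul
      (hF.contDiffAt ((hO.prod isOpen_univ).mem_nhds ⟨hz, trivial⟩))
  · have hz' : z.1 ∈ (tsupport u)ᶜ := fun h => hz (hs h)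
    have hn : {w : Coord n | w.1 ∈ (tsupport u)ᶜ} ∈ 𝓝 z :=
      ((isClosed_tsupport u).isOpen_compl.preimage continuous_fst).mem_nhds hz'
    refine (contDiffAt_const (c := (0 : ℝ))).congr_of_eventuallyEq ?_
    filter_upwards [hn] with w hw
    rw [image_eq_zero_of_notMem_tsupport hw, zero_mul]

lemma pd_eq_zero_of_notMem_tsupport {H : Coord n → ℝ} {K : Set (EuclideanSpace ℝ (Fin n))}
    (hK : IsClosed K) (h : ∀ z : Coord n, z.1 ∉ K → H z = 0) (α : Fin (n + 1)) {z : Coord n}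
    (hz : z.1 ∉ K) : pd α H z = 0 := by
  rw [pd_congr (hK.isOpen_compl.preimage continuous_fst) (H := fun _ => 0)
    (fun w hw => h w hw) α hz]
  simp [pd]

lemma integral_pd_succ_eq_zero {H : Coord n → ℝ} (hH : ContDiff ℝ ∞ H)
    {K : Set (EuclideanSpace ℝ (Fin n))} (hK : IsCompact K) (h : ∀ z : Coord n, z.1 ∉ K → H z = 0)
    (i : Fin n) (t : ℝ) : ∫ x, pd i.succ H (x, t) = 0 := by
  set f : EuclideanSpace ℝ (Fin n) → ℝ := fun x => H (x, t) with hf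
  have hfs : ContDiff ℝ ∞ f := hH.comp (contDiff_id.prodMk contDiff_const)
  have hc : HasCompactSupport f := HasCompactSupport.intro hK fun x hx => h (x, t) hx
  have e : ∀ x, pd i.succ H (x, t) = fderiv ℝ f x (EuclideanSpace.single i 1) := by
    intro x
    have h1 : HasFDerivAt (fun x : EuclideanSpace ℝ (Fin n) => (x, t))
        ((ContinuousLinearMap.id ℝ _).prod 0) x := (hasFDerivAt_id x).prodMk (hasFDerivAt_const t x)
    have h2 := ((hH.differentiable (by simp)) (x, t)).hasFDerivAt.comp x h1
    have h3 : fderiv ℝ f x = _ := h2.fderiv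
    rw [h3]
    simp [pd, coordVec]
  have hcf : Continuous fun x => fderiv ℝ f x (EuclideanSpace.single i 1) :=
    (hfs.continuous_fderiv (by simp)).clm_apply continuous_const
  -- Integration by parts against the constant function `1`, whose derivative vanishes.
  have key := integral_mul_fderiv_eq_neg_fderiv_mul_of_integrable (μ := volume)
    (f := fun _ : EuclideanSpace ℝ (Fin n) => (1 : ℝ)) (g := f)
    (v := EuclideanSpace.single i 1) (by simp)
    (by
      simp only [one_mul]
      exact hcf.integrable_of_hasCompactSupport (hc.fderiv_apply (𝕜 := ℝ) _))
    (by
      simp only [one_mul]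
      exact hfs.continuous.integrable_of_hasCompactSupport hc)
    (fun _ _ => differentiableAt_const _)
    (fun x _ => hfs.differentiable (by simp) x)
  simp only [e]
  simpa using key

lemma continuous_pd {H : Coord n → ℝ} (hH : ContDiff ℝ ∞ H) (α : Fin (n + 1)) :
    Continuous (pd α H) :=
  (hH.continuous_fderiv (by simp)).clm_apply continuous_const

variable {F : Fin (n + 1) → Coord n → ℝ}

/-- In the chart, the flux of the current `F` through the cutoff `u` is the integral of a time
derivative. -/
lemma integral_current_cutoff (hO : IsOpen O) (hu : ContDiff ℝ ∞ u) (hs : tsupport u ⊆ O)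
    (hc : HasCompactSupport u) (hF : ∀ α, ContDiffOn ℝ ∞ (F α) (O ×ˢ Set.univ))
    (hdiv : ∀ z ∈ O ×ˢ (Set.univ : Set ℝ), ∑ α, pd α (F α) z = 0) (t : ℝ) :
    ∫ x, ∑ α, F α (x, t) * pd α (fun w : Coord n => u w.1) (x, t)
      = ∫ x, pd 0 (fun w : Coord n => u w.1 * F 0 w) (x, t) := by
  have hH := fun α => contDiff_cutoff_mul hO hu hs (hF α)
  have hz : ∀ α, ∀ z : Coord n, z.1 ∉ tsupport u → u z.1 * F α z = 0 := fun α z hz => by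
    rw [image_eq_zero_of_notMem_tsupport hz, zero_mul]
  -- On `O` this is the product rule with `∂_α F^α = 0`; off `O` both sides vanish, even though
  -- nothing is known about `F` there. The spatial terms on the right then integrate to zero.
  have e : ∀ x, ∑ α, F α (x, t) * pd α (fun w : Coord n => u w.1) (x, t)
      = ∑ α, pd α (fun w : Coord n => u w.1 * F α w) (x, t) := by
    intro x
    by_cases hx : x ∈ O
    · have hxt : (x, t) ∈ O ×ˢ (Set.univ : Set ℝ) := ⟨hx, trivial⟩
      have hd := fun α => differentiableAt_of_contDiffOn (hO.prod isOpen_univ) (hF α) hxt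
      have hud : DifferentiableAt ℝ (fun w : Coord n => u w.1) (x, t) :=
        (hu.comp contDiff_fst).differentiable (by simp) _
      have : ∀ α, pd α (fun w : Coord n => u w.1 * F α w) (x, t)
          = u x * pd α (F α) (x, t) + F α (x, t) * pd α (fun w : Coord n => u w.1) (x, t) :=
        fun α => pd_mul hud (hd α) α
      simp only [this, Finset.sum_add_distrib, ← Finset.mul_sum, hdiv _ hxt, mul_zero, zero_add]
    · have hx' : x ∉ tsupport u := fun h => hx (hs h)
      rw [Finset.sum_eq_zero, Finset.sum_eq_zero]
      · exact fun α _ => pd_eq_zero_of_notMem_tsupport (isClosed_tsupport u) (hz α) α hx'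
      · intro α _
        rw [pd_eq_zero_of_notMem_tsupport (isClosed_tsupport u)
          (fun z hz => image_eq_zero_of_notMem_tsupport hz) α hx', mul_zero]
  have hint : ∀ α, Integrable fun x => pd α (fun w : Coord n => u w.1 * F α w) (x, t) := by
    intro α
    refine Continuous.integrable_of_hasCompactSupport
      ((continuous_pd (hH α) α).comp (continuous_id.prodMk continuous_const))
      (HasCompactSupport.intro hc fun x hx => ?_)
    exact pd_eq_zero_of_notMem_tsupport (isClosed_tsupport u) (hz α) α hx
  simp only [e]
  rw [integral_finsetSum _ fun α _ => hint α, Fin.sum_univ_succ, Finset.sum_eq_zero, add_zero]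
  exact fun i _ => integral_pd_succ_eq_zero (hH i.succ) hc (hz i.succ) i t

/-- Continuity in time ensures the interval integrability needed to sum over a partition of unity.
It holds because the integrand on the right of `integral_current_cutoff` is jointly continuous and
supported over a fixed compact set. -/
lemma continuous_integral_current_cutoff (hO : IsOpen O) (hu : ContDiff ℝ ∞ u)
    (hs : tsupport u ⊆ O)
    (hc : HasCompactSupport u) (hF : ∀ α, ContDiffOn ℝ ∞ (F α) (O ×ˢ Set.univ))
    (hdiv : ∀ z ∈ O ×ˢ (Set.univ : Set ℝ), ∑ α, pd α (F α) z = 0) :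
    Continuous fun t => ∫ x, ∑ α, F α (x, t) * pd α (fun w : Coord n => u w.1) (x, t) := by
  simp only [integral_current_cutoff hO hu hs hc hF hdiv]
  have e : ∀ t, ∫ x, pd 0 (fun w : Coord n => u w.1 * F 0 w) (x, t)
      = ∫ x in tsupport u, pd 0 (fun w : Coord n => u w.1 * F 0 w) (x, t) := fun t =>
    (setIntegral_eq_integral_of_forall_compl_eq_zero fun x hx =>
      pd_eq_zero_of_notMem_tsupport (isClosed_tsupport u)
        (fun z hz => by rw [image_eq_zero_of_notMem_tsupport hz, zero_mul]) 0 hx).symm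
  simp only [e]
  refine continuous_parametric_integral_of_continuous
    (f := fun t x => pd 0 (fun w : Coord n => u w.1 * F 0 w) (x, t)) ?_ hc
  exact (continuous_pd (contDiff_cutoff_mul hO hu hs (hF 0)) 0).comp continuous_swap

/-- The balance law in one chart. -/
lemma balance_cutoff (hO : IsOpen O) (hu : ContDiff ℝ ∞ u) (hs : tsupport u ⊆ O)
    (hc : HasCompactSupport u) (hF : ∀ α, ContDiffOn ℝ ∞ (F α) (O ×ˢ Set.univ))
    (hdiv : ∀ z ∈ O ×ˢ (Set.univ : Set ℝ), ∑ α, pd α (F α) z = 0) (t₀ t₁ : ℝ) :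
    ∫ t in t₀..t₁, ∫ x, ∑ α, F α (x, t) * pd α (fun w : Coord n => u w.1) (x, t)
      = (∫ x, u x * F 0 (x, t₁)) - ∫ x, u x * F 0 (x, t₀) := by
  simp only [integral_current_cutoff hO hu hs hc hF hdiv]
  set H : Coord n → ℝ := fun w => u w.1 * F 0 w with hHdef
  have hH : ContDiff ℝ ∞ H := contDiff_cutoff_mul hO hu hs (hF 0)
  have hz : ∀ z : Coord n, z.1 ∉ tsupport u → H z = 0 := fun z hz => by
    rw [hHdef]; simp only; rw [image_eq_zero_of_notMem_tsupport hz, zero_mul]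
  have hcont : Continuous fun q : ℝ × EuclideanSpace ℝ (Fin n) => pd 0 H (q.2, q.1) :=
    (continuous_pd hH 0).comp continuous_swap
  -- Fubini's hypothesis: a continuous function over a bounded time interval that vanishes off a
  -- compact set in space.
  have hsw : Integrable (Function.uncurry fun t x => pd 0 H (x, t))
      ((volume.restrict (Set.uIoc t₀ t₁)).prod volume) := by
    rw [← Measure.restrict_univ (μ := (volume : Measure (EuclideanSpace ℝ (Fin n)))),
      Measure.prod_restrict]
    have h1 : IntegrableOn (Function.uncurry fun t x => pd 0 H (x, t))
        (Set.uIoc t₀ t₁ ×ˢ tsupport u) ((volume : Measure ℝ).prod volume) :=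
      (hcont.continuousOn.integrableOn_compact (isCompact_uIcc.prod hc)).mono_set
        (Set.prod_mono Set.uIoc_subset_uIcc subset_rfl)
    refine h1.of_forall_sdiff_eq_zero (measurableSet_uIoc.prod MeasurableSet.univ) ?_
    rintro ⟨t, x⟩ ⟨⟨ht, -⟩, hx⟩
    exact pd_eq_zero_of_notMem_tsupport (isClosed_tsupport u) hz 0 fun h => hx ⟨ht, h⟩
  rw [intervalIntegral_integral_swap hsw]
  have ftc : ∀ x, ∫ t in t₀..t₁, pd 0 H (x, t) = H (x, t₁) - H (x, t₀) := by
    intro x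
    refine intervalIntegral.integral_eq_sub_of_hasDerivAt (f := fun t => H (x, t)) (fun t _ => ?_)
      (((continuous_pd hH 0).comp (continuous_const.prodMk continuous_id)).intervalIntegrable _ _)
    have h1 : HasDerivAt (fun t : ℝ => (x, t)) (0, 1) t :=
      (hasDerivAt_const t x).prodMk (hasDerivAt_id t)
    exact ((hH.differentiable (by simp)) (x, t)).hasFDerivAt.comp_hasDerivAt t h1
  simp only [ftc]
  have hi : ∀ t, Integrable fun x => H (x, t) := fun t =>
    (hH.continuous.comp (continuous_id.prodMk continuous_const)).integrable_of_hasCompactSupport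
      (HasCompactSupport.intro hc fun x hx => hz (x, t) hx)
  exact integral_sub (hi t₁) (hi t₀)

end Balance

/-! ### Charts of the spacetime and the components of tensor fields -/

section ChartCalculus

variable {n : ℕ} {M : Type*} [TopologicalSpace M] [ChartedSpace (EuclideanSpace ℝ (Fin n)) M]

lemma chartPoint_coordsAt (p : M × ℝ) :
    chartPoint (chartAt (EuclideanSpace ℝ (Fin n)) p.1) (coordsAt p) = p := by
  simp [chartPoint, coordsAt]

lemma coordsAt_mem (p : M × ℝ) :
    (coordsAt p : Coord n).1 ∈ (chartAt (EuclideanSpace ℝ (Fin n)) p.1).target := by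
  simp [coordsAt]

/-- The differential of the inverse of the chart `e`. -/
def chartDeriv (e : OpenPartialHomeomorph M (EuclideanSpace ℝ (Fin n)))
    (x : EuclideanSpace ℝ (Fin n)) : EuclideanSpace ℝ (Fin n) →L[ℝ] EuclideanSpace ℝ (Fin n) :=
  mfderiv (𝓡 n) (𝓡 n) e.symm x

variable [IsManifold (𝓡 n) ∞ M] {e : OpenPartialHomeomorph M (EuclideanSpace ℝ (Fin n))}

lemma contMDiffAt_chart_symm (he : e ∈ atlas (EuclideanSpace ℝ (Fin n)) M)
    {x : EuclideanSpace ℝ (Fin n)} (hx : x ∈ e.target) : ContMDiffAt (𝓡 n) (𝓡 n) ∞ e.symm x :=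
  (contMDiffOn_symm_of_mem_maximalAtlas (IsManifold.subset_maximalAtlas he)).contMDiffAt
    (e.open_target.mem_nhds hx)

lemma contMDiffAt_chart (he : e ∈ atlas (EuclideanSpace ℝ (Fin n)) M)
    {x : M} (hx : x ∈ e.source) : ContMDiffAt (𝓡 n) (𝓡 n) ∞ e x :=
  (contMDiffOn_of_mem_maximalAtlas (IsManifold.subset_maximalAtlas he)).contMDiffAt
    (e.open_source.mem_nhds hx)

lemma contMDiffAt_chartPoint (he : e ∈ atlas (EuclideanSpace ℝ (Fin n)) M)
    {y : Coord n} (hy : y.1 ∈ e.target) :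
    ContMDiffAt 𝓘(ℝ, Coord n) (STModel n) ∞ (chartPoint e) y := by
  have h1 : ContMDiffAt 𝓘(ℝ, Coord n) (𝓡 n) ∞ (fun y : Coord n => y.1) y :=
    contDiff_fst.contMDiff.contMDiffAt
  have h2 : ContMDiffAt 𝓘(ℝ, Coord n) 𝓘(ℝ, ℝ) ∞ (fun y : Coord n => y.2) y :=
    contDiff_snd.contMDiff.contMDiffAt
  exact (ContMDiffAt.comp y (contMDiffAt_chart_symm he hy) h1).prodMk h2

lemma mfderiv_chartPoint (he : e ∈ atlas (EuclideanSpace ℝ (Fin n)) M)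
    {y : Coord n} (hy : y.1 ∈ e.target) (v : Coord n) :
    (mfderiv 𝓘(ℝ, Coord n) (STModel n) (chartPoint e) y v : Coord n)
      = (chartDeriv e y.1 v.1, v.2) := by
  have h1 : HasMFDerivAt 𝓘(ℝ, Coord n) (𝓡 n) (fun y : Coord n => y.1) y
      (ContinuousLinearMap.fst ℝ (EuclideanSpace ℝ (Fin n)) ℝ) :=
    (hasFDerivAt_fst (p := y)).hasMFDerivAt
  have h2 : HasMFDerivAt 𝓘(ℝ, Coord n) 𝓘(ℝ, ℝ) (fun y : Coord n => y.2) y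
      (ContinuousLinearMap.snd ℝ (EuclideanSpace ℝ (Fin n)) ℝ) :=
    (hasFDerivAt_snd (p := y)).hasMFDerivAt
  have h3 : HasMFDerivAt (𝓡 n) (𝓡 n) e.symm y.1 (chartDeriv e y.1) :=
    ((contMDiffAt_chart_symm he hy).mdifferentiableAt (by simp)).hasMFDerivAt
  have h4 := (HasMFDerivAt.comp y h3 h1).prodMk h2
  have h5 : mfderiv 𝓘(ℝ, Coord n) (STModel n) (chartPoint e) y = _ := h4.mfderiv
  rw [h5]
  rfl

lemma chartFrame_zero (he : e ∈ atlas (EuclideanSpace ℝ (Fin n)) M)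
    {y : Coord n} (hy : y.1 ∈ e.target) : (chartFrame e y 0 : Coord n) = (0, 1) :=
  (mfderiv_chartPoint he hy _).trans (Prod.ext (map_zero (chartDeriv e y.1)) rfl)

lemma chartFrame_succ (he : e ∈ atlas (EuclideanSpace ℝ (Fin n)) M)
    {y : Coord n} (hy : y.1 ∈ e.target) (i : Fin n) :
    (chartFrame e y i.succ : Coord n) = (chartDeriv e y.1 (EuclideanSpace.single i 1), 0) :=
  mfderiv_chartPoint he hy _

/-- The tangent space at `x` is identified with `ℝⁿ` through the preferred chart at `x`, and in that
chart its own inverse reads as the identity near the point. -/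
lemma chartDeriv_chartAt (x : M) :
    chartDeriv (chartAt (EuclideanSpace ℝ (Fin n)) x) (chartAt (EuclideanSpace ℝ (Fin n)) x x)
      = ContinuousLinearMap.id ℝ _ := by
  set e := chartAt (EuclideanSpace ℝ (Fin n)) x with he
  have hx : e x ∈ e.target := mem_chart_target _ x
  have hmd : MDifferentiableAt (𝓡 n) (𝓡 n) e.symm (e x) :=
    (contMDiffAt_chart_symm (chart_mem_atlas _ x) hx).mdifferentiableAt (by simp)
  unfold chartDeriv
  rw [hmd.mfderiv]
  have hev : writtenInExtChartAt (𝓡 n) (𝓡 n) (e x) e.symm =ᶠ[𝓝 (e x)] id := by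
    filter_upwards [e.open_target.mem_nhds hx] with z hz
    have h1 : e.symm (e x) = x := e.left_inv (mem_chart_source _ x)
    simp only [writtenInExtChartAt, h1, Function.comp_apply, extChartAt_model_space_eq_id, id]
    simp [← he, e.right_inv hz]
  have hpt : extChartAt (𝓡 n) (e x) (e x) = e x := rfl
  rw [hpt, ModelWithCorners.range_eq_univ, fderivWithin_univ, hev.fderiv_eq, fderiv_id]

lemma chartDeriv_injective (he : e ∈ atlas (EuclideanSpace ℝ (Fin n)) M)
    {x : EuclideanSpace ℝ (Fin n)} (hx : x ∈ e.target) : Function.Injective (chartDeriv e x) := by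
  have h3 : HasMFDerivAt (𝓡 n) (𝓡 n) e.symm x (chartDeriv e x) :=
    ((contMDiffAt_chart_symm he hx).mdifferentiableAt (by simp)).hasMFDerivAt
  have h4 : HasMFDerivAt (𝓡 n) (𝓡 n) e (e.symm x) (mfderiv (𝓡 n) (𝓡 n) e (e.symm x)) :=
    ((contMDiffAt_chart he (e.map_target hx)).mdifferentiableAt (by simp)).hasMFDerivAt
  have h5 := HasMFDerivAt.comp x h4 h3
  have hev : e ∘ e.symm =ᶠ[𝓝 x] id := by
    filter_upwards [e.open_target.mem_nhds hx] with z hz using e.right_inv hz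
  have h6 := h5.mfderiv
  rw [hev.mfderiv_eq, mfderiv_id] at h6
  intro a b hab
  have h7 : ∀ c, (mfderiv (𝓡 n) (𝓡 n) e (e.symm x) (chartDeriv e x c) :
      EuclideanSpace ℝ (Fin n)) = c := fun c => (DFunLike.congr_fun h6 c).symm
  rw [← h7 a, ← h7 b, hab]

/-- In the preferred chart at `p`, the coordinate frame at `p` is the standard basis. -/
lemma chartFrame_coordsAt (p : M × ℝ) (α : Fin (n + 1)) :
    (chartFrame (chartAt (EuclideanSpace ℝ (Fin n)) p.1) (coordsAt p) α : Coord n)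
      = coordVec n α := by
  rw [chartFrame, mfderiv_chartPoint (chart_mem_atlas _ _) (coordsAt_mem p)]
  simp only [coordsAt, chartDeriv_chartAt]
  rfl

lemma comp_coordsAt (B : TwoTensor n M) (p : M × ℝ) (α β : Fin (n + 1)) :
    comp (chartAt (EuclideanSpace ℝ (Fin n)) p.1) B (coordsAt p) α β
      = B p (frame p α) (frame p β) := by
  -- The tangent vectors depend on the base point, so the equality of base points is substituted
  -- with both vectors regarded in the fixed space `Coord n`.
  have key : ∀ (q : M × ℝ) (v w v' w' : Coord n), q = p → v = v' → w = w' →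
      B q v w = B p v' w' := by
    rintro q v w v' w' rfl rfl rfl; rfl
  exact key _ _ _ _ _ (chartPoint_coordsAt p) (chartFrame_coordsAt p α) (chartFrame_coordsAt p β)

/-- The frame field is the tangent map of `chartPoint e` composed with a constant vector field,
hence smooth. -/
lemma contMDiffAt_chartFrame (he : e ∈ atlas (EuclideanSpace ℝ (Fin n)) M)
    {y : Coord n} (hy : y.1 ∈ e.target) (α : Fin (n + 1)) :
    ContMDiffAt 𝓘(ℝ, Coord n) (STModel n).tangent ∞
      (fun z => (⟨chartPoint e z, chartFrame e z α⟩ : TangentBundle (STModel n) (M × ℝ))) y := by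
  set U : Set (Coord n) := {z | z.1 ∈ e.target}
  have hU : IsOpen U := e.open_target.preimage continuous_fst
  have h1 : ContMDiffOn 𝓘(ℝ, Coord n) (STModel n) ∞ (chartPoint e) U := fun z hz =>
    (contMDiffAt_chartPoint he hz).contMDiffWithinAt
  have h2 := h1.contMDiffOn_tangentMapWithin (m := ∞) (by simp) hU.uniqueMDiffOn
  have h3 : ContMDiff 𝓘(ℝ, Coord n) 𝓘(ℝ, Coord n).tangent ∞
      (fun z : Coord n => (⟨z, coordVec n α⟩ : TangentBundle 𝓘(ℝ, Coord n) (Coord n))) :=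
    contMDiff_vectorSpace_iff_contDiff.mpr contDiff_const
  have h4 := h2.comp h3.contMDiffOn (s := U) (fun z hz => hz)
  refine (h4.contMDiffAt (hU.mem_nhds hy)).congr_of_eventuallyEq ?_
  filter_upwards [hU.mem_nhds hy] with z hz
  simp only [Function.comp, tangentMapWithin, mfderivWithin_of_isOpen hU hz]
  rfl

lemma contDiffOn_tensor (S : SymTensorField n M) (he : e ∈ atlas (EuclideanSpace ℝ (Fin n)) M)
    {v w : ∀ z : Coord n, TangentSpace (STModel n) (chartPoint e z)}
    (hv : ∀ y : Coord n, y.1 ∈ e.target → ContMDiffAt 𝓘(ℝ, Coord n) (STModel n).tangent ∞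
      (fun z => (⟨chartPoint e z, v z⟩ : TangentBundle (STModel n) (M × ℝ))) y)
    (hw : ∀ y : Coord n, y.1 ∈ e.target → ContMDiffAt 𝓘(ℝ, Coord n) (STModel n).tangent ∞
      (fun z => (⟨chartPoint e z, w z⟩ : TangentBundle (STModel n) (M × ℝ))) y) :
    ContDiffOn ℝ ∞ (fun z => S.tensor (chartPoint e z) (v z) (w z)) (e.target ×ˢ Set.univ) := by
  intro y hy
  have h1 := (S.smooth (chartPoint e y)).comp y (contMDiffAt_chartPoint he hy.1)
  have h2 := ContMDiffAt.clm_bundle_apply₂ (F₁ := Coord n) (F₂ := Coord n) (F₃ := ℝ)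
    (E₃ := Bundle.Trivial (M × ℝ) ℝ) (b := chartPoint e)
    (ψ := fun z => S.val (chartPoint e z)) h1 (hv y hy.1) (hw y hy.1)
  rw [Bundle.contMDiffAt_totalSpace] at h2
  exact h2.2.contDiffAt.contDiffWithinAt

lemma contDiffOn_comp (S : SymTensorField n M) (he : e ∈ atlas (EuclideanSpace ℝ (Fin n)) M)
    (α β : Fin (n + 1)) :
    ContDiffOn ℝ ∞ (fun z => comp e S.tensor z α β) (e.target ×ˢ Set.univ) :=
  contDiffOn_tensor S he (fun _ hy => contMDiffAt_chartFrame he hy α)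
    (fun _ hy => contMDiffAt_chartFrame he hy β)

lemma contDiffOn_lower (S : SymTensorField n M) (he : e ∈ atlas (EuclideanSpace ℝ (Fin n)) M)
    {X : VField n M} (hX : ContMDiff (STModel n) (STModel n).tangent ∞
      (fun p => (⟨p, X p⟩ : TangentBundle (STModel n) (M × ℝ)))) (α : Fin (n + 1)) :
    ContDiffOn ℝ ∞ (fun z => S.tensor (chartPoint e z) (chartFrame e z α) (X (chartPoint e z)))
      (e.target ×ˢ Set.univ) :=
  contDiffOn_tensor S he (fun _ hy => contMDiffAt_chartFrame he hy α)
    (fun y hy => (hX (chartPoint e y)).comp y (contMDiffAt_chartPoint he hy))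

end ChartCalculus

/-! ### Change of frame at a point -/

section MatrixAlgebra

variable {m : Type*} [Fintype m] [DecidableEq m] {A g T : Matrix m m ℝ}

/-- Components of the contraction of a covector with a twice raised tensor. -/
def momentumVec (g T : Matrix m m ℝ) (x : m → ℝ) : m → ℝ := x ᵥ* (g⁻¹ * T * (g⁻¹)ᵀ)

/-- If the columns of `A` are the new frame in the old one, lower indices transform by `Aᵀ` and
inverse metrics by `A⁻¹`. All factors cancel except one, so the result transforms as a vector. -/
lemma mulVec_momentumVec (hA : IsUnit A.det) (x : m → ℝ) :
    A *ᵥ momentumVec (Aᵀ * g * A) (Aᵀ * T * A) (Aᵀ *ᵥ x) = momentumVec g T x := by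
  have h1 : A * A⁻¹ = 1 := Matrix.mul_nonsing_inv A hA
  have hi : (Aᵀ * g * A)⁻¹ = A⁻¹ * g⁻¹ * (A⁻¹)ᵀ := by
    rw [Matrix.mul_inv_rev, Matrix.mul_inv_rev, Matrix.transpose_nonsing_inv, Matrix.mul_assoc]
  have h2 : (A⁻¹)ᵀ * Aᵀ = 1 := by rw [← Matrix.transpose_mul, h1, Matrix.transpose_one]
  have h3 : A * ((Aᵀ * g * A)⁻¹ * (Aᵀ * T * A) * ((Aᵀ * g * A)⁻¹)ᵀ) * Aᵀ = g⁻¹ * T * (g⁻¹)ᵀ := by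
    rw [hi]
    simp only [Matrix.transpose_mul, Matrix.transpose_transpose]
    calc _ = (A * A⁻¹) * g⁻¹ * ((A⁻¹)ᵀ * Aᵀ) * T * (A * A⁻¹) * (g⁻¹)ᵀ * ((A⁻¹)ᵀ * Aᵀ) := by
          simp only [Matrix.mul_assoc]
      _ = _ := by simp only [h1, h2, Matrix.mul_one, Matrix.one_mul]
  unfold momentumVec
  rw [Matrix.mulVec_transpose, ← Matrix.vecMul_transpose, Matrix.vecMul_vecMul,
    Matrix.vecMul_vecMul, ← Matrix.mul_assoc A _ (Aᵀ), h3]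

lemma inv_eq_conj (hA : IsUnit A.det) : A * (Aᵀ * g * A)⁻¹ * Aᵀ = g⁻¹ := by
  have h1 : A * A⁻¹ = 1 := Matrix.mul_nonsing_inv A hA
  have h2 : (A⁻¹)ᵀ * Aᵀ = 1 := by rw [← Matrix.transpose_mul, h1, Matrix.transpose_one]
  rw [Matrix.mul_inv_rev, Matrix.mul_inv_rev, ← Matrix.transpose_nonsing_inv]
  calc _ = (A * A⁻¹) * g⁻¹ * ((A⁻¹)ᵀ * Aᵀ) := by simp only [Matrix.mul_assoc]
    _ = _ := by simp only [h1, h2, Matrix.mul_one, Matrix.one_mul]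

/-- The first row of `A` says that `dt` is the same covector in both frames, and `g^{00}` is its
squared length. -/
lemma inv_zero_zero_conj {n : ℕ} {A g : Matrix (Fin (n + 1)) (Fin (n + 1)) ℝ} (hA : IsUnit A.det)
    (h0 : A 0 0 = 1) (hs : ∀ i : Fin n, A 0 i.succ = 0) : (Aᵀ * g * A)⁻¹ 0 0 = g⁻¹ 0 0 := by
  rw [← inv_eq_conj (g := g) hA]
  generalize (Aᵀ * g * A)⁻¹ = B
  simp [Matrix.mul_apply, Fin.sum_univ_succ, h0, hs]

lemma momentumVec_apply (x : m → ℝ) (β : m) :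
    momentumVec g T x β = ∑ α, x α * ∑ γ, ∑ δ, g⁻¹ α γ * g⁻¹ β δ * T γ δ := by
  simp only [momentumVec, Matrix.vecMul, dotProduct, Matrix.mul_apply, Matrix.transpose_apply,
    Finset.sum_mul]
  refine Finset.sum_congr rfl fun α _ => ?_
  congr 1
  rw [Finset.sum_comm]
  exact Finset.sum_congr rfl fun γ _ => Finset.sum_congr rfl fun δ _ => by ring

end MatrixAlgebra

/-! ### The coordinate frame of a chart relative to the preferred frame. -/

section FrameChange

variable {n : ℕ} {M : Type*} [TopologicalSpace M] [ChartedSpace (EuclideanSpace ℝ (Fin n)) M]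

lemma sum_coordOf (v : Coord n) : v = ∑ α, coordOf v α • coordVec n α := by
  rw [Fin.sum_univ_succ]
  have h : ∑ i : Fin n, v.1 i • (EuclideanSpace.single i (1 : ℝ)) = v.1 := by
    ext j
    simp [Finset.sum_apply, Pi.single_apply]
  refine Prod.ext ?_ ?_
  · simp [coordOf, coordVec, h, Prod.fst_sum]
  · simp [coordOf, coordVec, Prod.snd_sum]

/-- Pointwise bilinear tensor fields. -/
def IsBilin (B : TwoTensor n M) : Prop :=
  ∀ p, ∃ L : Coord n →ₗ[ℝ] Coord n →ₗ[ℝ] ℝ, ∀ v w : Coord n, B p v w = L v w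

/-- The components of `B` in the preferred frame at `p`. -/
def frameMat (B : TwoTensor n M) (p : M × ℝ) : Matrix (Fin (n + 1)) (Fin (n + 1)) ℝ :=
  Matrix.of fun α β => B p (frame p α) (frame p β)

/-- The matrix of the coordinate frame of `e` in the preferred frame. -/
def frameChange (e : OpenPartialHomeomorph M (EuclideanSpace ℝ (Fin n))) (y : Coord n) :
    Matrix (Fin (n + 1)) (Fin (n + 1)) ℝ :=
  Matrix.of fun α β => coordOf (n := n) (chartFrame e y β) α

lemma comp_eq_conj {B : TwoTensor n M} (hB : IsBilin B)
    (e : OpenPartialHomeomorph M (EuclideanSpace ℝ (Fin n))) (y : Coord n) :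
    comp e B y = (frameChange e y)ᵀ * frameMat B (chartPoint e y) * frameChange e y := by
  obtain ⟨L, hL⟩ := hB (chartPoint e y)
  ext α β
  have e1 : comp e B y α β = L (∑ γ, frameChange e y γ α • coordVec n γ)
      (∑ δ, frameChange e y δ β • coordVec n δ) := by
    have h : ∀ α, ∑ γ, frameChange e y γ α • coordVec n γ = (chartFrame e y α : Coord n) :=
      fun α => (sum_coordOf _).symm
    rw [h, h]; exact hL _ _
  have e2 : ∀ γ δ, frameMat B (chartPoint e y) γ δ = L (coordVec n γ) (coordVec n δ) :=
    fun γ δ => hL _ _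
  rw [e1]
  simp only [map_sum, LinearMap.sum_apply, map_smul, LinearMap.smul_apply, smul_eq_mul,
    Matrix.mul_apply, Matrix.transpose_apply, e2, Finset.sum_mul]
  refine Finset.sum_congr rfl fun γ _ => ?_
  rw [Finset.mul_sum]
  exact Finset.sum_congr rfl fun δ _ => by ring

variable [IsManifold (𝓡 n) ∞ M] {e : OpenPartialHomeomorph M (EuclideanSpace ℝ (Fin n))}

lemma SymTensorField.isBilin (S : SymTensorField n M) : IsBilin S.tensor := fun p =>
  ⟨LinearMap.mk₂ ℝ (fun v w : Coord n => S.val p v w)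
    (fun v v' w => DFunLike.congr_fun (map_add (S.val p) v v') w)
    (fun c v w => DFunLike.congr_fun (map_smul (S.val p) c v) w)
    (fun v w w' => map_add (S.val p v) w w') (fun c v w => map_smul (S.val p v) c w),
   fun _ _ => rfl⟩

section FrameMatrix

variable (he : e ∈ atlas (EuclideanSpace ℝ (Fin n)) M) {y : Coord n} (hy : y.1 ∈ e.target)
include he hy

lemma frameChange_zero_zero : frameChange e y 0 0 = 1 :=
  congrArg (fun v => coordOf v 0) (chartFrame_zero he hy)

lemma frameChange_zero_succ (i : Fin n) : frameChange e y 0 i.succ = 0 :=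
  congrArg (fun v => coordOf v 0) (chartFrame_succ he hy i)

lemma frameChange_mulVec (v : Fin (n + 1) → ℝ) :
    ∑ α, (frameChange e y *ᵥ v) α • coordVec n α
      = (chartDeriv e y.1 (∑ α, v α • coordVec n α).1, (∑ α, v α • coordVec n α).2) := by
  refine Eq.trans ?_ (mfderiv_chartPoint he hy _)
  have e1 : (mfderiv 𝓘(ℝ, Coord n) (STModel n) (chartPoint e) y (∑ α, v α • coordVec n α) : Coord n)
      = ∑ β, v β • (chartFrame e y β : Coord n) :=
    (map_sum (mfderiv 𝓘(ℝ, Coord n) (STModel n) (chartPoint e) y) _ _).trans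
      (Finset.sum_congr rfl fun β _ => map_smul (mfderiv 𝓘(ℝ, Coord n) (STModel n) (chartPoint e) y)
        (v β) (coordVec n β))
  refine Eq.trans ?_ e1.symm
  have e2 : ∀ β, (chartFrame e y β : Coord n) = ∑ α, frameChange e y α β • coordVec n α :=
    fun β => sum_coordOf _
  simp only [Matrix.mulVec, dotProduct, Finset.sum_smul]
  rw [Finset.sum_comm]
  refine Finset.sum_congr rfl fun β _ => ?_
  refine Eq.trans ?_ (congrArg (v β • ·) (e2 β)).symm
  change _ = v β • ∑ α, frameChange e y α β • coordVec n α
  rw [Finset.smul_sum]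
  exact Finset.sum_congr rfl fun _ _ => by rw [smul_smul, mul_comm]

end FrameMatrix

lemma coordVec_sum_eq_zero {v : Fin (n + 1) → ℝ} (h : ∑ α, v α • coordVec n α = 0) : v = 0 := by
  have e : ∀ β, coordOf (∑ α, v α • coordVec n α) β = v β := by
    intro β
    refine Fin.cases ?_ (fun j => ?_) β
    · simp [coordOf, coordVec, Prod.snd_sum, Fin.sum_univ_succ]
    · simp [coordOf, coordVec, Prod.fst_sum, Fin.sum_univ_succ, Pi.single_apply]
  ext β
  rw [← e β, h]
  refine Fin.cases ?_ (fun j => ?_) β <;> simp [coordOf]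

/-- A kernel vector would have zero time component and a spatial part killed by the injective
differential of the inverse chart. -/
lemma isUnit_det_frameChange (he : e ∈ atlas (EuclideanSpace ℝ (Fin n)) M) {y : Coord n}
    (hy : y.1 ∈ e.target) : IsUnit (frameChange e y).det := by
  rw [isUnit_iff_ne_zero]
  intro h
  obtain ⟨v, hv, hv0⟩ := Matrix.exists_mulVec_eq_zero_iff.mpr h
  apply hv
  apply coordVec_sum_eq_zero
  have e1 := frameChange_mulVec he hy v
  rw [hv0] at e1
  simp only [Pi.zero_apply, zero_smul, Finset.sum_const_zero] at e1
  have e2 := congrArg Prod.fst e1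
  have e3 := congrArg Prod.snd e1
  refine Prod.ext (chartDeriv_injective he hy ?_) e3.symm
  exact e2.symm.trans (map_zero (chartDeriv e y.1)).symm

end FrameChange

/-! ### The metric, the lapse and the energy density in a chart -/

section MetricInChart

variable {n : ℕ} {M : Type*} [TopologicalSpace M] [ChartedSpace (EuclideanSpace ℝ (Fin n)) M]
  [IsManifold (𝓡 n) ∞ M] {e : OpenPartialHomeomorph M (EuclideanSpace ℝ (Fin n))}
  (g : LorentzMetric n M)

/-- A copy of the metric at `p` on the fixed space `Coord n`, so that linear algebra need not
mention tangent spaces. -/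
lemma LorentzMetric.exists_bilin (p : M × ℝ) : ∃ L : Coord n →ₗ[ℝ] Coord n →ₗ[ℝ] ℝ,
    (∀ v w : Coord n, g.tensor p v w = L v w) ∧ (∀ v w, L v w = L w v) ∧
    ∃ v, 0 < L v v ∧ ∀ w, L v w = 0 → w ≠ 0 → L w w < 0 := by
  obtain ⟨L, hL⟩ := g.toSymTensorField.isBilin p
  refine ⟨L, hL, fun v w => ?_, ?_⟩
  · rw [← hL, ← hL]; exact g.symm p v w
  · obtain ⟨v, hv, hw⟩ := g.lorentzian p
    exact ⟨v, (hL v v) ▸ hv, fun w h1 h2 => (hL w w) ▸ hw w ((hL v w).trans h1) h2⟩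

lemma frameMat_apply_bilin {B : TwoTensor n M} {p : M × ℝ} {L : Coord n →ₗ[ℝ] Coord n →ₗ[ℝ] ℝ}
    (hL : ∀ v w : Coord n, B p v w = L v w) (α β : Fin (n + 1)) :
    frameMat B p α β = L (coordVec n α) (coordVec n β) := hL _ _

lemma bilin_sum_right (L : Coord n →ₗ[ℝ] Coord n →ₗ[ℝ] ℝ) (v : Coord n) (c : Fin (n + 1) → ℝ) :
    L v (∑ β, c β • coordVec n β) = ∑ β, c β * L v (coordVec n β) := by
  simp only [map_sum, map_smul, smul_eq_mul]

/-- A nonzero vector in the radical is orthogonal to the timelike vector `v`, hence has negative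
square; but its square is zero. -/
lemma det_frameMat_ne_zero (p : M × ℝ) : (frameMat g.tensor p).det ≠ 0 := by
  obtain ⟨L, hL, hsymm, v, hv, hw⟩ := g.exists_bilin p
  intro h
  obtain ⟨c, hc, hc0⟩ := Matrix.exists_mulVec_eq_zero_iff.mpr h
  set u : Coord n := ∑ β, c β • coordVec n β with hu
  have hu0 : u ≠ 0 := fun h => hc (coordVec_sum_eq_zero h)
  have h1 : ∀ α, L (coordVec n α) u = 0 := by
    intro α
    rw [hu, bilin_sum_right]
    refine Eq.trans ?_ (congrFun hc0 α)
    exact Finset.sum_congr rfl fun β _ => (mul_comm _ _).trans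
      (congrArg (· * c β) (frameMat_apply_bilin hL α β).symm)
  have h2 : ∀ x, L x u = 0 := by
    intro x
    rw [hsymm, sum_coordOf x, bilin_sum_right]
    exact Finset.sum_eq_zero fun α _ => by rw [hsymm, h1, mul_zero]
  have := hw u (h2 v) hu0
  rw [h2 u] at this
  exact lt_irrefl _ this

lemma invMetric_eq (p : M × ℝ) : invMetric g p = (frameMat g.tensor p)⁻¹ := rfl

lemma frameMat_mul_invMetric (p : M × ℝ) : frameMat g.tensor p * invMetric g p = 1 :=
  Matrix.mul_nonsing_inv _ (det_frameMat_ne_zero g p).isUnit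

lemma isMetricOn_comp (he : e ∈ atlas (EuclideanSpace ℝ (Fin n)) M) :
    IsMetricOn (comp e g.tensor) (e.target ×ˢ Set.univ) where
  isOpen := e.open_target.prod isOpen_univ
  smooth := contDiffOn_comp g.toSymTensorField he
  symm y _ := by ext α β; exact g.symm _ _ _
  det_ne_zero y hy := by
    rw [comp_eq_conj g.toSymTensorField.isBilin, Matrix.det_mul, Matrix.det_mul,
      Matrix.det_transpose]
    have := (isUnit_det_frameChange he hy.1).ne_zero
    exact mul_ne_zero (mul_ne_zero this (det_frameMat_ne_zero g _)) this

lemma comp_inv_zero_zero (he : e ∈ atlas (EuclideanSpace ℝ (Fin n)) M) {y : Coord n}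
    (hy : y.1 ∈ e.target) :
    (comp e g.tensor y)⁻¹ 0 0 = invMetric g (chartPoint e y) 0 0 := by
  rw [comp_eq_conj g.toSymTensorField.isBilin, invMetric_eq]
  exact inv_zero_zero_conj (isUnit_det_frameChange he hy) (frameChange_zero_zero he hy)
    (frameChange_zero_succ he hy)

variable {g}

lemma SpacelikeSlices.bilin_neg (hs : SpacelikeSlices g) {p : M × ℝ}
    {L : Coord n →ₗ[ℝ] Coord n →ₗ[ℝ] ℝ} (hL : ∀ v w : Coord n, g.tensor p v w = L v w)
    {u : Coord n} (hu : u.2 = 0) (h0 : u ≠ 0) : L u u < 0 := by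
  obtain ⟨u1, u2⟩ := u
  obtain rfl : u2 = 0 := hu
  rw [← hL]
  exact hs p u1 fun h => h0 (by rw [h]; rfl)

/-- The gradient of the time is timelike. -/
lemma SpacelikeSlices.invMetric_pos (hs : SpacelikeSlices g) (p : M × ℝ) :
    0 < invMetric g p 0 0 := by
  obtain ⟨L, hL, hsymm, v, hv, -⟩ := g.exists_bilin p
  -- The gradient of the time: it pairs with every `x` to `dt(x)`, so its square is its own time
  -- component `g^{00}`.
  set w : Coord n := ∑ β, invMetric g p β 0 • coordVec n β with hw
  have hw2 : w.2 = invMetric g p 0 0 := by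
    simp [hw, Prod.snd_sum, Fin.sum_univ_succ, coordVec]
  have h1 : ∀ α, L (coordVec n α) w = (1 : Matrix (Fin (n + 1)) (Fin (n + 1)) ℝ) α 0 := by
    intro α
    rw [hw, bilin_sum_right, ← frameMat_mul_invMetric g p, Matrix.mul_apply]
    exact Finset.sum_congr rfl fun β _ => by rw [frameMat_apply_bilin hL, mul_comm]
  have h2 : ∀ x : Coord n, L x w = x.2 := by
    intro x
    conv_lhs => rw [hsymm, sum_coordOf x, bilin_sum_right]
    rw [Fin.sum_univ_succ, Finset.sum_eq_zero]
    · rw [hsymm, h1]; simp [coordOf]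
    · intro i _; rw [hsymm, h1]; simp
  by_cases h0 : w.2 = 0
  · exfalso
    by_cases hw0 : w = 0
    · have := h2 (0, 1)
      rw [hw0, map_zero] at this
      exact zero_ne_one this
    · have := hs.bilin_neg hL h0 hw0
      rw [h2 w, h0] at this
      exact lt_irrefl _ this
  · rw [← hw2]
    -- This value of `c` makes `s = v - c w` tangent to the slice, hence orthogonal to `w`. As `s`
    -- has nonpositive and `v` positive square, `c² g^{00}` must be positive.
    set c := v.2 / w.2
    set s : Coord n := v - c • w with hsd
    have hs2 : s.2 = 0 := by simp [hsd, c, h0]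
    have h3 : L s s ≤ 0 := by
      by_cases hs0 : s = 0
      · simp [hs0]
      · exact (hs.bilin_neg hL hs2 hs0).le
    have h4 : L v v = L s s + c ^ 2 * w.2 := by
      have hvs : v = s + c • w := by simp [hsd]
      rw [hvs]
      simp only [map_add, LinearMap.add_apply, map_smul, LinearMap.smul_apply, smul_eq_mul]
      rw [hsymm w s, h2 s, h2 w, hs2]
      ring
    have h5 : 0 < c ^ 2 * w.2 := by linarith
    exact pos_of_mul_pos_right h5 (sq_nonneg c)

variable (g) in
/-- The density of the volume of the slices in the chart `e`. -/
def chartDensity (e : OpenPartialHomeomorph M (EuclideanSpace ℝ (Fin n))) (y : Coord n) : ℝ :=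
  √(Matrix.det (Matrix.of fun i j : Fin n => -comp e g.tensor y i.succ j.succ))

/-- The matrix is the Gram matrix of `-g`, positive definite along the slice, on the spatial frame,
which is independent because the chart differential is injective. -/
lemma SpacelikeSlices.det_pos (hs : SpacelikeSlices g)
    (he : e ∈ atlas (EuclideanSpace ℝ (Fin n)) M) {y : Coord n} (hy : y.1 ∈ e.target) :
    0 < Matrix.det (Matrix.of fun i j : Fin n => -comp e g.tensor y i.succ j.succ) := by
  obtain ⟨L, hL, hsymm, -⟩ := g.exists_bilin (chartPoint e y)
  refine Matrix.PosDef.det_pos (Matrix.PosDef.of_dotProduct_mulVec_pos ?_ fun v hv => ?_)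
  · ext i j
    simp only [Matrix.conjTranspose_apply, Matrix.of_apply, star_trivial]
    exact congrArg Neg.neg (g.symm _ _ _)
  · obtain ⟨F, hF⟩ : ∃ F : Fin n → Coord n, ∀ i, F i = chartFrame e y i.succ :=
      ⟨_, fun _ => rfl⟩
    have hF' : ∀ i, F i = (chartDeriv e y.1 (EuclideanSpace.single i 1), 0) := fun i =>
      (hF i).trans (chartFrame_succ he hy i)
    set u : Coord n := ∑ i, v i • F i with hu
    have hu2 : u.2 = 0 := by simp [hu, Prod.snd_sum, hF']
    have hu1 : u.1 = chartDeriv e y.1 (∑ i, v i • EuclideanSpace.single i 1) := by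
      simp [hu, Prod.fst_sum, hF', map_sum, map_smul]
    have hu0 : u ≠ 0 := by
      intro h
      have h1 : chartDeriv e y.1 (∑ i, v i • EuclideanSpace.single i 1) = chartDeriv e y.1 0 := by
        rw [← hu1, h, map_zero]; rfl
      have h2 := chartDeriv_injective he hy h1
      apply hv
      ext j
      have := congrArg (fun x : EuclideanSpace ℝ (Fin n) => x j) h2
      simpa [Finset.sum_apply, Pi.single_apply] using this
    have key := hs.bilin_neg hL hu2 hu0
    have e1 : L u u = ∑ i, v i * ∑ j, v j * comp e g.tensor y i.succ j.succ := by
      have : ∀ i j : Fin n, comp e g.tensor y i.succ j.succ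
          = L (F i) (F j) := fun i j => by rw [hF, hF]; exact hL _ _
      simp only [this]
      have a1 : ∀ x, L (∑ i, v i • F i) x = ∑ i, v i * L (F i) x := fun x => by
        simp [map_sum, LinearMap.sum_apply]
      have a2 : ∀ x, L x (∑ i, v i • F i) = ∑ i, v i * L x (F i) := fun x => by
        simp [map_sum]
      rw [hu, a1]
      simp only [a2]
    rw [e1] at key
    simp only [dotProduct, Matrix.mulVec, Matrix.of_apply, Pi.star_apply, star_trivial]
    have e2 : ∑ i, v i * ∑ j, -comp e g.tensor y i.succ j.succ * v j
        = -∑ i, v i * ∑ j, v j * comp e g.tensor y i.succ j.succ := by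
      rw [← Finset.sum_neg_distrib]
      refine Finset.sum_congr rfl fun i _ => ?_
      rw [← mul_neg, ← Finset.sum_neg_distrib]
      congr 1
      exact Finset.sum_congr rfl fun j _ => by ring
    rw [e2]; linarith

lemma chartDensity_pos (hs : SpacelikeSlices g)
    (he : e ∈ atlas (EuclideanSpace ℝ (Fin n)) M) {y : Coord n} (hy : y.1 ∈ e.target) :
    0 < chartDensity g e y := Real.sqrt_pos.mpr (hs.det_pos he hy)

lemma contDiffOn_chartDensity (hs : SpacelikeSlices g)
    (he : e ∈ atlas (EuclideanSpace ℝ (Fin n)) M) :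
    ContDiffOn ℝ ∞ (chartDensity g e) (e.target ×ˢ Set.univ) :=
by
  have h : ContDiffOn ℝ ∞ (fun y => Matrix.det
      (Matrix.of fun i j : Fin n => -comp e g.tensor y i.succ j.succ)) (e.target ×ˢ Set.univ) :=
    contDiffOn_det fun i j => (contDiffOn_comp g.toSymTensorField he i.succ j.succ).neg
  exact h.sqrt fun y hy => (hs.det_pos he hy.1).ne'

/-- By Cramer's rule `g^{00}` is the spatial minor divided by the full determinant; negating the `n
× n` spatial block produces `(-1) ^ n`. -/
lemma det_comp_eq (hs : SpacelikeSlices g)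
    (he : e ∈ atlas (EuclideanSpace ℝ (Fin n)) M) {y : Coord n} (hy : y.1 ∈ e.target) :
    (-1) ^ n * (comp e g.tensor y).det
      = Matrix.det (Matrix.of fun i j : Fin n => -comp e g.tensor y i.succ j.succ)
        / invMetric g (chartPoint e y) 0 0 := by
  have hpos := hs.invMetric_pos (chartPoint e y)
  rw [eq_div_iff hpos.ne', ← comp_inv_zero_zero g he hy, Matrix.inv_def, Matrix.smul_apply,
    Matrix.adjugate_fin_succ_eq_det_submatrix, Ring.inverse_eq_inv', smul_eq_mul]
  have hne := (isMetricOn_comp g he).det_ne_zero y ⟨hy, trivial⟩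
  have : (Matrix.of fun i j : Fin n => -comp e g.tensor y i.succ j.succ)
      = -((comp e g.tensor y).submatrix (Fin.succAbove 0) (Fin.succAbove 0)) := by
    ext i j; simp
  rw [this, Matrix.det_neg, Fintype.card_fin]
  field_simp
  simp

lemma signed_det_pos (hs : SpacelikeSlices g)
    (he : e ∈ atlas (EuclideanSpace ℝ (Fin n)) M) {y : Coord n} (hy : y.1 ∈ e.target) :
    0 < (-1) ^ n * (comp e g.tensor y).det := by
  rw [det_comp_eq hs he hy]
  exact div_pos (hs.det_pos he hy) (hs.invMetric_pos _)

lemma lapse_mul_chartDensity (hs : SpacelikeSlices g)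
    (he : e ∈ atlas (EuclideanSpace ℝ (Fin n)) M) {y : Coord n} (hy : y.1 ∈ e.target) :
    lapse g (chartPoint e y) * chartDensity g e y = √((-1) ^ n * (comp e g.tensor y).det) := by
  rw [det_comp_eq hs he hy, Real.sqrt_div (hs.det_pos he hy).le, lapse, chartDensity]
  ring

/-- Lowering the gradient of the time gives back `dt`, so the normal covector is the lapse times
`dt`, and energy densities involve only the time component of `P`. -/
lemma lowerAt_unitNormal (p : M × ℝ) (α : Fin (n + 1)) :
    lowerAt g p (unitNormal g p) α
      = lapse g p * (1 : Matrix (Fin (n + 1)) (Fin (n + 1)) ℝ) α 0 := by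
  obtain ⟨L, hL, -⟩ := g.exists_bilin p
  have e1 : lowerAt g p (unitNormal g p) α
      = L (coordVec n α) ((1 / √(invMetric g p 0 0)) • ∑ β, invMetric g p β 0 • coordVec n β) :=
    hL _ _
  rw [e1, map_smul, smul_eq_mul, bilin_sum_right, ← frameMat_mul_invMetric g p, Matrix.mul_apply,
    lapse]
  congr 1
  exact Finset.sum_congr rfl fun β _ => by rw [frameMat_apply_bilin hL, mul_comm]

lemma energyDensity_eq (T : TwoTensor n M) (X : VField n M) (p : M × ℝ) :
    energyDensity g T X p = energyMomentum g T X p 0 * lapse g p := by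
  unfold energyDensity
  simp only [lowerAt_unitNormal]
  rw [Fin.sum_univ_succ, Finset.sum_eq_zero, Matrix.one_apply_eq, mul_one, add_zero]
  intro i _
  rw [Matrix.one_apply_ne (Fin.succ_ne_zero i), mul_zero, mul_zero]

variable (g) in
/-- The energy-momentum vector in the chart `e`. -/
def chartMomentum (e : OpenPartialHomeomorph M (EuclideanSpace ℝ (Fin n))) (T : TwoTensor n M)
    (X : VField n M) (β : Fin (n + 1)) (y : Coord n) : ℝ :=
  ∑ α, g.tensor (chartPoint e y) (chartFrame e y α) (X (chartPoint e y))
    * raiseComp (comp e g.tensor) (comp e T) y α β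

lemma frameChange_mulVec_chartMomentum {T : TwoTensor n M} (hT : IsBilin T) (X : VField n M)
    (he : e ∈ atlas (EuclideanSpace ℝ (Fin n)) M) {y : Coord n} (hy : y.1 ∈ e.target) :
    frameChange e y *ᵥ (fun β => chartMomentum g e T X β y)
      = energyMomentum g T X (chartPoint e y) := by
  obtain ⟨L, hL, hsymm, -⟩ := g.exists_bilin (chartPoint e y)
  have h1 : energyMomentum g T X (chartPoint e y) = momentumVec (frameMat g.tensor (chartPoint e y))
      (frameMat T (chartPoint e y)) (lowerAt g (chartPoint e y) (X (chartPoint e y))) := by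
    ext β
    rw [momentumVec_apply]
    rfl
  have h2 : (fun β => chartMomentum g e T X β y) = momentumVec (comp e g.tensor y) (comp e T y)
      ((frameChange e y)ᵀ *ᵥ lowerAt g (chartPoint e y) (X (chartPoint e y))) := by
    ext β
    rw [momentumVec_apply]
    refine Finset.sum_congr rfl fun α _ => ?_
    congr 1
    have h3 : g.tensor (chartPoint e y) (chartFrame e y α) (X (chartPoint e y))
        = L (X (chartPoint e y)) (∑ γ, frameChange e y γ α • coordVec n γ) := by
      refine (hL _ _).trans ((hsymm _ _).trans ?_)
      exact congrArg _ (sum_coordOf (chartFrame e y α : Coord n))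
    refine (h3.trans (bilin_sum_right L _ _)).trans ?_
    exact Finset.sum_congr rfl fun γ _ => congrArg _ ((hsymm _ _).trans (hL _ _).symm)
  rw [h1, h2, comp_eq_conj g.toSymTensorField.isBilin, comp_eq_conj hT]
  exact mulVec_momentumVec (isUnit_det_frameChange he hy) _

/-- The current `√|g| P^α` in the chart `e`. -/
def chartCurrent (g : LorentzMetric n M) (e : OpenPartialHomeomorph M (EuclideanSpace ℝ (Fin n)))
    (T : TwoTensor n M) (X : VField n M) (β : Fin (n + 1)) (y : Coord n) : ℝ :=
  √((-1) ^ n * (comp e g.tensor y).det) * chartMomentum g e T X β y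

/-- The time component of a vector is the same in the chart frame and the preferred frame, and the
lapse combines with the slice density into `√|g|`. -/
lemma energyDensity_mul_chartDensity (hs : SpacelikeSlices g) {T : TwoTensor n M} (hT : IsBilin T)
    (X : VField n M) (he : e ∈ atlas (EuclideanSpace ℝ (Fin n)) M) {y : Coord n}
    (hy : y.1 ∈ e.target) :
    energyDensity g T X (chartPoint e y) * chartDensity g e y = chartCurrent g e T X 0 y := by
  rw [energyDensity_eq, chartCurrent, ← lapse_mul_chartDensity hs he hy,
    ← frameChange_mulVec_chartMomentum hT X he hy]
  simp only [Matrix.mulVec, dotProduct]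
  rw [Fin.sum_univ_succ, Finset.sum_eq_zero, frameChange_zero_zero he hy]
  · ring
  · intro i _; rw [frameChange_zero_succ he hy, zero_mul]

/-- The pairing of `dψ` with `P` does not depend on the frame; the chain rule turns `dψ` on the
chart frame into partial derivatives of `ψ` in the chart. -/
lemma flux_mul_chartDensity (hs : SpacelikeSlices g) {T : TwoTensor n M} (hT : IsBilin T)
    (X : VField n M) (he : e ∈ atlas (EuclideanSpace ℝ (Fin n)) M) {y : Coord n}
    (hy : y.1 ∈ e.target) {ψ : M → ℝ} (hψ : ContMDiff (𝓡 n) 𝓘(ℝ, ℝ) ∞ ψ) :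
    (∑ α, energyMomentum g T X (chartPoint e y) α
        * dScalar (fun q : M × ℝ => ψ q.1) (chartPoint e y) (frame (chartPoint e y) α))
        * lapse g (chartPoint e y) * chartDensity g e y
      = ∑ α, chartCurrent g e T X α y * pd α (fun w : Coord n => ψ (e.symm w.1)) y := by
  set d : Coord n →L[ℝ] ℝ := mfderiv (STModel n) 𝓘(ℝ, ℝ) (fun q : M × ℝ => ψ q.1) (chartPoint e y)
    with hd
  have hmd : MDifferentiableAt (STModel n) 𝓘(ℝ, ℝ) (fun q : M × ℝ => ψ q.1) (chartPoint e y) :=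
    ((hψ.comp contMDiff_fst).contMDiffAt).mdifferentiableAt (by simp)
  have h1 : ∀ α, pd α (fun w : Coord n => ψ (e.symm w.1)) y = d (chartFrame e y α) := by
    intro α
    have h2 := (hmd.hasMFDerivAt.comp y
      ((contMDiffAt_chartPoint he hy).mdifferentiableAt (by simp)).hasMFDerivAt).mfderiv
    rw [mfderiv_eq_fderiv] at h2
    exact DFunLike.congr_fun h2 (coordVec n α)
  have h3 : ∀ α, d (chartFrame e y α) = ∑ γ, frameChange e y γ α * d (coordVec n γ) := by
    intro α
    refine (congrArg d (sum_coordOf (chartFrame e y α : Coord n))).trans ?_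
    simp only [map_sum, map_smul, smul_eq_mul]
    rfl
  have h4 : ∑ α, energyMomentum g T X (chartPoint e y) α
        * dScalar (fun q : M × ℝ => ψ q.1) (chartPoint e y) (frame (chartPoint e y) α)
      = ∑ α, chartMomentum g e T X α y * d (chartFrame e y α) := by
    rw [← frameChange_mulVec_chartMomentum hT X he hy]
    simp only [h3, Matrix.mulVec, dotProduct, Finset.sum_mul, Finset.mul_sum]
    rw [Finset.sum_comm]
    refine Finset.sum_congr rfl fun α _ => Finset.sum_congr rfl fun γ _ => ?_
    rw [mul_comm (frameChange e y γ α), mul_assoc]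
    rfl
  simp only [h1]
  rw [h4, mul_assoc, lapse_mul_chartDensity hs he hy, Finset.sum_mul]
  exact Finset.sum_congr rfl fun α _ => by rw [chartCurrent]; ring

end MetricInChart

/-! ### The volume of the slices -/

section SliceVolume

variable {n : ℕ} {M : Type*} [TopologicalSpace M] [ChartedSpace (EuclideanSpace ℝ (Fin n)) M]
  [IsManifold (𝓡 n) ∞ M] {e e' : OpenPartialHomeomorph M (EuclideanSpace ℝ (Fin n))}
  {g : LorentzMetric n M}

lemma chartDeriv_transition (he : e ∈ atlas (EuclideanSpace ℝ (Fin n)) M)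
    (he' : e' ∈ atlas (EuclideanSpace ℝ (Fin n)) M) {x : EuclideanSpace ℝ (Fin n)}
    (hx : x ∈ e.target) (hx' : e.symm x ∈ e'.source) :
    ∃ J : EuclideanSpace ℝ (Fin n) →L[ℝ] EuclideanSpace ℝ (Fin n),
      HasFDerivAt (e' ∘ e.symm) J x ∧
      ∀ v, chartDeriv e x v = chartDeriv e' (e' (e.symm x)) (J v) := by
  have h1 : HasMFDerivAt (𝓡 n) (𝓡 n) e.symm x (chartDeriv e x) :=
    ((contMDiffAt_chart_symm he hx).mdifferentiableAt (by simp)).hasMFDerivAt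
  have h2 : HasMFDerivAt (𝓡 n) (𝓡 n) e' (e.symm x) (mfderiv (𝓡 n) (𝓡 n) e' (e.symm x)) :=
    ((contMDiffAt_chart he' hx').mdifferentiableAt (by simp)).hasMFDerivAt
  have h3 := HasMFDerivAt.comp x h2 h1
  have h4 : HasMFDerivAt (𝓡 n) (𝓡 n) e'.symm ((e' ∘ e.symm) x) (chartDeriv e' (e' (e.symm x))) :=
    ((contMDiffAt_chart_symm he' (e'.map_source hx')).mdifferentiableAt (by simp)).hasMFDerivAt
  have h5 := HasMFDerivAt.comp x h4 h3
  have hev : e'.symm ∘ (e' ∘ e.symm) =ᶠ[𝓝 x] e.symm := by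
    have hc : ContinuousAt e.symm x := e.symm.continuousAt hx
    filter_upwards [hc.preimage_mem_nhds (e'.open_source.mem_nhds hx')] with z hz
    exact e'.left_inv hz
  have h6 := h5.mfderiv
  rw [hev.mfderiv_eq] at h6
  exact ⟨_, h3.hasFDerivAt, fun v => DFunLike.congr_fun h6 v⟩

/-- The spatial Gram matrices are related by `S = Jᵀ S' J`, so the roots of their determinants
differ by `|det J|`, the factor in the change of variables formula. -/
lemma chartDensity_transition (he : e ∈ atlas (EuclideanSpace ℝ (Fin n)) M)
    (he' : e' ∈ atlas (EuclideanSpace ℝ (Fin n)) M) {x : EuclideanSpace ℝ (Fin n)}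
    (hx : x ∈ e.target) (hx' : e.symm x ∈ e'.source)
    {J : EuclideanSpace ℝ (Fin n) →L[ℝ] EuclideanSpace ℝ (Fin n)}
    (hJ : ∀ v, chartDeriv e x v = chartDeriv e' (e' (e.symm x)) (J v)) (t : ℝ) :
    chartDensity g e (x, t) = |J.det| * chartDensity g e' (e' (e.symm x), t) := by
  set x' := e' (e.symm x) with hx'def
  have hxt' : x' ∈ e'.target := e'.map_source hx'
  have hp : chartPoint e' (x', t) = chartPoint e (x, t) := by
    simp [chartPoint, hx'def, e'.left_inv hx']
  obtain ⟨L, hL⟩ := g.toSymTensorField.isBilin (chartPoint e (x, t))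
  set S := Matrix.of fun i j : Fin n => -comp e g.tensor (x, t) i.succ j.succ with hS
  set S' := Matrix.of fun i j : Fin n => -comp e' g.tensor (x', t) i.succ j.succ with hS'
  set D' := chartDeriv e' x'
  have e1 : ∀ i j : Fin n, comp e g.tensor (x, t) i.succ j.succ
      = L (D' (J (EuclideanSpace.single i 1)), 0) (D' (J (EuclideanSpace.single j 1)), 0) := by
    intro i j
    rw [← hJ, ← hJ]
    exact (hL _ _).trans (congrArg₂ (fun v w => L v w) (chartFrame_succ he (y := (x, t)) hx i)
      (chartFrame_succ he (y := (x, t)) hx j))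
  have e2 : ∀ i j : Fin n, comp e' g.tensor (x', t) i.succ j.succ
      = L (D' (EuclideanSpace.single i 1), 0) (D' (EuclideanSpace.single j 1), 0) := by
    intro i j
    have key : ∀ (q : M × ℝ) (v w : Coord n), q = chartPoint e (x, t) →
        g.tensor q v w = L v w := by
      rintro q v w rfl; exact hL v w
    exact (key _ _ _ hp).trans
      (congrArg₂ (fun v w => L v w) (chartFrame_succ he' (y := (x', t)) hxt' i)
      (chartFrame_succ he' (y := (x', t)) hxt' j))
  set Jm : Matrix (Fin n) (Fin n) ℝ := Matrix.of fun i j => J (EuclideanSpace.single j 1) i with hJm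
  have e3 : ∀ j, J (EuclideanSpace.single j 1)
      = ∑ k, Jm k j • (EuclideanSpace.single k (1 : ℝ)) := by
    intro j
    ext l
    simp [hJm, Finset.sum_apply, Pi.single_apply]
  have e4 : ∀ j, ((D' (J (EuclideanSpace.single j 1)), 0) : Coord n)
      = ∑ k, Jm k j • ((D' (EuclideanSpace.single k (1 : ℝ)), 0) : Coord n) := by
    intro j
    rw [e3]
    refine Prod.ext ?_ ?_
    · simp [Prod.fst_sum, map_sum]
    · simp [Prod.snd_sum]
  have e5 : S = Jmᵀ * S' * Jm := by
    ext i j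
    rw [hS, Matrix.of_apply, e1, e4, e4]
    simp only [Matrix.mul_apply, Matrix.transpose_apply, hS', Matrix.of_apply, e2, map_sum,
      LinearMap.sum_apply, map_smul, LinearMap.smul_apply, smul_eq_mul, Finset.sum_mul]
    rw [← Finset.sum_neg_distrib]
    refine Finset.sum_congr rfl fun k _ => ?_
    rw [Finset.mul_sum, ← Finset.sum_neg_distrib]
    exact Finset.sum_congr rfl fun l _ => by ring
  have e6 : J.det = Jm.det := by
    rw [ContinuousLinearMap.det,
      ← LinearMap.det_toMatrix (EuclideanSpace.basisFun (Fin n) ℝ).toBasis]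
    congr 1
  change √S.det = |J.det| * √S'.det
  rw [e5, Matrix.det_mul, Matrix.det_mul, Matrix.det_transpose, e6,
    show Jm.det * S'.det * Jm.det = Jm.det ^ 2 * S'.det by ring,
    Real.sqrt_mul (sq_nonneg _), Real.sqrt_sq_eq_abs]

/-- A function is continuous if it is continuous in every chart. -/
lemma continuous_of_charts {f : M → ℝ} (h : ∀ e ∈ atlas (EuclideanSpace ℝ (Fin n)) M,
    ContinuousOn (fun x => f (e.symm x)) e.target) : Continuous f := by
  rw [continuous_iff_continuousAt]
  intro x
  set e := chartAt (EuclideanSpace ℝ (Fin n)) x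
  have h1 := (h e (chart_mem_atlas _ x)).continuousAt
    (e.open_target.mem_nhds (mem_chart_target _ x))
  have h2 : ContinuousAt (fun z => f (e.symm (e z))) x :=
    ContinuousAt.comp (f := e) (g := fun y => f (e.symm y)) h1
      (e.continuousAt (mem_chart_source _ x))
  refine h2.congr ?_
  filter_upwards [e.open_source.mem_nhds (mem_chart_source _ x)] with z hz
  rw [e.left_inv hz]

variable [MeasurableSpace M] [BorelSpace M]

lemma measurableSet_chart_preimage (e : OpenPartialHomeomorph M (EuclideanSpace ℝ (Fin n)))
    {A : Set M} (hA : MeasurableSet A) : MeasurableSet (e.symm ⁻¹' A ∩ e.target) := by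
  have h1 : Measurable (e.target.domRestrict e.symm) :=
    (continuousOn_iff_continuous_domRestrict.mp e.continuousOn_symm).measurable
  have h2 := e.open_target.measurableSet.subtype_image (h1 hA)
  convert h2 using 1
  ext x
  constructor
  · rintro ⟨h, hx⟩; exact ⟨⟨x, hx⟩, h, rfl⟩
  · rintro ⟨⟨z, hz⟩, h, rfl⟩; exact ⟨h, hz⟩

lemma chartVolume_eq (g : LorentzMetric n M) (t : ℝ)
    (e : OpenPartialHomeomorph M (EuclideanSpace ℝ (Fin n))) :
    chartVolume g t e = (((volume : Measure (EuclideanSpace ℝ (Fin n))).restrict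
      e.target).withDensity (fun x => ENNReal.ofReal (chartDensity g e (x, t)))).map e.symm := rfl

lemma aemeasurable_chart_symm (e : OpenPartialHomeomorph M (EuclideanSpace ℝ (Fin n)))
    (ρ : EuclideanSpace ℝ (Fin n) → ENNReal) :
    AEMeasurable e.symm (((volume : Measure (EuclideanSpace ℝ (Fin n))).restrict
      e.target).withDensity ρ) :=
  (e.continuousOn_symm.aemeasurable e.open_target.measurableSet).mono_ac
    (withDensity_absolutelyContinuous _ _)

lemma chartVolume_apply (t : ℝ) (e : OpenPartialHomeomorph M (EuclideanSpace ℝ (Fin n)))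
    {A : Set M} (hA : MeasurableSet A) :
    chartVolume g t e A
      = ∫⁻ x in e.symm ⁻¹' A ∩ e.target, ENNReal.ofReal (chartDensity g e (x, t)) := by
  rw [chartVolume_eq, Measure.map_apply_of_aemeasurable (aemeasurable_chart_symm _ _) hA,
    withDensity_apply', Measure.restrict_restrict' e.open_target.measurableSet]

lemma chartVolume_inter_source (t : ℝ) (e : OpenPartialHomeomorph M (EuclideanSpace ℝ (Fin n)))
    {A : Set M} (hA : MeasurableSet A) :
    chartVolume g t e (A ∩ e.source) = chartVolume g t e A := by
  rw [chartVolume_apply t e hA, chartVolume_apply t e (hA.inter e.open_source.measurableSet)]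
  congr 2
  ext x
  constructor
  · rintro ⟨⟨h, -⟩, hx⟩; exact ⟨h, hx⟩
  · rintro ⟨h, hx⟩; exact ⟨⟨h, e.map_target hx⟩, hx⟩

/-- The volumes in two charts agree on the overlap. -/
lemma chartVolume_overlap (he : e ∈ atlas (EuclideanSpace ℝ (Fin n)) M)
    (he' : e' ∈ atlas (EuclideanSpace ℝ (Fin n)) M) (t : ℝ) {A : Set M} (hA : MeasurableSet A)
    (h1 : A ⊆ e.source) (h2 : A ⊆ e'.source) : chartVolume g t e A = chartVolume g t e' A := by
  rw [chartVolume_apply t e hA, chartVolume_apply t e' hA]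
  set B := e.symm ⁻¹' A ∩ e.target with hB
  have hBm : MeasurableSet B := measurableSet_chart_preimage e hA
  have himg : (e' ∘ e.symm) '' B = e'.symm ⁻¹' A ∩ e'.target := by
    ext z
    constructor
    · rintro ⟨x, ⟨hx, hxt⟩, rfl⟩
      have hs : e.symm x ∈ e'.source := h2 hx
      refine ⟨?_, e'.map_source hs⟩
      simp only [Set.mem_preimage, Function.comp_apply, e'.left_inv hs]
      exact hx
    · rintro ⟨hz, hzt⟩
      have hs : e'.symm z ∈ e.source := h1 hz
      refine ⟨e (e'.symm z), ⟨?_, e.map_source hs⟩, ?_⟩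
      · simp only [Set.mem_preimage, e.left_inv hs]; exact hz
      · simp only [Function.comp_apply, e.left_inv hs, e'.right_inv hzt]
  have hinj : Set.InjOn (e' ∘ e.symm) B := by
    rintro x ⟨hx, hxt⟩ z ⟨hz, hzt⟩ hxz
    have := e'.injOn (h2 hx) (h2 hz) hxz
    exact e.symm.injOn hxt hzt this
  choose! J hJ hJ' using fun (x : EuclideanSpace ℝ (Fin n)) (hx : x ∈ B) =>
    chartDeriv_transition he he' hx.2 (h2 hx.1)
  rw [← himg, lintegral_image_eq_lintegral_abs_det_fderiv_mul volume hBm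
    (fun x hx => (hJ x hx).hasFDerivWithinAt) hinj]
  refine setLIntegral_congr_fun hBm fun x hx => ?_
  simp only [Function.comp_apply]
  rw [chartDensity_transition he he' hx.2 (h2 hx.1) (hJ' x hx) t, ENNReal.ofReal_mul (abs_nonneg _)]

lemma chartVolume_le_sliceVolume (he : e ∈ atlas (EuclideanSpace ℝ (Fin n)) M) (t : ℝ) :
    chartVolume g t e ≤ sliceVolume g t := le_iSup₂_of_le e he le_rfl

lemma sliceVolume_restrict (he : e ∈ atlas (EuclideanSpace ℝ (Fin n)) M) (t : ℝ) :
    (sliceVolume g t).restrict e.source = chartVolume g t e := by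
  have hsm := e.open_source.measurableSet
  -- To bound a supremum of measures it suffices to bound each chart measure: inside the domain of
  -- `e` the overlap formula compares it with `e`, outside it is at most the supremum.
  have hle : sliceVolume g t ≤ chartVolume g t e + (sliceVolume g t).restrict e.sourceᶜ := by
    refine iSup₂_le fun e' he' => ?_
    rw [Measure.le_iff]
    intro A hA
    rw [Measure.add_apply, Measure.restrict_apply hA, ← measure_inter_add_sdiff A hsm]
    refine add_le_add ?_ ?_
    · rw [← chartVolume_inter_source t e' (hA.inter hsm),
        ← chartVolume_overlap he he' t ((hA.inter hsm).inter e'.open_source.measurableSet)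
          (fun x hx => hx.1.2) (fun x hx => hx.2)]
      exact measure_mono fun x hx => hx.1.1
    · exact chartVolume_le_sliceVolume he' t _
  refine le_antisymm (Measure.le_iff.mpr fun A hA => ?_) (Measure.le_iff.mpr fun A hA => ?_)
  · rw [Measure.restrict_apply hA]
    refine (hle _).trans ?_
    rw [Measure.add_apply, Measure.restrict_apply (hA.inter hsm)]
    have : A ∩ e.source ∩ e.sourceᶜ = ∅ := by
      ext x; simp only [Set.mem_inter_iff, Set.mem_compl_iff, Set.mem_empty_iff_false]; tauto
    rw [this, measure_empty, add_zero]
    exact measure_mono Set.inter_subset_left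
  · rw [Measure.restrict_apply hA, ← chartVolume_inter_source t e hA]
    exact chartVolume_le_sliceVolume he t _

lemma continuousOn_chartDensity (hs : SpacelikeSlices g)
    (he : e ∈ atlas (EuclideanSpace ℝ (Fin n)) M) (t : ℝ) :
    ContinuousOn (fun x => chartDensity g e (x, t)) e.target :=
  (contDiffOn_chartDensity hs he).continuousOn.comp
    (continuous_id.prodMk continuous_const).continuousOn
    fun _ hx => ⟨hx, trivial⟩

/-- The integral over a slice of a function that vanishes off the domain of a chart. -/
lemma integral_sliceVolume (hs : SpacelikeSlices g)
    (he : e ∈ atlas (EuclideanSpace ℝ (Fin n)) M) (t : ℝ) {f : M → ℝ} (hf : Continuous f)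
    (h0 : ∀ x, x ∉ e.source → f x = 0) :
    ∫ x, f x ∂(sliceVolume g t)
      = ∫ x in e.target, f (e.symm x) * chartDensity g e (x, t) := by
  rw [← setIntegral_eq_integral_of_forall_compl_eq_zero (s := e.source) h0,
    sliceVolume_restrict he, chartVolume_eq,
    integral_map (aemeasurable_chart_symm _ _) hf.aestronglyMeasurable,
    integral_withDensity_eq_integral_toReal_smul₀]
  · refine setIntegral_congr_fun e.open_target.measurableSet fun x hx => ?_
    simp only [smul_eq_mul]
    rw [ENNReal.toReal_ofReal (chartDensity_pos hs he (y := (x, t)) hx).le, mul_comm]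
  · exact ((continuousOn_chartDensity hs he t).aemeasurable
      e.open_target.measurableSet).ennreal_ofReal
  · exact ae_of_all _ fun _ => ENNReal.ofReal_lt_top

/-- Makes continuous functions with compact support integrable on the slices. Near a point the
measure is a continuous density over a subset of a compact set in the chart. -/
lemma isLocallyFiniteMeasure_sliceVolume (hs : SpacelikeSlices g) (t : ℝ) :
    IsLocallyFiniteMeasure (sliceVolume g t) := by
  refine ⟨fun x => ?_⟩
  set e := chartAt (EuclideanSpace ℝ (Fin n)) x with hedef
  have he : e ∈ atlas (EuclideanSpace ℝ (Fin n)) M := chart_mem_atlas _ x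
  obtain ⟨K, hK, hxK, hKt⟩ := exists_compact_subset e.open_target (mem_chart_target _ x)
  set N : Set M := e.source ∩ e ⁻¹' interior K with hN
  have hNo : IsOpen N := e.isOpen_inter_preimage isOpen_interior
  refine ⟨N, hNo.mem_nhds ⟨mem_chart_source _ x, hxK⟩, ?_⟩
  rw [← Measure.restrict_eq_self (s := N) (t := e.source) (sliceVolume g t) Set.inter_subset_left,
    sliceVolume_restrict he, chartVolume_apply t e hNo.measurableSet]
  have hsub : e.symm ⁻¹' N ∩ e.target ⊆ K := by
    rintro z ⟨⟨-, hz⟩, hzt⟩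
    simp only [Set.mem_preimage, e.right_inv hzt] at hz
    exact interior_subset hz
  refine (lintegral_mono_set hsub).trans_lt ?_
  exact (((continuousOn_chartDensity hs he t).mono hKt).integrableOn_compact hK).lintegral_lt_top

end SliceVolume

/-! ### The balance law on the spacetime -/

section GlobalBalance

variable {n : ℕ} {M : Type*} [TopologicalSpace M] [ChartedSpace (EuclideanSpace ℝ (Fin n)) M]
  [IsManifold (𝓡 n) ∞ M] {e : OpenPartialHomeomorph M (EuclideanSpace ℝ (Fin n))}
  {g : LorentzMetric n M} {T : TwoTensor n M} {X : VField n M}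

/-- Bilinear tensor fields whose components in the charts are smooth. -/
structure IsSmoothTensor (T : TwoTensor n M) : Prop where
  bilin : IsBilin T
  smooth : ∀ e ∈ atlas (EuclideanSpace ℝ (Fin n)) M, ∀ α β,
    ContDiffOn ℝ ∞ (fun z => comp e T z α β) (e.target ×ˢ Set.univ)

/-- The energy-momentum current has no divergence in the charts. -/
def CurrentConserved (g : LorentzMetric n M) (T : TwoTensor n M) (X : VField n M) : Prop :=
  ∀ e ∈ atlas (EuclideanSpace ℝ (Fin n)) M, ∀ z ∈ e.target ×ˢ (Set.univ : Set ℝ),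
    ∑ α, pd α (chartCurrent g e T X α) z = 0

/-- The density of the flux of energy-momentum through the level sets of `ψ`. -/
def fluxDensity (g : LorentzMetric n M) (T : TwoTensor n M) (X : VField n M) (ψ : M → ℝ)
    (p : M × ℝ) : ℝ :=
  (∑ α, energyMomentum g T X p α * dScalar (fun q : M × ℝ => ψ q.1) p (frame p α)) * lapse g p

lemma contDiffOn_chartCurrent (hs : SpacelikeSlices g) (hT : IsSmoothTensor T)
    (hX : ContMDiff (STModel n) (STModel n).tangent ∞
      (fun p => (⟨p, X p⟩ : TangentBundle (STModel n) (M × ℝ))))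
    (he : e ∈ atlas (EuclideanSpace ℝ (Fin n)) M) (α : Fin (n + 1)) :
    ContDiffOn ℝ ∞ (chartCurrent g e T X α) (e.target ×ˢ Set.univ) := by
  have hg := isMetricOn_comp g he
  have h1 : ContDiffOn ℝ ∞ (fun z => √((-1) ^ n * (comp e g.tensor z).det))
      (e.target ×ˢ Set.univ) :=
    (contDiffOn_const.mul (contDiffOn_det hg.smooth)).sqrt
      fun z hz => (signed_det_pos hs he hz.1).ne'
  have h2 : ContDiffOn ℝ ∞ (chartMomentum g e T X α) (e.target ×ˢ Set.univ) :=
    ContDiffOn.sum fun β _ => (contDiffOn_lower g.toSymTensorField he hX β).mul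
      (contDiffOn_raiseComp hg (hT.smooth e he) β α)
  exact h1.mul h2

lemma contDiffOn_comp_chart_symm (he : e ∈ atlas (EuclideanSpace ℝ (Fin n)) M) {ψ : M → ℝ}
    (hψ : ContMDiff (𝓡 n) 𝓘(ℝ, ℝ) ∞ ψ) : ContDiffOn ℝ ∞ (fun x => ψ (e.symm x)) e.target :=
  fun _ hx => ((hψ.contMDiffAt.comp _ (contMDiffAt_chart_symm he hx)).contDiffAt).contDiffWithinAt

lemma contDiffOn_comp_chart_symm_fst (he : e ∈ atlas (EuclideanSpace ℝ (Fin n)) M) {ψ : M → ℝ}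
    (hψ : ContMDiff (𝓡 n) 𝓘(ℝ, ℝ) ∞ ψ) :
    ContDiffOn ℝ ∞ (fun w : Coord n => ψ (e.symm w.1)) (e.target ×ˢ Set.univ) :=
  (contDiffOn_comp_chart_symm he hψ).comp contDiff_fst.contDiffOn fun _ hw => hw.1

lemma continuousOn_slice {F : Coord n → ℝ} (hF : ContDiffOn ℝ ∞ F (e.target ×ˢ Set.univ)) (t : ℝ) :
    ContinuousOn (fun x => F (x, t)) e.target :=
  hF.continuousOn.comp (continuous_id.prodMk continuous_const).continuousOn
    fun _ hx => ⟨hx, trivial⟩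

lemma continuous_energyDensity (hs : SpacelikeSlices g) (hT : IsSmoothTensor T)
    (hX : ContMDiff (STModel n) (STModel n).tangent ∞
      (fun p => (⟨p, X p⟩ : TangentBundle (STModel n) (M × ℝ)))) (t : ℝ) :
    Continuous fun x => energyDensity g T X (x, t) := by
  refine continuous_of_charts (n := n) fun e he => ?_
  refine ((continuousOn_slice (contDiffOn_chartCurrent hs hT hX he 0) t).div
    (continuousOn_slice (contDiffOn_chartDensity hs he) t)
    fun x hx => (chartDensity_pos hs he (y := (x, t)) hx).ne').congr fun x hx => ?_
  exact (eq_div_iff (chartDensity_pos hs he (y := (x, t)) hx).ne').mpr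
    (energyDensity_mul_chartDensity hs hT.bilin X he (y := (x, t)) hx)

lemma continuous_fluxDensity (hs : SpacelikeSlices g) (hT : IsSmoothTensor T)
    (hX : ContMDiff (STModel n) (STModel n).tangent ∞
      (fun p => (⟨p, X p⟩ : TangentBundle (STModel n) (M × ℝ)))) {ψ : M → ℝ}
    (hψ : ContMDiff (𝓡 n) 𝓘(ℝ, ℝ) ∞ ψ) (t : ℝ) :
    Continuous fun x => fluxDensity g T X ψ (x, t) := by
  refine continuous_of_charts (n := n) fun e he => ?_
  have h1 : ContDiffOn ℝ ∞ (fun y : Coord n => ∑ α, chartCurrent g e T X α y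
      * pd α (fun w : Coord n => ψ (e.symm w.1)) y) (e.target ×ˢ Set.univ) :=
    ContDiffOn.sum fun α _ => (contDiffOn_chartCurrent hs hT hX he α).mul
      (contDiffOn_pd (e.open_target.prod isOpen_univ) (contDiffOn_comp_chart_symm_fst he hψ) α)
  refine ((continuousOn_slice h1 t).div (continuousOn_slice (contDiffOn_chartDensity hs he) t)
    fun x hx => (chartDensity_pos hs he (y := (x, t)) hx).ne').congr fun x hx => ?_
  exact (eq_div_iff (chartDensity_pos hs he (y := (x, t)) hx).ne').mpr
    (flux_mul_chartDensity hs hT.bilin X he (y := (x, t)) hx hψ)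

lemma fluxDensity_eq_zero {ψ : M → ℝ} {x : M} (hx : x ∉ tsupport ψ) (t : ℝ) :
    fluxDensity g T X ψ (x, t) = 0 := by
  have hev : (fun q : M × ℝ => ψ q.1) =ᶠ[𝓝 (x, t)] fun _ => (0 : ℝ) := by
    filter_upwards [((isClosed_tsupport ψ).isOpen_compl.preimage continuous_fst).mem_nhds
      (show (x, t) ∈ Prod.fst ⁻¹' (tsupport ψ)ᶜ from hx)] with q hq
    exact image_eq_zero_of_notMem_tsupport hq
  have h : ∀ v, dScalar (n := n) (fun q : M × ℝ => ψ q.1) (x, t) v = 0 := by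
    intro v
    have h1 : mfderiv (STModel n) 𝓘(ℝ, ℝ) (fun q : M × ℝ => ψ q.1) (x, t) = 0 := by
      exact hev.mfderiv_eq.trans mfderiv_const
    exact DFunLike.congr_fun h1 v
  simp [fluxDensity, h]

lemma fluxDensity_sum {ι : Type*} (s : Finset ι) {ψ : ι → M → ℝ}
    (hψ : ∀ i, ContMDiff (𝓡 n) 𝓘(ℝ, ℝ) ∞ (ψ i)) (p : M × ℝ) :
    fluxDensity g T X (fun x => ∑ i ∈ s, ψ i x) p = ∑ i ∈ s, fluxDensity g T X (ψ i) p := by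
  classical
  have hmd : ∀ i, MDifferentiableAt (STModel n) 𝓘(ℝ, ℝ) (fun q : M × ℝ => ψ i q.1) p :=
    fun i => (((hψ i).comp contMDiff_fst).contMDiffAt).mdifferentiableAt (by simp)
  have key : ∀ v, dScalar (n := n) (fun q : M × ℝ => ∑ i ∈ s, ψ i q.1) p v
      = ∑ i ∈ s, dScalar (fun q : M × ℝ => ψ i q.1) p v := by
    intro v
    set f' : ι → TangentSpace (STModel n) p →L[ℝ] ℝ := fun i =>
      mfderiv (STModel n) 𝓘(ℝ, ℝ) (fun q : M × ℝ => ψ i q.1) p with hf'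
    have h0 : ∀ i ∈ s, HasMFDerivAt (STModel n) 𝓘(ℝ, ℝ) (fun q : M × ℝ => ψ i q.1) p (f' i) :=
      fun i _ => (hmd i).hasMFDerivAt
    have hs : HasMFDerivAt (STModel n) 𝓘(ℝ, ℝ) (∑ i ∈ s, fun q : M × ℝ => ψ i q.1) p
        (∑ i ∈ s, f' i) := by
      clear_value f'
      induction s using Finset.induction_on with
      | empty => exact hasMFDerivAt_const (I := STModel n) (I' := 𝓘(ℝ, ℝ)) (0 : ℝ) p
      | insert a s ha ih =>
        rw [Finset.sum_insert ha]
        exact ((h0 a (Finset.mem_insert_self a s)).add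
          (ih fun i hi => h0 i (Finset.mem_insert_of_mem hi))).congr_mfderiv
          (Finset.sum_insert (f := f') ha).symm
    have h := hs.mfderiv
    have hfun : (∑ i ∈ s, fun q : M × ℝ => ψ i q.1) = fun q : M × ℝ => ∑ i ∈ s, ψ i q.1 := by
      ext q
      simp
    rw [hfun] at h
    exact (DFunLike.congr_fun h v).trans (sum_apply _ _ _)
  simp only [fluxDensity, key, Finset.mul_sum, Finset.sum_mul]
  rw [Finset.sum_comm]

/-! ### Cutoffs supported in the domain of one chart. -/

section ChartCutoff

variable {ψ : M → ℝ}

variable (e ψ) in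
/-- The function `ψ` in the chart `e`, extended by zero. -/
def chartCutoff : EuclideanSpace ℝ (Fin n) → ℝ := e.target.indicator fun x => ψ (e.symm x)

lemma isCompact_image_tsupport (hc : HasCompactSupport ψ) (hsupp : tsupport ψ ⊆ e.source) :
    IsCompact (e '' tsupport ψ) :=
  hc.isCompact.image_of_continuousOn (e.continuousOn.mono hsupp)

lemma chartCutoff_eq_zero {x : EuclideanSpace ℝ (Fin n)} (hx : x ∉ e '' tsupport ψ) :
    chartCutoff e ψ x = 0 := by
  by_cases h : x ∈ e.target
  · rw [chartCutoff, Set.indicator_of_mem h]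
    by_contra h0
    exact hx ⟨e.symm x, subset_tsupport _ h0, e.right_inv h⟩
  · exact Set.indicator_of_notMem h _

lemma image_tsupport_subset (hsupp : tsupport ψ ⊆ e.source) : e '' tsupport ψ ⊆ e.target := by
  rintro _ ⟨x, hx, rfl⟩
  exact e.map_source (hsupp hx)

lemma tsupport_chartCutoff_subset (hc : HasCompactSupport ψ) (hsupp : tsupport ψ ⊆ e.source) :
    tsupport (chartCutoff e ψ) ⊆ e '' tsupport ψ :=
  closure_minimal (fun _ hx => by_contra fun h => hx (chartCutoff_eq_zero h))
    (isCompact_image_tsupport hc hsupp).isClosed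

lemma hasCompactSupport_chartCutoff (hc : HasCompactSupport ψ) (hsupp : tsupport ψ ⊆ e.source) :
    HasCompactSupport (chartCutoff e ψ) :=
  HasCompactSupport.intro (isCompact_image_tsupport hc hsupp) fun _ hx => chartCutoff_eq_zero hx

/-- Extension by zero is smooth because the image of the support is compact, hence closed in all of
`ℝⁿ` and not only in the chart target. -/
lemma contDiff_chartCutoff (he : e ∈ atlas (EuclideanSpace ℝ (Fin n)) M)
    (hψ : ContMDiff (𝓡 n) 𝓘(ℝ, ℝ) ∞ ψ) (hc : HasCompactSupport ψ)
    (hsupp : tsupport ψ ⊆ e.source) : ContDiff ℝ ∞ (chartCutoff e ψ) := by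
  rw [contDiff_iff_contDiffAt]
  intro x
  by_cases hx : x ∈ e.target
  · refine ((contDiffOn_comp_chart_symm he hψ).contDiffAt
      (e.open_target.mem_nhds hx)).congr_of_eventuallyEq ?_
    filter_upwards [e.open_target.mem_nhds hx] with z hz using Set.indicator_of_mem hz _
  · refine (contDiffAt_const (c := (0 : ℝ))).congr_of_eventuallyEq ?_
    filter_upwards [(isCompact_image_tsupport hc hsupp).isClosed.isOpen_compl.mem_nhds
      (fun h => hx (image_tsupport_subset hsupp h))] with z hz using chartCutoff_eq_zero hz

variable [MeasurableSpace M] [BorelSpace M]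

lemma integral_cutoff_energyDensity (hs : SpacelikeSlices g) (hT : IsSmoothTensor T)
    (hX : ContMDiff (STModel n) (STModel n).tangent ∞
      (fun p => (⟨p, X p⟩ : TangentBundle (STModel n) (M × ℝ))))
    (he : e ∈ atlas (EuclideanSpace ℝ (Fin n)) M)
    (hψ : ContMDiff (𝓡 n) 𝓘(ℝ, ℝ) ∞ ψ)
    (hsupp : tsupport ψ ⊆ e.source) (t : ℝ) :
    ∫ x, ψ x * energyDensity g T X (x, t) ∂(sliceVolume g t)
      = ∫ x, chartCutoff e ψ x * chartCurrent g e T X 0 (x, t) := by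
  rw [integral_sliceVolume (f := fun x => ψ x * energyDensity g T X (x, t)) hs he t
    (hψ.continuous.mul (continuous_energyDensity hs hT hX t))
    fun x hx => by rw [image_eq_zero_of_notMem_tsupport fun h => hx (hsupp h), zero_mul]]
  rw [← setIntegral_eq_integral_of_forall_compl_eq_zero (s := e.target)
    (f := fun x => chartCutoff e ψ x * chartCurrent g e T X 0 (x, t))]
  · refine setIntegral_congr_fun e.open_target.measurableSet fun x hx => ?_
    have := energyDensity_mul_chartDensity hs hT.bilin X he (y := (x, t)) hx
    simp only [chartCutoff, Set.indicator_of_mem hx]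
    rw [← this, mul_assoc]
    rfl
  · intro x hx
    rw [chartCutoff, Set.indicator_of_notMem hx, zero_mul]

lemma integral_fluxDensity (hs : SpacelikeSlices g) (hT : IsSmoothTensor T)
    (hX : ContMDiff (STModel n) (STModel n).tangent ∞
      (fun p => (⟨p, X p⟩ : TangentBundle (STModel n) (M × ℝ))))
    (he : e ∈ atlas (EuclideanSpace ℝ (Fin n)) M)
    (hψ : ContMDiff (𝓡 n) 𝓘(ℝ, ℝ) ∞ ψ) (hc : HasCompactSupport ψ)
    (hsupp : tsupport ψ ⊆ e.source) (t : ℝ) :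
    ∫ x, fluxDensity g T X ψ (x, t) ∂(sliceVolume g t)
      = ∫ x, ∑ α, chartCurrent g e T X α (x, t)
        * pd α (fun w : Coord n => chartCutoff e ψ w.1) (x, t) := by
  rw [integral_sliceVolume hs he t (continuous_fluxDensity hs hT hX hψ t)
    fun x hx => fluxDensity_eq_zero (fun h => hx (hsupp h)) t]
  rw [← setIntegral_eq_integral_of_forall_compl_eq_zero (s := e.target)
    (f := fun x => ∑ α, chartCurrent g e T X α (x, t)
        * pd α (fun w : Coord n => chartCutoff e ψ w.1) (x, t))]
  · refine setIntegral_congr_fun e.open_target.measurableSet fun x hx => ?_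
    refine (flux_mul_chartDensity hs hT.bilin X he (y := (x, t)) hx hψ).trans ?_
    refine Finset.sum_congr rfl fun α _ => ?_
    congr 1
    refine pd_congr (e.open_target.prod isOpen_univ) (fun w hw => ?_) α (y := (x, t)) ⟨hx, trivial⟩
    exact (Set.indicator_of_mem hw.1 fun x => ψ (e.symm x)).symm
  · intro x hx
    refine Finset.sum_eq_zero fun α _ => ?_
    rw [pd_eq_zero_of_notMem_tsupport (H := fun w : Coord n => chartCutoff e ψ w.1)
      (isCompact_image_tsupport hc hsupp).isClosed
      (fun z hz => chartCutoff_eq_zero hz) α (z := (x, t))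
      (fun h => hx (image_tsupport_subset hsupp h)), mul_zero]

lemma balance_of_support_in_chart (hs : SpacelikeSlices g) (hT : IsSmoothTensor T)
    (hX : ContMDiff (STModel n) (STModel n).tangent ∞
      (fun p => (⟨p, X p⟩ : TangentBundle (STModel n) (M × ℝ)))) (hcons : CurrentConserved g T X)
    (he : e ∈ atlas (EuclideanSpace ℝ (Fin n)) M)
    (hψ : ContMDiff (𝓡 n) 𝓘(ℝ, ℝ) ∞ ψ) (hc : HasCompactSupport ψ)
    (hsupp : tsupport ψ ⊆ e.source) (t₀ t₁ : ℝ) :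
    (Continuous fun t => ∫ x, fluxDensity g T X ψ (x, t) ∂(sliceVolume g t)) ∧
    ∫ t in t₀..t₁, ∫ x, fluxDensity g T X ψ (x, t) ∂(sliceVolume g t)
      = (∫ x, ψ x * energyDensity g T X (x, t₁) ∂(sliceVolume g t₁))
        - ∫ x, ψ x * energyDensity g T X (x, t₀) ∂(sliceVolume g t₀) := by
  have h1 := contDiff_chartCutoff he hψ hc hsupp
  have h2 := hasCompactSupport_chartCutoff hc hsupp
  have h3 := (tsupport_chartCutoff_subset hc hsupp).trans (image_tsupport_subset hsupp)
  have h4 := contDiffOn_chartCurrent hs hT hX he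
  simp only [integral_fluxDensity hs hT hX he hψ hc hsupp,
    integral_cutoff_energyDensity hs hT hX he hψ hsupp]
  exact ⟨continuous_integral_current_cutoff e.open_target h1 h3 h2 h4 (hcons e he),
    balance_cutoff e.open_target h1 h3 h2 h4 (hcons e he) t₀ t₁⟩

end ChartCutoff

variable [MeasurableSpace M] [BorelSpace M] [T2Space M] [SigmaCompactSpace M]

/-- The balance law for a cutoff with compact support. -/
lemma balance_of_hasCompactSupport (hs : SpacelikeSlices g) (hT : IsSmoothTensor T)
    (hX : ContMDiff (STModel n) (STModel n).tangent ∞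
      (fun p => (⟨p, X p⟩ : TangentBundle (STModel n) (M × ℝ)))) (hcons : CurrentConserved g T X)
    {χ : M → ℝ} (hχ : ContMDiff (𝓡 n) 𝓘(ℝ, ℝ) ∞ χ) (hc : HasCompactSupport χ) (t₀ t₁ : ℝ) :
    ∫ t in t₀..t₁, ∫ x, fluxDensity g T X χ (x, t) ∂(sliceVolume g t)
      = (∫ x, χ x * energyDensity g T X (x, t₁) ∂(sliceVolume g t₁))
        - ∫ x, χ x * energyDensity g T X (x, t₀) ∂(sliceVolume g t₀) := by
  -- Only finitely many members of the partition meet the compact support of `χ`, so `χ` is a finite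
  -- sum of cutoffs each supported in one chart.
  obtain ⟨ρ, hρ⟩ := SmoothPartitionOfUnity.exists_isSubordinate_chartAt_source (𝓡 n) M
  have hfin := ρ.locallyFinite.finite_nonempty_inter_compact hc.isCompact
  set s := hfin.toFinset with hsdef
  set ψ : M → M → ℝ := fun i x => ρ i x * χ x with hψdef
  have hψ : ∀ i, ContMDiff (𝓡 n) 𝓘(ℝ, ℝ) ∞ (ψ i) := fun i => (ρ i).contMDiff.mul hχ
  have hψc : ∀ i, HasCompactSupport (ψ i) := fun i => hc.mul_left
  have hψs : ∀ i, tsupport (ψ i) ⊆ (chartAt (EuclideanSpace ℝ (Fin n)) i).source := fun i =>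
    (closure_mono (Function.support_mul_subset_left _ _)).trans (hρ i)
  have hsum : ∀ x, χ x = ∑ i ∈ s, ψ i x := by
    intro x
    by_cases hx : x ∈ tsupport χ
    · have h1 : ρ.finsupport x ⊆ s := by
        intro i hi
        rw [hsdef, Set.Finite.mem_toFinset]
        exact ⟨x, (ρ.mem_finsupport x).mp hi, hx⟩
      rw [hψdef, ← Finset.sum_mul, ρ.sum_finsupport' x (Set.mem_univ x) h1, one_mul]
    · simp [hψdef, image_eq_zero_of_notMem_tsupport hx]
  have hb := fun i => balance_of_support_in_chart hs hT hX hcons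
    (chart_mem_atlas (EuclideanSpace ℝ (Fin n)) i) (hψ i) (hψc i) (hψs i) t₀ t₁
  have hfl : ∀ t, ∫ x, fluxDensity g T X χ (x, t) ∂(sliceVolume g t)
      = ∑ i ∈ s, ∫ x, fluxDensity g T X (ψ i) (x, t) ∂(sliceVolume g t) := by
    intro t
    have := isLocallyFiniteMeasure_sliceVolume hs t
    rw [← integral_finsetSum]
    · refine integral_congr_ae (ae_of_all _ fun x => ?_)
      change fluxDensity g T X χ (x, t) = ∑ i ∈ s, fluxDensity g T X (ψ i) (x, t)
      rw [← fluxDensity_sum s hψ, ← funext hsum]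
    · exact fun i _ => (continuous_fluxDensity hs hT hX (hψ i) t).integrable_of_hasCompactSupport
        (HasCompactSupport.intro (hψc i) fun x hx => fluxDensity_eq_zero hx t)
  have hen : ∀ t, ∫ x, χ x * energyDensity g T X (x, t) ∂(sliceVolume g t)
      = ∑ i ∈ s, ∫ x, ψ i x * energyDensity g T X (x, t) ∂(sliceVolume g t) := by
    intro t
    have := isLocallyFiniteMeasure_sliceVolume hs t
    rw [← integral_finsetSum]
    · refine integral_congr_ae (ae_of_all _ fun x => ?_)
      simp only [hsum x, Finset.sum_mul]
    · exact fun i _ => ((hψ i).continuous.mul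
        (continuous_energyDensity hs hT hX t)).integrable_of_hasCompactSupport (hψc i).mul_right
  simp only [hfl, hen]
  rw [intervalIntegral.integral_finsetSum fun i _ => (hb i).1.intervalIntegrable _ _,
    ← Finset.sum_sub_distrib]
  exact Finset.sum_congr rfl fun i _ => (hb i).2

/-- If the current is conserved and there is no flux at infinity, then the energy of the slices is
conserved. -/
theorem integral_energyDensity_eq (hs : SpacelikeSlices g) (hT : IsSmoothTensor T)
    (hX : ContMDiff (STModel n) (STModel n).tangent ∞
      (fun p => (⟨p, X p⟩ : TangentBundle (STModel n) (M × ℝ)))) (hcons : CurrentConserved g T X)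
    {t₀ t₁ : ℝ} (h₀ : Integrable (fun x => energyDensity g T X (x, t₀)) (sliceVolume g t₀))
    (h₁ : Integrable (fun x => energyDensity g T X (x, t₁)) (sliceVolume g t₁))
    (hdecay : CompactSpace M ∨ NoFluxAtInfinity g T X t₀ t₁) :
    ∫ x, energyDensity g T X (x, t₁) ∂(sliceVolume g t₁)
      = ∫ x, energyDensity g T X (x, t₀) ∂(sliceVolume g t₀) := by
  have hflux : NoFluxAtInfinity g T X t₀ t₁ := by
    -- On a compact `M` the constant cutoff `1` is admissible, and its differential vanishes.
    refine hdecay.elim (fun hM => ?_) id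
    refine ⟨fun _ _ => 1, fun _ => ⟨contMDiff_const, HasCompactSupport.of_compactSpace _,
      fun _ => ⟨zero_le_one, le_rfl⟩⟩, fun _ _ => Eventually.of_forall fun _ _ _ => rfl, ?_⟩
    have h : ∀ p v, dScalar (n := n) (fun _ : M × ℝ => (1 : ℝ)) p v = 0 := fun p v =>
      DFunLike.congr_fun (mfderiv_const (I := STModel n) (I' := 𝓘(ℝ, ℝ)) (c := (1 : ℝ)) (x := p)) v
    simp [h]
  obtain ⟨χ, hχ, hχ1, hlim⟩ := hflux
  -- Dominated convergence with the energy density as majorant; each point is a compact set, so the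
  -- cutoffs are eventually `1` there.
  have hE : ∀ t, Integrable (fun x => energyDensity g T X (x, t)) (sliceVolume g t) →
      Tendsto (fun k => ∫ x, χ k x * energyDensity g T X (x, t) ∂(sliceVolume g t)) atTop
        (𝓝 (∫ x, energyDensity g T X (x, t) ∂(sliceVolume g t))) := by
    intro t ht
    refine tendsto_integral_of_dominated_convergence (fun x => ‖energyDensity g T X (x, t)‖)
      (fun k => ?_) ht.norm (fun k => ae_of_all _ fun x => ?_) (ae_of_all _ fun x => ?_)
    · exact ((hχ k).1.continuous.aestronglyMeasurable).mul ht.aestronglyMeasurable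
    · rw [norm_mul]
      refine mul_le_of_le_one_left (norm_nonneg _) ?_
      rw [Real.norm_of_nonneg ((hχ k).2.2 x).1]
      exact ((hχ k).2.2 x).2
    · refine tendsto_const_nhds.congr' ?_
      filter_upwards [hχ1 {x} isCompact_singleton] with k hk
      rw [hk x rfl, one_mul]
  have hlim2 := (hE t₁ h₁).sub (hE t₀ h₀)
  have hlim3 : Tendsto (fun k => (∫ x, χ k x * energyDensity g T X (x, t₁) ∂(sliceVolume g t₁))
      - ∫ x, χ k x * energyDensity g T X (x, t₀) ∂(sliceVolume g t₀)) atTop (𝓝 0) := by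
    refine hlim.congr fun k => ?_
    exact balance_of_hasCompactSupport hs hT hX hcons (hχ k).1 (hχ k).2.1 t₀ t₁
  exact sub_eq_zero.mp (tendsto_nhds_unique hlim2 hlim3)

end GlobalBalance

/-! ### The Einstein equations with a scalar field -/

section FieldEquations

variable {n : ℕ} {M : Type*} [TopologicalSpace M] [ChartedSpace (EuclideanSpace ℝ (Fin n)) M]
  [IsManifold (𝓡 n) ∞ M] {g : LorentzMetric n M}

lemma IsBilin.add {S T : TwoTensor n M} (hS : IsBilin S) (hT : IsBilin T) :
    IsBilin (fun p v w => S p v w + T p v w) := by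
  intro p
  obtain ⟨L, hL⟩ := hS p
  obtain ⟨L', hL'⟩ := hT p
  exact ⟨L + L', fun v w => congrArg₂ (· + ·) (hL v w) (hL' v w)⟩

lemma isBilin_scalarStress (g : LorentzMetric n M) (φ V : M × ℝ → ℝ) :
    IsBilin (scalarStress g φ V) := by
  intro p
  obtain ⟨L, hL⟩ := g.toSymTensorField.isBilin p
  set d : Coord n →ₗ[ℝ] ℝ := (mfderiv (STModel n) 𝓘(ℝ, ℝ) φ p : Coord n →L[ℝ] ℝ).toLinearMap
    with hd
  set c : ℝ := ∑ α, ∑ β, invMetric g p α β * dScalar φ p (frame p α) * dScalar φ p (frame p β)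
    - 2 * V p with hc
  refine ⟨d.smulRight d - ((1 / 2) * c) • L, fun v w => ?_⟩
  have h : scalarStress g φ V p v w = d v * d w - (1 / 2) * L v w * c :=
    congrArg (fun x => d v * d w - (1 / 2) * x * c) (hL v w)
  rw [h]
  simp only [LinearMap.sub_apply, LinearMap.smulRight_apply, LinearMap.smul_apply, smul_eq_mul]
  ring

lemma scalarStress_symm (g : LorentzMetric n M) (φ V : M × ℝ → ℝ) (p : M × ℝ)
    (v w : TangentSpace (STModel n) p) : scalarStress g φ V p v w = scalarStress g φ V p w v := by
  unfold scalarStress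
  rw [show g.tensor p v w = g.tensor p w v from g.symm p v w, mul_comm (dScalar φ p v)]

lemma isSmoothTensor_tensor (S : SymTensorField n M) : IsSmoothTensor S.tensor :=
  ⟨S.isBilin, fun _ he => contDiffOn_comp S he⟩

/-- Regularity of the source comes from the geometry: its components equal those of the Einstein
tensor of a smooth metric. -/
lemma EinsteinEquations.isSmoothTensor {T : TwoTensor n M} (h : EinsteinEquations g T)
    (hT : IsBilin T) : IsSmoothTensor T :=
  ⟨hT, fun e he α β => (contDiffOn_einsteinComp (isMetricOn_comp g he) α β).congr
    fun y hy => (h e he y hy.1 α β).symm⟩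

/-- Gives the smoothness of the scalar stress tensor as total minus matter, without differentiating
`φ` and `V`. -/
lemma IsSmoothTensor.of_add_right {S T : TwoTensor n M} (hS : IsBilin S) (hT : IsSmoothTensor T)
    (h : IsSmoothTensor fun p v w => S p v w + T p v w) : IsSmoothTensor S :=
  ⟨hS, fun e he α β => ((h.smooth e he α β).sub (hT.smooth e he α β)).congr
    fun _ _ => (add_sub_cancel_right _ _).symm⟩

lemma EinsteinEquations.isConserved {T : TwoTensor n M} (h : EinsteinEquations g T) :
    IsConserved g T := by
  intro e he y hy β
  have hg := isMetricOn_comp g he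
  rw [← divComp_congr hg.isOpen (fun z hz α β => h e he z hz.1 α β) β ⟨hy, trivial⟩]
  exact divComp_einsteinComp hg ⟨hy, trivial⟩ β

lemma IsConserved.currentConserved (hs : SpacelikeSlices g) {T : TwoTensor n M}
    (h : IsConserved g T) (hT : IsSmoothTensor T) (hsymm : ∀ p v w, T p v w = T p w v)
    {X : VField n M} (hX : ContMDiff (STModel n) (STModel n).tangent ∞
      (fun p => (⟨p, X p⟩ : TangentBundle (STModel n) (M × ℝ)))) (hK : IsKilling g X) :
    CurrentConserved g T X := fun e he _ hz =>
  sum_pd_density_eq_zero (isMetricOn_comp g he) (fun _ hy => signed_det_pos hs he hy.1)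
    (hT.smooth e he) (fun _ _ _ _ => hsymm _ _ _) (fun y hy => h e he y hy.1)
    (contDiffOn_lower g.toSymTensorField he hX) (fun y hy => hK e he y hy.1) hz

lemma energyDensity_add (S T : TwoTensor n M) (X : VField n M) (p : M × ℝ) :
    energyDensity g (fun p v w => S p v w + T p v w) X p
      = energyDensity g S X p + energyDensity g T X p := by
  simp only [energyDensity, energyMomentum, raiseAt, mul_add, add_mul, Finset.sum_add_distrib]

lemma coordOf_coordVec (α β : Fin (n + 1)) :
    coordOf (coordVec n α) β = (1 : Matrix (Fin (n + 1)) (Fin (n + 1)) ℝ) α β := by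
  refine Fin.cases ?_ (fun i => ?_) α <;> refine Fin.cases ?_ (fun j => ?_) β <;>
    simp [coordOf, coordVec, Matrix.one_apply, Fin.succ_ne_zero, eq_comm]

lemma einsteinTensor_frame (p : M × ℝ) (γ δ : Fin (n + 1)) :
    einsteinTensor g p (frame p γ) (frame p δ)
      = einsteinComp (comp (chartAt (EuclideanSpace ℝ (Fin n)) p.1) g.tensor) (coordsAt p) γ δ := by
  have h : ∀ α β, coordOf (n := n) (frame p α) β
      = (1 : Matrix (Fin (n + 1)) (Fin (n + 1)) ℝ) α β := coordOf_coordVec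
  simp only [einsteinTensor, h, Matrix.one_apply, mul_ite, mul_one, mul_zero,
    Finset.sum_ite_eq, Finset.mem_univ, if_true]

lemma EinsteinEquations.einsteinTensor_eq {T : TwoTensor n M} (h : EinsteinEquations g T)
    (p : M × ℝ) (γ δ : Fin (n + 1)) :
    einsteinTensor g p (frame p γ) (frame p δ) = T p (frame p γ) (frame p δ) :=
  (einsteinTensor_frame p γ δ).trans
    ((h _ (chart_mem_atlas _ _) _ (coordsAt_mem p) γ δ).trans (comp_coordsAt T p γ δ))

/-- The integrands agree pointwise by the field equations, so no integrability is required. -/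
lemma EinsteinEquations.gravFlux_eq [MeasurableSpace M] {T : TwoTensor n M}
    (h : EinsteinEquations g T) (X : VField n M) (t : ℝ) :
    gravFlux g X t = sliceEnergy g T X t := by
  unfold gravFlux sliceEnergy
  refine integral_congr_ae (ae_of_all _ fun x => ?_)
  simp only [energyDensity, energyMomentum, raiseAt, h.einsteinTensor_eq, Finset.sum_mul]
  rw [Finset.sum_comm]
  refine Finset.sum_congr rfl fun α _ => Finset.sum_congr rfl fun β _ => ?_
  simp only [Finset.mul_sum, Finset.sum_mul]
  exact Finset.sum_congr rfl fun γ _ => Finset.sum_congr rfl fun δ _ => by ring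

lemma sliceEnergyExists_of_compactSpace [MeasurableSpace M] [BorelSpace M] [T2Space M]
    [SigmaCompactSpace M] [CompactSpace M] (hs : SpacelikeSlices g) {T : TwoTensor n M}
    (hT : IsSmoothTensor T) {X : VField n M} (hX : ContMDiff (STModel n) (STModel n).tangent ∞
      (fun p => (⟨p, X p⟩ : TangentBundle (STModel n) (M × ℝ)))) (t : ℝ) :
    SliceEnergyExists g T X t := by
  have := isLocallyFiniteMeasure_sliceVolume hs t
  exact (continuous_energyDensity hs hT hX t).integrable_of_hasCompactSupport
    (HasCompactSupport.of_compactSpace _)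

end FieldEquations

end

theorem theorem2 {n : ℕ} {M : Type*} [TopologicalSpace M]
    [ChartedSpace (EuclideanSpace ℝ (Fin n)) M] [IsManifold (𝓡 n) ∞ M]
    [T2Space M] [SigmaCompactSpace M] [MeasurableSpace M] [BorelSpace M]
    (g gE : LorentzMetric n M)
    (Ω : M × ℝ → ℝ) (hΩ : ∀ p, 0 < Ω p)
    (hconf : ∀ p v w, gE.tensor p v w = Ω p ^ 2 * g.tensor p v w)
    (hslices : SpacelikeSlices gE)
    (f : ℝ → ℝ) (hf : ∀ p, ContDiffAt ℝ ∞ f (scalarCurvature g p))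
    (hf' : ∀ p, 0 < deriv f (scalarCurvature g p))
    (Tφ : TwoTensor n M) (hTφ : Tφ = scalarStress gE (inflaton f g) (inflatonPotential f g))
    (Tψ : SymTensorField n M)
    (hfield : EinsteinEquations gE (fun p v w => Tφ p v w + Tψ.tensor p v w))
    (X : VField n M)
    (hX : ContMDiff (STModel n) (STModel n).tangent ∞
      (fun p => (⟨p, X p⟩ : TangentBundle (STModel n) (M × ℝ))))
    (t₀ t₁ : ℝ)
    (hdecay : CompactSpace M ∨
      ((∀ t, t = t₀ ∨ t = t₁ →
          SliceEnergyExists gE Tφ X t ∧ SliceEnergyExists gE Tψ.tensor X t) ∧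
        NoFluxAtInfinity gE (fun p v w => Tφ p v w + Tψ.tensor p v w) X t₀ t₁)) :
    IsConserved gE (fun p v w => Tφ p v w + Tψ.tensor p v w) ∧
    (sliceEnergy gE Tφ X t₁ + sliceEnergy gE Tψ.tensor X t₁)
        - (sliceEnergy gE Tφ X t₀ + sliceEnergy gE Tψ.tensor X t₀)
      = gravFlux gE X t₁ - gravFlux gE X t₀ ∧
    (IsKilling gE X →
      sliceEnergy gE Tφ X t₁ + sliceEnergy gE Tψ.tensor X t₁
        = sliceEnergy gE Tφ X t₀ + sliceEnergy gE Tψ.tensor X t₀) := by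
  set T : TwoTensor n M := fun p v w => Tφ p v w + Tψ.tensor p v w with hTdef
  have hbφ : IsBilin Tφ := hTφ ▸ isBilin_scalarStress _ _ _
  have hψ := isSmoothTensor_tensor Tψ
  have hT : IsSmoothTensor T := hfield.isSmoothTensor (hbφ.add hψ.bilin)
  have hφ : IsSmoothTensor Tφ := .of_add_right hbφ hψ hT
  have hsymm : ∀ p v w, T p v w = T p w v := fun p v w =>
    congrArg₂ (· + ·) (hTφ ▸ scalarStress_symm gE _ _ p v w) (Tψ.symm p v w)
  have hint : ∀ t, t = t₀ ∨ t = t₁ →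
      SliceEnergyExists gE Tφ X t ∧ SliceEnergyExists gE Tψ.tensor X t :=
    hdecay.elim (fun _ t _ => ⟨sliceEnergyExists_of_compactSpace hslices hφ hX t,
      sliceEnergyExists_of_compactSpace hslices hψ hX t⟩) And.left
  have hTint : ∀ t, t = t₀ ∨ t = t₁ → SliceEnergyExists gE T X t := fun t ht =>
    ((hint t ht).1.add (hint t ht).2).congr
      (ae_of_all _ fun x => (energyDensity_add Tφ Tψ.tensor X (x, t)).symm)
  -- Existence of the two separate energies is what allows their integrals to be added; the total
  -- energy is then the gravitational flux, and the balance becomes an identity.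
  have hadd : ∀ t, t = t₀ ∨ t = t₁ →
      sliceEnergy gE Tφ X t + sliceEnergy gE Tψ.tensor X t = sliceEnergy gE T X t := fun t ht =>
    (integral_add (hint t ht).1 (hint t ht).2).symm.trans
      (integral_congr_ae (ae_of_all _ fun x => (energyDensity_add Tφ Tψ.tensor X (x, t)).symm))
  have hcons := hfield.isConserved
  rw [hadd t₀ (.inl rfl), hadd t₁ (.inr rfl), hfield.gravFlux_eq, hfield.gravFlux_eq]
  exact ⟨hcons, rfl, fun hK => integral_energyDensity_eq hslices hT hX
    (hcons.currentConserved hslices hT hsymm hX hK) (hTint t₀ (.inl rfl)) (hTint t₁ (.inr rfl))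
    (hdecay.imp_right And.right)⟩
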